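/- **Conventions.** For a finitely generated free abelian group $N$ put $N_\mathbb{R}=N\otimes\mathbb{R}$ and $M=\mathrm{Hom}(N,\mathbb{Z})$. A unimodular fan $\Sigma$ in $N_\mathbb{R}$ is a finite rational fan containing the origin in which every cone is generated by part of a $\mathbb{Z}$-basis of $N$; it is complete if its support $|\Sigma|$ is $N_\mathbb{R}$. $\Sigma(1)$ is its set of rays, $u_\rho$ is the generator of the ray $\rho$, and $\Sigma^\rho$ is the star fan at $\rho$, a unimodular fan in $N^\rho_\mathbb{R}$ where $N^\rho=N/\mathbb{Z}u_\rho$. $\mathrm{PL}(\Sigma)$ is the group of functions $|\Sigma|\to\mathbb{R}$ that agree on each cone with an element of $M$, $\underline{\mathrm{PL}}(\Sigma)$ is its quotient by the restrictions of elements of $M$, and $\delta_\rho\in\mathrm{PL}(\Sigma)$ has value $1$ at $u_\rho$ and $0$ at all other ray generators. For $f\in \mathrm{PL}(\Sigma)$, $[f]^\rho\in\underline{\mathrm{PL}}(\Sigma^\rho)$ is the class of the function on $|\Sigma^\rho|$ induced by $f-m$, where $m\in M$ agrees with $f$ on $\rho$. Recursively on dimension, a unimodular fan $\Sigma$ is *Ehrhart*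 if all $\Sigma^\rho$, $\rho\in\Sigma(1)$, are Ehrhart and there is a function $\chi_\Sigma:\underline{\mathrm{PL}}(\Sigma)\to\mathbb{Z}$, called its *Ehrhart polynomial*, with $\chi_\Sigma(0)=1$ and $\chi_\Sigma([f])=\chi_\Sigma([f-\delta_\rho])+\chi_{\Sigma^\rho}([f]^\rho)$ for all $f\in\mathrm{PL}(\Sigma)$ and $\rho\in\Sigma(1)$. Let $0\to N'\to N\xrightarrow{\pi}N''\to0$ be a short exact sequence of finitely generated free abelian groups and let $\Sigma',\Sigma''$ be unimodular fans in $N'_\mathbb{R},N''_\mathbb{R}$. A *$\Sigma'$-bundle over $\Sigma''$* is a unimodular fan $\Sigma$ in $N_\mathbb{R}$ such that (1) $|\Sigma|\cap N'_\mathbb{R}=|\Sigma'|$; (2) there is a subfan $\widetilde\Sigma\subseteq\Sigma$ such that $\pi$ is injective on $|\widetilde\Sigma|$, $\widetilde\sigma\mapsto\pi(\widetilde\sigma)$ is a bijection $\widetilde\Sigma\to\Sigma''$, and $\pi(\widetilde\sigma\cap N)=\pi(\widetilde\sigma)\cap N''$ for all $\widetilde\sigma\in\widetilde\Sigma$; (3)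 $(\sigma',\widetilde\sigma)\mapsto\sigma'+\widetilde\sigma$ is a bijection $\Sigma'\times\widetilde\Sigma\to\Sigma$. For $f\in\mathrm{PL}(\Sigma)$ let $f'\in\mathrm{PL}(\Sigma')$ be the restriction of $f$ to $|\Sigma'|$, and let $f''\in\mathrm{PL}(\Sigma'')$ be the function with $f''(u_{\pi(\rho)})=f(u_\rho)$ for all $\rho\in\widetilde\Sigma(1)$, that is, $f''(\pi(x))=f(x)$ for $x\in|\widetilde\Sigma|$. **Proposition.** Let $\Sigma$ be a $\Sigma'$-bundle over $\Sigma''$ as above, and assume that $\Sigma'$ is complete. Then $\Sigma$ is Ehrhart if and only if $\Sigma''$ is Ehrhart. In this case, choose any splitting $N=N'\oplus N''$ of the exact sequence and use it to view each $m'\in M'=\mathrm{Hom}(N',\mathbb{Z})$ as a linear function on $N_\mathbb{R}$. Then, for every $f\in\mathrm{PL}(\Sigma)$, $$\chi_\Sigma([f])=(-1)^{\dim\Sigma'}\sum_{m'\in M'}\Big(\sum_{\sigma\in\Sigma'_{f',m'}}(-1)^{\dim\sigma}\Big)\,\chi_{\Sigma''}\big([(f-m')'']\big),$$ where $\Sigma'_{f',m'}=\{\sigma\in\Sigma'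 : m'(x)\le f'(x)\text{ for all }x\in\sigma\}$, and the inner sum is nonzero for only finitely many $m'\in M'$. -/

import Mathlib

open scoped TensorProduct

noncomputable section

namespace EhrhartFan

/-! Lattices, cones and fans. A lattice is a finitely generated free abelian group `N`, with
`N_ℝ = ℝ ⊗ N` and dual `M = Hom(N, ℤ)`, which is the type `N →+ ℤ`. -/

/-- The real vector space `N_ℝ` of an abelian group `N`. -/
abbrev RealSpace (N : Type*) [AddCommGroup N] : Type _ := ℝ ⊗[ℤ] N

/-- The lattice vector `v` as an element of `N_ℝ`. -/
def latticePoint {N : Type*} [AddCommGroup N] (v : N) : RealSpace N := (1 : ℝ) ⊗ₜ[ℤ] v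

/-- The real-linear map `N_ℝ → P_ℝ` induced by a homomorphism `N → P`. -/
def realMap {N P : Type*} [AddCommGroup N] [AddCommGroup P] (φ : N →+ P) :
    RealSpace N →ₗ[ℝ] RealSpace P :=
  φ.toIntLinearMap.baseChange ℝ

/-- The integral linear function on `N_ℝ` given by `m ∈ M`. -/
def pairing {N : Type*} [AddCommGroup N] (m : N →+ ℤ) : RealSpace N →ₗ[ℝ] ℝ :=
  ((Int.castAddHom ℝ).comp m).toIntLinearMap.liftBaseChange ℝ

/-- Convex cones in `N_ℝ` containing the origin. -/
abbrev Cone (N : Type*) [AddCommGroup N] : Type _ := PointedCone ℝ (RealSpace N)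

/-- A rational cone is a finite intersection of closed rational halfspaces. -/
def IsRationalCone {N : Type*} [AddCommGroup N] (σ : Cone N) : Prop :=
  ∃ S : Finset (N →+ ℤ), ∀ x, x ∈ σ ↔ ∀ m ∈ S, 0 ≤ pairing m x

/-- `IsFace τ σ`: the set `τ` is a face of `σ`, that is `τ = σ ∩ {m ≥ 0}` for an integral linear
function `m` for which `σ ∩ {m > 0}` is empty. -/
def IsFace {N : Type*} [AddCommGroup N] (τ σ : Cone N) : Prop :=
  ∃ m : N →+ ℤ, (∀ x ∈ σ, ¬ 0 < pairing m x) ∧ ∀ x, x ∈ τ ↔ x ∈ σ ∧ 0 ≤ pairing m x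

/-- The dimension of the linear span of a cone. -/
def coneDim {N : Type*} [AddCommGroup N] (σ : Cone N) : ℕ :=
  Module.finrank ℝ (Submodule.span ℝ (σ : Set (RealSpace N)))

/-- The set of lattice vectors `σ ∩ N`. -/
def latticeSet {N : Type*} [AddCommGroup N] (σ : Cone N) : Set N :=
  {v | latticePoint v ∈ σ}

/-- A rational fan: a finite collection of rational cones, closed under taking faces, any two of
which meet in a common face. -/
structure IsRationalFan {N : Type*} [AddCommGroup N] (F : Set (Cone N)) : Prop where
  finite : F.Finite
  rational : ∀ σ ∈ F, IsRationalCone σ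
  face_mem : ∀ σ ∈ F, ∀ τ, IsFace τ σ → τ ∈ F
  inter_face : ∀ σ₁ ∈ F, ∀ σ₂ ∈ F, IsFace (σ₁ ⊓ σ₂) σ₁ ∧ IsFace (σ₁ ⊓ σ₂) σ₂

/-- A unimodular fan: a rational fan containing the origin, each of whose cones is spanned by part
of a `ℤ`-basis of `N` (these basis vectors are then the ray generators of the cone). -/
structure IsUnimodularFan {N : Type*} [AddCommGroup N] (F : Set (Cone N)) : Prop extends
    IsRationalFan F where
  origin_mem : ⊥ ∈ F
  unimodular : ∀ σ ∈ F, ∃ (n : ℕ) (b : Module.Basis (Fin n) ℤ N) (s : Set (Fin n)),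
    σ = PointedCone.hull ℝ ((fun j => latticePoint (b j)) '' s)

/-- The support `|Σ|` of a fan. -/
def support {N : Type*} [AddCommGroup N] (F : Set (Cone N)) : Set (RealSpace N) :=
  {x | ∃ σ ∈ F, x ∈ σ}

/-- A fan is complete if its support is all of `N_ℝ`. -/
def IsComplete {N : Type*} [AddCommGroup N] (F : Set (Cone N)) : Prop :=
  support F = Set.univ

/-- The dimension of a fan: the largest dimension of a cone in it. -/
def fanDim {N : Type*} [AddCommGroup N] (F : Set (Cone N)) : ℕ :=
  sSup (coneDim '' F)

/-- The set `Σ(1)` of one-dimensional cones. -/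
def rays {N : Type*} [AddCommGroup N] (F : Set (Cone N)) : Set (Cone N) :=
  {ρ | ρ ∈ F ∧ coneDim ρ = 1}

/-- `u` is the generator of the ray `ρ`: the monoid `ρ ∩ N` consists of the multiples of `u`. -/
def IsRayGenerator {N : Type*} [AddCommGroup N] (ρ : Cone N) (u : N) : Prop :=
  ∀ v : N, v ∈ latticeSet ρ ↔ ∃ k : ℕ, v = k • u

/-- The neighborhood of a cone `σ` in a fan: the faces of the cones that contain `σ` as a face. -/
def neighborhood {N : Type*} [AddCommGroup N] (F : Set (Cone N)) (σ : Cone N) : Set (Cone N) :=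
  {τ | τ ∈ F ∧ ∃ σ' ∈ F, IsFace σ σ' ∧ IsFace τ σ'}

/-- The quotient lattice `N^σ` of `N` by the span of `σ ∩ N`. -/
abbrev StarLattice {N : Type*} [AddCommGroup N] (σ : Cone N) : Type _ :=
  N ⧸ AddSubgroup.closure (latticeSet σ)

/-- The quotient map `N_ℝ → N^σ_ℝ`. -/
def starMap {N : Type*} [AddCommGroup N] (σ : Cone N) :
    RealSpace N →ₗ[ℝ] RealSpace (StarLattice σ) :=
  realMap (QuotientAddGroup.mk' (AddSubgroup.closure (latticeSet σ)))

/-- The star fan `Σ^σ`: the images in `N^σ_ℝ` of the cones in the neighborhood of `σ`. -/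
def starFan {N : Type*} [AddCommGroup N] (F : Set (Cone N)) (σ : Cone N) :
    Set (Cone (StarLattice σ)) :=
  PointedCone.map (starMap σ) '' neighborhood F σ

/-! Piecewise-linear functions. -/

/-- The group `PL(Σ)` of integral piecewise-linear functions: the functions `|Σ| → ℝ` that agree
on each cone with an integral linear function. -/
def PL {N : Type*} [AddCommGroup N] (F : Set (Cone N)) : AddSubgroup (support F → ℝ) where
  carrier := {f | ∀ σ ∈ F, ∃ m : N →+ ℤ, ∀ x : support F, (x : RealSpace N) ∈ σ →
    f x = pairing m x}
  add_mem' := by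
    intro f g hf hg σ hσ
    obtain ⟨m, hm⟩ := hf σ hσ
    obtain ⟨k, hk⟩ := hg σ hσ
    refine ⟨m + k, fun x hx => ?_⟩
    have h : pairing (m + k) = pairing m + pairing k := by
      ext; simp [pairing]
    simp [h, hm x hx, hk x hx]
  zero_mem' := by
    intro σ _
    refine ⟨0, fun x _ => ?_⟩
    have h : pairing (0 : N →+ ℤ) = 0 := by
      ext; simp [pairing]
    simp [h]
  neg_mem' := by
    intro f hf σ hσ
    obtain ⟨m, hm⟩ := hf σ hσ
    refine ⟨-m, fun x hx => ?_⟩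
    have h : pairing (-m) = -pairing m := by
      ext; simp [pairing]
    simp [h, hm x hx]

/-- The restriction to `|Σ|` of the integral linear functions. -/
def linearPL {N : Type*} [AddCommGroup N] (F : Set (Cone N)) : (N →+ ℤ) →+ PL F where
  toFun m := ⟨fun x => pairing m x, fun _ _ => ⟨m, fun _ _ => rfl⟩⟩
  map_zero' := by
    have h : pairing (0 : N →+ ℤ) = 0 := by
      ext; simp [pairing]
    ext x
    simp [h]
  map_add' := by
    intro m k
    have h : pairing (m + k) = pairing m + pairing k := by
      ext; simp [pairing]
    ext x
    simp [h]

/-- The group of integral piecewise-linear functions up to translation by integral linear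
functions. -/
abbrev ReducedPL {N : Type*} [AddCommGroup N] (F : Set (Cone N)) : Type _ :=
  PL F ⧸ (linearPL F).range

/-- The class `[f]` of a piecewise-linear function `f`. -/
def plClass {N : Type*} [AddCommGroup N] {F : Set (Cone N)} (f : PL F) : ReducedPL F :=
  QuotientAddGroup.mk f

/-- `δ` is the Courant function of the ray `ρ`: its value is `1` at the generator of `ρ` and `0` at
the generators of all other rays. -/
def IsCourant {N : Type*} [AddCommGroup N] {F : Set (Cone N)} (ρ : Cone N) (δ : PL F) : Prop :=
  (∀ u, IsRayGenerator ρ u → ∀ x : support F, (x : RealSpace N) = latticePoint u → δ.1 x = 1) ∧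
  ∀ τ ∈ rays F, τ ≠ ρ → ∀ u, IsRayGenerator τ u →
    ∀ x : support F, (x : RealSpace N) = latticePoint u → δ.1 x = 0

/-- `g` is a representative of `[f]^σ`: for some `m ∈ M` that agrees with `f` on `σ`, the function
`f - m` on the neighborhood of `σ` is the pullback of the function `g` on the star fan. -/
def IsStarRestriction {N : Type*} [AddCommGroup N] {F : Set (Cone N)} (σ : Cone N) (f : PL F)
    (g : PL (starFan F σ)) : Prop :=
  ∃ m : N →+ ℤ, (∀ x : support F, (x : RealSpace N) ∈ σ → f.1 x = pairing m x) ∧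
    ∀ (x : support F) (y : support (starFan F σ)),
      (x : RealSpace N) ∈ support (neighborhood F σ) → (y : RealSpace _) = starMap σ x →
        g.1 y = f.1 x - pairing m x

/-! Ehrhart fans. -/

/-- `IsEhrhartPolynomial Σ χ`: the fan `Σ` is unimodular, its star fans at rays are Ehrhart, and `χ`
satisfies `χ(0) = 1` and the recursion `χ([f]) = χ([f - δ_ρ]) + χ_{Σ^ρ}([f]^ρ)` for all `f` and
`ρ`. The recursion in this definition ends because the star fan at a ray has smaller dimension. -/
inductive IsEhrhartPolynomial.{u} : {N : Type u} → [AddCommGroup N] → (F : Set (Cone N)) →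
    (ReducedPL F → ℤ) → Prop
  | intro {N : Type u} [AddCommGroup N] (F : Set (Cone N)) (χ : ReducedPL F → ℤ)
      (unimodular : IsUnimodularFan F)
      (χstar : ∀ ρ ∈ rays F, ReducedPL (starFan F ρ) → ℤ)
      (star : ∀ ρ (hρ : ρ ∈ rays F), IsEhrhartPolynomial (starFan F ρ) (χstar ρ hρ))
      (map_zero : χ 0 = 1)
      (recursion : ∀ ρ (hρ : ρ ∈ rays F) (f δ : PL F) (g : PL (starFan F ρ)),
        IsCourant ρ δ → IsStarRestriction ρ f g →
          χ (plClass f) = χ (plClass (f - δ)) + χstar ρ hρ (plClass g)) :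
      IsEhrhartPolynomial F χ

/-- A fan is Ehrhart if it has an Ehrhart polynomial. -/
def IsEhrhart {N : Type*} [AddCommGroup N] (F : Set (Cone N)) : Prop :=
  ∃ χ : ReducedPL F → ℤ, IsEhrhartPolynomial F χ

/-! Fiber bundles of fans. -/

/-- The unimodular fan `F` is an `F'`-bundle over `F''`, with respect to the short exact sequence
`0 → N' → N → N'' → 0` with maps `i` and `p`; the subfan that lifts `F''` is `L`. -/
structure IsFiberBundle {N' N N'' : Type*} [AddCommGroup N'] [AddCommGroup N] [AddCommGroup N'']
    (i : N' →+ N) (p : N →+ N'') (F' : Set (Cone N')) (F'' : Set (Cone N''))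
    (F : Set (Cone N)) (L : Set (Cone N)) : Prop where
  inclusion_injective : Function.Injective i
  exact : Function.Exact i p
  projection_surjective : Function.Surjective p
  fiber_unimodular : IsUnimodularFan F'
  base_unimodular : IsUnimodularFan F''
  total_unimodular : IsUnimodularFan F
  support_inter : support F ∩ Set.range (realMap i) = realMap i '' support F'
  lift_subset : L ⊆ F
  lift_fan : IsRationalFan L
  lift_injOn : Set.InjOn (realMap p) (support L)
  lift_bijOn : Set.BijOn (PointedCone.map (realMap p)) L F''
  lift_lattice : ∀ σ ∈ L, p '' latticeSet σ = latticeSet (PointedCone.map (realMap p) σ)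
  sum_bijOn : Set.BijOn (fun q : Cone N' × Cone N => PointedCone.map (realMap i) q.1 ⊔ q.2)
    (F' ×ˢ L) F

namespace IsFiberBundle

variable {N' N N'' : Type*} [AddCommGroup N'] [AddCommGroup N] [AddCommGroup N'']
  {i : N' →+ N} {p : N →+ N''} {F' : Set (Cone N')} {F'' : Set (Cone N'')}
  {F L : Set (Cone N)}

theorem fiber_mem_support (h : IsFiberBundle i p F' F'' F L) {x : RealSpace N'}
    (hx : x ∈ support F') : realMap i x ∈ support F :=
  (h.support_inter.symm ▸ Set.mem_image_of_mem _ hx :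
    realMap i x ∈ support F ∩ Set.range (realMap i)).1

theorem bot_mem_lift (h : IsFiberBundle i p F' F'' F L) : ⊥ ∈ L := by
  obtain ⟨σ, hσ, hmap⟩ := h.lift_bijOn.surjOn h.base_unimodular.origin_mem
  have hσ0 : σ = ⊥ := by
    rw [eq_bot_iff]
    intro x hx
    have h1 : realMap p x = 0 := by
      have h2 : realMap p x ∈ PointedCone.map (realMap p) σ :=
        PointedCone.mem_map.2 ⟨x, hx, rfl⟩
      rw [hmap] at h2
      simpa using h2
    have h3 : x = 0 := h.lift_injOn ⟨σ, hσ, hx⟩ ⟨σ, hσ, zero_mem σ⟩ (by simp [h1])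
    simp [h3]
  exact hσ0 ▸ hσ

theorem map_mem_total (h : IsFiberBundle i p F' F'' F L) {σ : Cone N'} (hσ : σ ∈ F') :
    PointedCone.map (realMap i) σ ∈ F := by
  have h1 := h.sum_bijOn.mapsTo (show (σ, (⊥ : Cone N)) ∈ F' ×ˢ L from ⟨hσ, h.bot_mem_lift⟩)
  simpa using h1

theorem pairing_realMap {P Q : Type*} [AddCommGroup P] [AddCommGroup Q] (φ : P →+ Q)
    (m : Q →+ ℤ) (x : RealSpace P) : pairing m (realMap φ x) = pairing (m.comp φ) x := by
  have h : (pairing m).comp (realMap φ) = pairing (m.comp φ) := by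
    ext; simp [pairing, realMap]
  exact LinearMap.congr_fun h x

/-- The restriction `f'` of `f ∈ PL(Σ)` to the fiber fan `Σ'`. -/
def fiberPart (h : IsFiberBundle i p F' F'' F L) (f : PL F) : PL F' :=
  ⟨fun x => f.1 ⟨realMap i x, h.fiber_mem_support x.2⟩, by
    intro σ hσ
    obtain ⟨m, hm⟩ := f.2 _ (h.map_mem_total hσ)
    refine ⟨m.comp i, fun x hx => ?_⟩
    rw [← pairing_realMap]
    exact hm ⟨realMap i x, h.fiber_mem_support x.2⟩ (PointedCone.mem_map.2 ⟨x, hx, rfl⟩)⟩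

theorem exists_lift (h : IsFiberBundle i p F' F'' F L) (y : support F'') :
    ∃ x ∈ support L, realMap p x = y := by
  obtain ⟨σ'', hσ'', hy⟩ := y.2
  obtain ⟨σ, hσ, rfl⟩ := h.lift_bijOn.surjOn hσ''
  obtain ⟨x, hx, hxy⟩ := PointedCone.mem_map.1 hy
  exact ⟨x, ⟨σ, hσ, hx⟩, hxy⟩

/-- The unique point of the support of the lifted subfan that `p` maps to `y`. -/
def lift (h : IsFiberBundle i p F' F'' F L) (y : support F'') : RealSpace N :=
  (h.exists_lift y).choose

theorem lift_mem (h : IsFiberBundle i p F' F'' F L) (y : support F'') : h.lift y ∈ support L :=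
  (h.exists_lift y).choose_spec.1

theorem lift_mem_total (h : IsFiberBundle i p F' F'' F L) (y : support F'') :
    h.lift y ∈ support F := by
  obtain ⟨σ, hσ, hy⟩ := h.lift_mem y
  exact ⟨σ, h.lift_subset hσ, hy⟩

theorem realMap_lift (h : IsFiberBundle i p F' F'' F L) (y : support F'') :
    realMap p (h.lift y) = y :=
  (h.exists_lift y).choose_spec.2

/-- The function `f'' ∈ PL(Σ'')` of `f ∈ PL(Σ)`: the function with `f''(p x) = f(x)` for all `x` in
the support of the lifted subfan; in particular its value at the generator of the ray `p(ρ)` is the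
value of `f` at the generator of `ρ`, for each ray `ρ` of the lifted subfan. -/
def basePart (h : IsFiberBundle i p F' F'' F L) (f : PL F) : PL F'' :=
  ⟨fun y => f.1 ⟨h.lift y, h.lift_mem_total y⟩, by
    intro σ'' hσ''
    obtain ⟨n, b, s, hb⟩ := h.base_unimodular.unimodular σ'' hσ''
    obtain ⟨σ, hσ, hσσ⟩ := h.lift_bijOn.surjOn hσ''
    obtain ⟨m, hm⟩ := f.2 σ (h.lift_subset hσ)
    have hv : ∀ j, ∃ v : N, j ∈ s → latticePoint v ∈ σ ∧ p v = b j := by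
      intro j
      by_cases hj : j ∈ s
      · have h1 : b j ∈ latticeSet (PointedCone.map (realMap p) σ) := by
          rw [hσσ, hb]
          exact Submodule.subset_span ⟨j, hj, rfl⟩
        rw [← h.lift_lattice σ hσ] at h1
        obtain ⟨v, hv, hvj⟩ := h1
        exact ⟨v, fun _ => ⟨hv, hvj⟩⟩
      · exact ⟨0, fun hj' => absurd hj' hj⟩
    choose v hv using hv
    let m'' : N'' →+ ℤ := (b.constr ℤ (fun j => m (v j))).toAddMonoidHom
    have key : ∀ z ∈ σ'', ∃ x ∈ σ, realMap p x = z ∧ pairing m'' z = pairing m x := by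
      intro z hz
      rw [hb] at hz
      induction hz using Submodule.span_induction with
      | mem z hz =>
        obtain ⟨j, hj, rfl⟩ := hz
        refine ⟨latticePoint (v j), (hv j hj).1, ?_, ?_⟩
        · simp [realMap, latticePoint, (hv j hj).2]
        · simp [pairing, latticePoint, m'']
      | zero => exact ⟨0, zero_mem σ, by simp, by simp⟩
      | add z w _ _ hz hw =>
        obtain ⟨x, hx, hxz, hxm⟩ := hz
        obtain ⟨y, hy, hyz, hym⟩ := hw
        exact ⟨x + y, add_mem hx hy, by simp [hxz, hyz], by simp [hxm, hym]⟩
      | smul a z _ hz =>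
        obtain ⟨x, hx, hxz, hxm⟩ := hz
        refine ⟨a • x, Submodule.smul_mem σ a hx, ?_, ?_⟩
        · rw [← hxz]; exact map_smul (realMap p) (a : ℝ) x
        · have h1 := map_smul (pairing m'') (a : ℝ) z
          have h2 := map_smul (pairing m) (a : ℝ) x
          rw [hxm] at h1
          exact h1.trans h2.symm
    refine ⟨m'', fun y hy => ?_⟩
    obtain ⟨x, hx, hxy, hxm⟩ := key y hy
    have hxl : h.lift y = x :=
      h.lift_injOn (h.lift_mem y) ⟨σ, hσ, hx⟩ ((h.realMap_lift y).trans hxy.symm)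
    rw [hxm, ← hxl]
    exact hm ⟨h.lift y, h.lift_mem_total y⟩ (by
      change h.lift y ∈ σ
      rw [hxl]
      exact hx)⟩

theorem basePart_apply (h : IsFiberBundle i p F' F'' F L) (f : PL F) (x : support F)
    (hx : (x : RealSpace N) ∈ support L) (y : support F'') (hy : (y : RealSpace N'') = realMap p x) :
    (h.basePart f).1 y = f.1 x :=
  congrArg f.1 (Subtype.ext (h.lift_injOn (h.lift_mem y) hx ((h.realMap_lift y).trans hy)))

end IsFiberBundle

/-- The subfan of the cones of `Σ` on which the integral linear function `m` is at most `f`. -/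
def sublevelFan {N : Type*} [AddCommGroup N] {F : Set (Cone N)} (f : PL F) (m : N →+ ℤ) :
    Set (Cone N) :=
  {σ | σ ∈ F ∧ ∀ x : support F, (x : RealSpace N) ∈ σ → pairing m x ≤ f.1 x}

/-- The sum of `(-1) ^ dim σ` over the cones `σ` of `Σ` on which `m` is at most `f`. -/
def signedCount {N : Type*} [AddCommGroup N] {F : Set (Cone N)} (f : PL F) (m : N →+ ℤ) : ℤ :=
  ∑ᶠ σ ∈ sublevelFan f m, (-1) ^ coneDim σ

end EhrhartFan

end

/-! A unimodular fan is determined by the simplicial complex `D` of its sets of ray generators, and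
its piecewise-linear functions are arbitrary integer values at the vertices of `D`. In these terms
every star can be studied inside the original lattice `N`: a class on the star at the cone of `S` is
a family of values `a : N → ℤ`, up to linear functions on `N` and up to changes away from the star
of `S`. `IsEhrhartFunction` is the Ehrhart recursion in this form. The lemmas
`IsEhrhartPolynomial.exists_isEhrhartFunction` and `IsEhrhartFunction.isEhrhartPolynomial` translate
in both directions, so that iterated quotient lattices disappear from the argument.

For a bundle, `D` is the join of the fiber complex `D'` and a section of the base complex `D''`. If
the base is Ehrhart, the right side of the formula, written down for every star at `S' ∪ S''` as
`bundleFunction`, satisfies the recursion. At a fiber vertex `u` only the count changes: a set `T`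
with `m ≤ a` either survives lowering `a` at `u` by one, or it contains `u` with `m u = a u`, and
the latter sets are counted by the star at `u` (`fiberCount_recursion`). At a base vertex only the
factor from the base changes, by its own recursion. Adding a linear function on `N` reindexes the
sum over `M'` by its restriction to `N'`, and what remains is linear on `N''`.

The normalization is where completeness enters: for `a = 0` the count must be `(-1) ^ n` at `m = 0`,
with `n` the rank of `N'`, and zero for every other `m`. This is a computation of Euler
characteristics. The relative interiors of the cones partition the whole space, and their
intersections with the open halfspace `m > 0` partition that halfspace. Both have Euler
characteristic `(-1) ^ n`, so the cones on which `m ≤ 0` contribute zero (`sum_nonpos`). Additivity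
of the Euler characteristic is proved by refining arrangements of hyperplanes one hyperplane at a
time (`sum_refine_cell`).

Conversely, an Ehrhart function of the total complex gives one for the base by extending values by
zero along the fiber, because the recursion at base vertices is part of the recursion upstairs
(`isEhrhartFunction_pullback`). The formula for a given Ehrhart polynomial follows by uniqueness
(`IsEhrhartFunction.unique`): linear functions and Courant functions generate all values on a star.
-/

noncomputable section

namespace EhrhartFan

open scoped Classical

/-! ### Lattice points, simplicial cones and unimodular sets of vectors. -/

section Basics

variable {N P : Type*} [AddCommGroup N] [AddCommGroup P]

@[simp]
theorem pairing_latticePoint (m : N →+ ℤ) (v : N) : pairing m (latticePoint v) = m v := by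
  simp [pairing, latticePoint]

@[simp]
theorem realMap_latticePoint (φ : N →+ P) (v : N) :
    realMap φ (latticePoint v) = latticePoint (φ v) := by
  simp [realMap, latticePoint]

theorem latticePoint_add (v w : N) :
    latticePoint (v + w) = latticePoint v + latticePoint w :=
  TensorProduct.tmul_add _ _ _

@[simp]
theorem latticePoint_zero : latticePoint (0 : N) = 0 :=
  TensorProduct.tmul_zero _ _

theorem latticePoint_zsmul (k : ℤ) (v : N) :
    latticePoint (k • v) = (k : ℝ) • latticePoint v := by
  simp only [latticePoint, TensorProduct.tmul_smul]
  simp [TensorProduct.smul_tmul']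

theorem latticePoint_nsmul (k : ℕ) (v : N) :
    latticePoint (k • v) = (k : ℝ) • latticePoint v := by
  have := latticePoint_zsmul (k : ℤ) v
  simpa using this

/-- The pairing as a homomorphism in the integral linear function. -/
def pairingHom : (N →+ ℤ) →+ (RealSpace N →ₗ[ℝ] ℝ) where
  toFun := pairing
  map_zero' := by ext; simp [pairing]
  map_add' m k := by ext; simp [pairing]

theorem pairing_neg (m : N →+ ℤ) : pairing (-m) = -pairing m := pairingHom.map_neg m

theorem sum_coord_smul_latticePoint {ι : Type*} [Fintype ι] (b : Module.Basis ι ℤ N)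
    (x : RealSpace N) :
    ∑ j, pairing (b.coord j).toAddMonoidHom x • latticePoint (b j) = x := by
  have h : ∑ j, (pairing (b.coord j).toAddMonoidHom).smulRight (latticePoint (b j))
      = LinearMap.id := by
    ext v
    simp only [TensorProduct.AlgebraTensorModule.curry_apply, LinearMap.coe_restrictScalars,
      TensorProduct.curry_apply, LinearMap.sum_apply, LinearMap.smulRight_apply, LinearMap.id_apply]
    change ∑ j, pairing (b.coord j).toAddMonoidHom (latticePoint v) • latticePoint (b j)
      = latticePoint v
    conv_rhs => rw [← b.sum_repr v]
    have h2 : latticePoint (∑ j, b.repr v j • b j) = ∑ j, latticePoint (b.repr v j • b j) :=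
      TensorProduct.tmul_sum _ _ _
    rw [h2]
    refine Finset.sum_congr rfl fun j _ => ?_
    rw [latticePoint_zsmul]
    simp
  simpa using LinearMap.congr_fun h x

theorem latticePoint_injective [Module.Free ℤ N] :
    Function.Injective (latticePoint : N → RealSpace N) := by
  intro v w hvw
  have b := Module.Free.chooseBasis ℤ N
  refine b.ext_elem fun j => ?_
  have := congrArg (pairing (b.coord j).toAddMonoidHom) hvw
  simpa using this

/-- The cone generated by a finite set of lattice vectors. -/
def cone (S : Finset N) : Cone N :=
  PointedCone.hull ℝ (latticePoint '' (S : Set N))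

theorem latticePoint_mem_cone {S : Finset N} {v : N} (hv : v ∈ S) : latticePoint v ∈ cone S :=
  Submodule.subset_span ⟨v, hv, rfl⟩

theorem Cone.smul_mem {σ : Cone N} {x : RealSpace N} (hx : x ∈ σ) {t : ℝ} (ht : 0 ≤ t) :
    t • x ∈ σ :=
  Submodule.smul_mem σ (⟨t, ht⟩ : NNReal) hx

theorem sum_mem_cone {S : Finset N} {t : N → ℝ} (ht : ∀ v ∈ S, 0 ≤ t v) :
    ∑ v ∈ S, t v • latticePoint v ∈ cone S :=
  Submodule.sum_mem _ fun v hv => Cone.smul_mem (latticePoint_mem_cone hv) (ht v hv)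

theorem mem_cone {S : Finset N} {x : RealSpace N} :
    x ∈ cone S ↔ ∃ t : N → ℝ, (∀ v ∈ S, 0 ≤ t v) ∧ ∑ v ∈ S, t v • latticePoint v = x := by
  constructor
  · intro hx
    induction hx using Submodule.span_induction with
    | mem x hx =>
      obtain ⟨v, hv, rfl⟩ := hx
      refine ⟨fun w => if w = v then (1 : ℝ) else 0, fun w _ => by positivity, ?_⟩
      simp [ite_smul, Finset.mem_coe.1 hv]
    | zero => exact ⟨0, by simp, by simp⟩
    | add x y _ _ hx hy =>
      obtain ⟨s, hs, rfl⟩ := hx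
      obtain ⟨t, ht, rfl⟩ := hy
      exact ⟨s + t, fun v hv => add_nonneg (hs v hv) (ht v hv), by
        simp [add_smul, Finset.sum_add_distrib]⟩
    | smul a x _ hx =>
      obtain ⟨s, hs, rfl⟩ := hx
      refine ⟨fun v => a * s v, fun v hv => mul_nonneg a.2 (hs v hv), ?_⟩
      change _ = (a : ℝ) • ∑ v ∈ S, s v • latticePoint v
      rw [Finset.smul_sum]
      exact Finset.sum_congr rfl fun v _ => mul_smul _ _ _
  · rintro ⟨t, ht, rfl⟩
    exact sum_mem_cone ht

theorem cone_mono {S T : Finset N} (h : S ⊆ T) : cone S ≤ cone T :=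
  Submodule.span_mono (Set.image_mono (by exact_mod_cast h))

theorem cone_le {S : Finset N} {σ : Cone N} (h : ∀ v ∈ S, latticePoint v ∈ σ) : cone S ≤ σ :=
  Submodule.span_le.2 (by rintro _ ⟨v, hv, rfl⟩; exact h v hv)

@[simp]
theorem cone_empty : cone (∅ : Finset N) = ⊥ := by simp [cone]

theorem cone_union (S T : Finset N) : cone (S ∪ T) = cone S ⊔ cone T := by
  simp [cone, Set.image_union, PointedCone.hull, Submodule.span_union]

theorem map_cone (φ : N →+ P) (S : Finset N) :
    PointedCone.map (realMap φ) (cone S) = cone (S.image φ) := by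
  apply le_antisymm
  · intro y hy
    obtain ⟨x, hx, rfl⟩ := PointedCone.mem_map.1 hy
    obtain ⟨t, ht, rfl⟩ := mem_cone.1 hx
    rw [map_sum]
    refine Submodule.sum_mem _ fun v hv => ?_
    rw [map_smul, realMap_latticePoint]
    exact Cone.smul_mem (latticePoint_mem_cone (Finset.mem_image_of_mem _ hv)) (ht v hv)
  · refine cone_le fun w hw => ?_
    obtain ⟨v, hv, rfl⟩ := Finset.mem_image.1 hw
    exact PointedCone.mem_map.2 ⟨_, latticePoint_mem_cone hv, realMap_latticePoint φ v⟩

theorem pairing_sum_smul (m : N →+ ℤ) (S : Finset N) (t : N → ℝ) :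
    pairing m (∑ v ∈ S, t v • latticePoint v) = ∑ v ∈ S, t v * m v := by
  simp [map_sum]

/-- A finite set of lattice vectors that has dual integral linear functions; equivalently, part of
a `ℤ`-basis. -/
def IsUnimod (S : Finset N) : Prop :=
  ∀ u ∈ S, ∃ m : N →+ ℤ, m u = 1 ∧ ∀ v ∈ S, v ≠ u → m v = 0

namespace IsUnimod

variable {S : Finset N}

theorem mono (hS : IsUnimod S) {T : Finset N} (hT : T ⊆ S) : IsUnimod T := fun u hu => by
  obtain ⟨m, h1, h2⟩ := hS u (hT hu)
  exact ⟨m, h1, fun v hv => h2 v (hT hv)⟩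

/-- The dual function of a member of a unimodular set. -/
def dual (hS : IsUnimod S) (u : N) : N →+ ℤ :=
  if hu : u ∈ S then (hS u hu).choose else 0

theorem dual_apply (hS : IsUnimod S) {u v : N} (hu : u ∈ S) (hv : v ∈ S) :
    hS.dual u v = if v = u then 1 else 0 := by
  rw [dual, dif_pos hu]
  split_ifs with h
  · subst h; exact (hS v hu).choose_spec.1
  · exact (hS u hu).choose_spec.2 v hv h

theorem pairing_dual (hS : IsUnimod S) {u : N} (hu : u ∈ S) (t : N → ℝ) :
    pairing (hS.dual u) (∑ v ∈ S, t v • latticePoint v) = t u := by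
  rw [pairing_sum_smul, Finset.sum_eq_single u]
  · simp [hS.dual_apply hu hu]
  · intro v hv hvu
    simp [hS.dual_apply hu hv, hvu]
  · exact fun h => absurd hu h

theorem coeff_eq (hS : IsUnimod S) {s t : N → ℝ}
    (h : ∑ v ∈ S, s v • latticePoint v = ∑ v ∈ S, t v • latticePoint v) {u : N} (hu : u ∈ S) :
    s u = t u := by
  rw [← hS.pairing_dual hu s, h, hS.pairing_dual hu]

theorem ne_zero (hS : IsUnimod S) {u : N} (hu : u ∈ S) : u ≠ 0 := by
  rintro rfl
  obtain ⟨m, h1, -⟩ := hS 0 hu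
  simp at h1

/-- Values on a unimodular set extend to an integral linear function. -/
theorem exists_eq (hS : IsUnimod S) (a : N → ℤ) : ∃ m : N →+ ℤ, ∀ v ∈ S, m v = a v := by
  refine ⟨∑ u ∈ S, a u • hS.dual u, fun v hv => ?_⟩
  rw [AddMonoidHom.finsetSum_apply, Finset.sum_eq_single v]
  · simp [hS.dual_apply hv hv]
  · intro u hu huv
    simp [hS.dual_apply hu hv, huv.symm]
  · exact fun h => absurd hv h

theorem mem_of_sum_mem_cone (hS : IsUnimod S) {T : Finset N} (hT : T ⊆ S) {t : N → ℝ}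
    (h : ∑ v ∈ S, t v • latticePoint v ∈ cone T) {u : N} (hu : u ∈ S) (htu : t u ≠ 0) :
    u ∈ T := by
  by_contra huT
  obtain ⟨s, -, hs⟩ := mem_cone.1 h
  apply htu
  rw [← hS.pairing_dual hu t, ← hs, pairing_sum_smul]
  refine Finset.sum_eq_zero fun v hv => ?_
  rw [hS.dual_apply hu (hT hv), if_neg (by rintro rfl; exact huT hv)]
  simp

/-- Duality allows any values to be prescribed on `S`. The function with value `0` on `T` and `-1`
on the rest of `S` exposes the face spanned by `T`. -/
theorem isFace_iff (hS : IsUnimod S) {τ : Cone N} :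
    IsFace τ (cone S) ↔ ∃ T ⊆ S, τ = cone T := by
  constructor
  · rintro ⟨m, hm, hτ⟩
    have hneg : ∀ v ∈ S, m v ≤ 0 := fun v hv => by
      have := hm _ (latticePoint_mem_cone hv)
      rw [pairing_latticePoint] at this
      exact_mod_cast not_lt.1 this
    refine ⟨S.filter (fun v => m v = 0), Finset.filter_subset _ _, le_antisymm ?_ ?_⟩
    · intro x hx
      obtain ⟨hx, hmx⟩ := (hτ x).1 hx
      obtain ⟨t, ht, rfl⟩ := mem_cone.1 hx
      rw [pairing_sum_smul] at hmx
      have hle : ∀ v ∈ S, t v * (m v : ℝ) ≤ 0 := fun v hv =>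
        mul_nonpos_of_nonneg_of_nonpos (ht v hv) (by exact_mod_cast hneg v hv)
      have h0 := (Finset.sum_eq_zero_iff_of_nonpos hle).1
        (le_antisymm (Finset.sum_nonpos hle) hmx)
      refine Submodule.sum_mem _ fun v hv => ?_
      by_cases hmv : m v = 0
      · exact Cone.smul_mem (latticePoint_mem_cone (by simp [hv, hmv])) (ht v hv)
      · have : t v = 0 := by
          rcases mul_eq_zero.1 (h0 v hv) with h | h
          · exact h
          · exact absurd (by exact_mod_cast h) hmv
        simp [this]
    · refine cone_le fun v hv => ?_
      obtain ⟨hv, hmv⟩ := Finset.mem_filter.1 hv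
      exact (hτ _).2 ⟨latticePoint_mem_cone hv, by simp [hmv]⟩
  · rintro ⟨T, hT, rfl⟩
    obtain ⟨m, hm⟩ := hS.exists_eq (fun v => if v ∈ T then 0 else -1)
    refine ⟨m, fun x hx => ?_, fun x => ⟨fun hx => ⟨cone_mono hT hx, ?_⟩, fun hx => ?_⟩⟩
    · obtain ⟨t, ht, rfl⟩ := mem_cone.1 hx
      rw [pairing_sum_smul, not_lt]
      refine Finset.sum_nonpos fun v hv => mul_nonpos_of_nonneg_of_nonpos (ht v hv) ?_
      rw [hm v hv]
      split_ifs <;> norm_num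
    · obtain ⟨t, ht, rfl⟩ := mem_cone.1 hx
      rw [pairing_sum_smul]
      exact le_of_eq (Finset.sum_eq_zero fun v hv => by simp [hm v (hT hv), hv]).symm
    · obtain ⟨hx, hmx⟩ := hx
      obtain ⟨t, ht, rfl⟩ := mem_cone.1 hx
      rw [pairing_sum_smul] at hmx
      have hle : ∀ v ∈ S, t v * (m v : ℝ) ≤ 0 := fun v hv =>
        mul_nonpos_of_nonneg_of_nonpos (ht v hv) (by
          rw [hm v hv]; split_ifs <;> norm_num)
      have h0 := (Finset.sum_eq_zero_iff_of_nonpos hle).1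
        (le_antisymm (Finset.sum_nonpos hle) hmx)
      refine Submodule.sum_mem _ fun v hv => ?_
      by_cases hvT : v ∈ T
      · exact Cone.smul_mem (latticePoint_mem_cone hvT) (ht v hv)
      · have := h0 v hv
        rw [hm v hv, if_neg hvT] at this
        have : t v = 0 := by simpa using this
        simp [this]

/-- The generators are the primitive vectors of the extremal rays. If `w ∈ T` occurs with nonzero
coefficient in `v ∈ S`, then extremality makes `w` a multiple of `v`, and integrality makes the
multiple `1`. -/
theorem cone_subset [Module.Free ℤ N] (hS : IsUnimod S) {T : Finset N} (hT : IsUnimod T)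
    (h : cone S = cone T) : S ⊆ T := by
  intro v hv
  obtain ⟨t, ht, hvt⟩ := mem_cone.1 (h ▸ latticePoint_mem_cone hv)
  have hpos : ∃ w ∈ T, t w ≠ 0 := by
    by_contra! hcon
    have : latticePoint v = latticePoint (0 : N) := by
      rw [← hvt, latticePoint_zero]
      exact Finset.sum_eq_zero fun w hw => by simp [hcon w hw]
    exact hS.ne_zero hv (latticePoint_injective this)
  obtain ⟨w, hw, hwt⟩ := hpos
  obtain ⟨s, hs, hws⟩ := mem_cone.1 (h.symm ▸ latticePoint_mem_cone hw)
  -- The dual function of `u` vanishes at `v` and is nonnegative on all of `T`, so it vanishes at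
  -- each member of `T` that occurs in `v`.
  have hs0 : ∀ u ∈ S, u ≠ v → s u = 0 := by
    intro u hu huv
    have h1 : pairing (hS.dual u) (latticePoint v) = 0 := by
      simp [hS.dual_apply hu hv, huv.symm]
    rw [← hvt, pairing_sum_smul] at h1
    have hnn : ∀ w' ∈ T, 0 ≤ t w' * (hS.dual u w' : ℝ) := fun w' hw' => by
      obtain ⟨s', hs', hws'⟩ := mem_cone.1 (h.symm ▸ latticePoint_mem_cone hw')
      refine mul_nonneg (ht w' hw') ?_
      rw [← pairing_latticePoint, ← hws', hS.pairing_dual hu]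
      exact hs' u hu
    have h2 := (Finset.sum_eq_zero_iff_of_nonneg hnn).1 h1 w hw
    have h3 : (hS.dual u w : ℝ) = 0 := (mul_eq_zero.1 h2).resolve_left hwt
    rwa [← pairing_latticePoint, ← hws, hS.pairing_dual hu] at h3
  have hw' : latticePoint w = s v • latticePoint v := by
    rw [← hws]
    exact Finset.sum_eq_single v (fun u hu huv => by simp [hs0 u hu huv])
      (fun hv' => absurd hv hv')
  have hsv : s v = (hS.dual v w : ℤ) := by
    rw [← pairing_latticePoint, hw']; simp [hS.dual_apply hv hv]
  have hwv : w = (hS.dual v w) • v := latticePoint_injective (by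
    rw [latticePoint_zsmul, ← hsv, hw'])
  have h1 : hT.dual w w = 1 := by simp [hT.dual_apply hw hw]
  have h2 : hS.dual v w * hT.dual w v = 1 := by
    have h := congrArg (hT.dual w) hwv
    rw [map_zsmul, h1, smul_eq_mul] at h
    exact h.symm
  have h3 : 0 ≤ hS.dual v w := by
    have := hs v hv
    rw [hsv] at this
    exact_mod_cast this
  have h4 : hS.dual v w = 1 := by
    rcases Int.eq_one_or_neg_one_of_mul_eq_one h2 with h | h
    · exact h
    · omega
  rw [h4, one_smul] at hwv
  exact hwv ▸ hw

theorem cone_injective [Module.Free ℤ N] (hS : IsUnimod S) {T : Finset N} (hT : IsUnimod T)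
    (h : cone S = cone T) : S = T :=
  (hS.cone_subset hT h).antisymm (hT.cone_subset hS h.symm)

theorem linearIndependent (hS : IsUnimod S) :
    LinearIndependent ℝ (fun v : S => latticePoint (v : N)) := by
  rw [Fintype.linearIndependent_iff]
  intro g hg v
  have h1 : ∑ v ∈ S, (fun u => if hu : u ∈ S then g ⟨u, hu⟩ else 0) v • latticePoint v
      = ∑ v ∈ S, (0 : N → ℝ) v • latticePoint v := by
    rw [← Finset.sum_coe_sort S]
    simpa using hg
  simpa using hS.coeff_eq h1 v.2

theorem finrank_span (hS : IsUnimod S) :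
    Module.finrank ℝ (Submodule.span ℝ (latticePoint '' (S : Set N))) = S.card := by
  have h := finrank_span_eq_card hS.linearIndependent
  rw [Fintype.card_coe] at h
  rw [← h, Set.image_eq_range]
  rfl

theorem coneDim_cone (hS : IsUnimod S) : coneDim (cone S) = S.card := by
  have hspan : Submodule.span ℝ (cone S : Set (RealSpace N)) =
      Submodule.span ℝ (latticePoint '' (S : Set N)) := by
    refine le_antisymm (Submodule.span_le.2 fun x hx => ?_) (Submodule.span_mono ?_)
    · obtain ⟨t, -, rfl⟩ := mem_cone.1 hx
      exact Submodule.sum_mem _ fun v hv => Submodule.smul_mem _ _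
        (Submodule.subset_span ⟨v, hv, rfl⟩)
    · rintro _ ⟨v, hv, rfl⟩
      exact latticePoint_mem_cone hv
  rw [coneDim, hspan, hS.finrank_span]

end IsUnimod

end Basics

/-! ### Unimodular fans as simplicial complexes of ray generators. -/

section FanComplex

variable {N : Type*} [AddCommGroup N]

theorem IsUnimod.of_basis {ι : Type*} (b : Module.Basis ι ℤ N) {S : Finset N}
    (hS : (S : Set N) ⊆ Set.range b) : IsUnimod S := by
  intro u hu
  obtain ⟨j, rfl⟩ := hS hu
  refine ⟨(b.coord j).toAddMonoidHom, by simp, fun v hv hvu => ?_⟩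
  obtain ⟨k, rfl⟩ := hS hv
  have hkj : k ≠ j := fun h => hvu (h ▸ rfl)
  simp [hkj]

/-- The dual functions split `N` as `ℤ^S ⊕ K`, where `K` is their common kernel, and a basis of `K`
completes `S`. -/
theorem IsUnimod.exists_basis [Module.Free ℤ N] [Module.Finite ℤ N] {S : Finset N}
    (hS : IsUnimod S) :
    ∃ (n : ℕ) (b : Module.Basis (Fin n) ℤ N) (s : Set (Fin n)), b '' s = S := by
  let K : Submodule ℤ N := ⨅ u : S, LinearMap.ker (hS.dual u).toIntLinearMap
  have hK : ∀ k : K, ∀ u ∈ S, hS.dual u k = 0 := fun k u hu => by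
    have := (Submodule.mem_iInf _).1 k.2 ⟨u, hu⟩
    exact this
  have hmem : ∀ n : N, n - ∑ u : S, hS.dual u n • (u : N) ∈ K := fun n => by
    refine (Submodule.mem_iInf _).2 fun u => ?_
    rw [LinearMap.mem_ker]
    change hS.dual u (n - ∑ w : S, hS.dual w n • (w : N)) = 0
    rw [map_sub, map_sum, Finset.sum_eq_single u]
    · simp [hS.dual_apply u.2 u.2]
    · intro w _ hwu
      rw [map_zsmul, hS.dual_apply u.2 w.2, if_neg (fun h => hwu (Subtype.ext h)), smul_zero]
    · simp
  let e : ((S → ℤ) × K) ≃ₗ[ℤ] N :=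
    { toFun := fun g => ∑ u : S, g.1 u • (u : N) + g.2
      map_add' := fun g g' => by
        simp only [Prod.fst_add, Pi.add_apply, add_smul, Finset.sum_add_distrib, Prod.snd_add,
          Submodule.coe_add]
        abel
      map_smul' := fun c g => by
        simp [smul_add, Finset.smul_sum, mul_smul]
      invFun := fun n => (fun u => hS.dual u n, ⟨_, hmem n⟩)
      left_inv := fun g => by
        have h1 : ∀ u : S, hS.dual u (∑ w : S, g.1 w • (w : N) + g.2) = g.1 u := fun u => by
          rw [map_add, hK g.2 u u.2, map_sum, Finset.sum_eq_single u]
          · simp [hS.dual_apply u.2 u.2]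
          · intro w _ hwu
            rw [map_zsmul, hS.dual_apply u.2 w.2, if_neg (fun h => hwu (Subtype.ext h)), smul_zero]
          · simp
        refine Prod.ext (funext h1) (Subtype.ext ?_)
        simp only [h1]
        abel
      right_inv := fun n => by simp }
  let b0 := ((Pi.basisFun ℤ S).prod (Module.Free.chooseBasis ℤ K)).map e
  have hb0 : ∀ u : S, b0 (Sum.inl u) = u := fun u => by
    simp [b0, e, Pi.single_apply, ite_smul]
  let f := Fintype.equivFin (S ⊕ Module.Free.ChooseBasisIndex ℤ K)
  refine ⟨_, b0.reindex f, f '' Set.range Sum.inl, ?_⟩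
  ext v
  simp only [Set.image_image, Module.Basis.reindex_apply, Equiv.symm_apply_apply]
  constructor
  · rintro ⟨_, ⟨u, rfl⟩, rfl⟩
    simp [hb0]
  · intro hv
    exact ⟨_, ⟨⟨v, hv⟩, rfl⟩, hb0 ⟨v, hv⟩⟩

/-- Coordinate functions cutting out the span of one part `S` of a unimodular set. -/
theorem IsUnimod.exists_coordinates [Module.Free ℤ N] [Module.Finite ℤ N] {S : Finset N}
    (hS : IsUnimod S) : ∃ A : Finset (N →+ ℤ), (∀ k ∈ A, ∀ v ∈ S, k v = 0) ∧
      ∀ x, (∀ k ∈ A, pairing k x = 0) →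
        x = ∑ v ∈ S, pairing (hS.dual v) x • latticePoint v := by
  obtain ⟨n, b, s, hb⟩ := hS.exists_basis
  refine ⟨(Finset.univ.filter (fun j => j ∉ s)).image (fun j => (b.coord j).toAddMonoidHom),
    ?_, ?_⟩
  · intro k hk v hv
    obtain ⟨j, hj, rfl⟩ := Finset.mem_image.1 hk
    obtain ⟨l, hl, rfl⟩ := hb.symm ▸ Finset.mem_coe.2 hv
    have : l ≠ j := by rintro rfl; exact (Finset.mem_filter.1 hj).2 hl
    simp [this]
  · intro x hx
    have h1 : x = ∑ j ∈ Finset.univ.filter (fun j => j ∈ s),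
        pairing (b.coord j).toAddMonoidHom x • latticePoint (b j) := by
      conv_lhs => rw [← sum_coord_smul_latticePoint b x]
      rw [Finset.sum_filter_of_ne]
      intro j _ hj
      by_contra hjs
      exact hj (by rw [hx _ (Finset.mem_image_of_mem _ (by simp [hjs])), zero_smul])
    have h2 : S = (Finset.univ.filter (fun j => j ∈ s)).image b := by
      ext v
      rw [← Finset.mem_coe, ← hb]
      simp
    have h3 : ∃ t : N → ℝ, x = ∑ v ∈ S, t v • latticePoint v := by
      refine ⟨fun v => if h : ∃ j, b j = v then
        pairing (b.coord h.choose).toAddMonoidHom x else 0, ?_⟩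
      rw [h2, Finset.sum_image (fun _ _ _ _ h => b.injective h)]
      conv_lhs => rw [h1]
      refine Finset.sum_congr rfl fun j _ => ?_
      have hex : ∃ l, b l = b j := ⟨j, rfl⟩
      simp only [dif_pos hex, b.injective hex.choose_spec]
    obtain ⟨t, rfl⟩ := h3
    exact Finset.sum_congr rfl fun v hv => by rw [hS.pairing_dual hv]

theorem IsUnimod.mem_cone_iff {S : Finset N} (hS : IsUnimod S) {A : Finset (N →+ ℤ)}
    (hA : (∀ k ∈ A, ∀ v ∈ S, k v = 0) ∧ ∀ x, (∀ k ∈ A, pairing k x = 0) →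
        x = ∑ v ∈ S, pairing (hS.dual v) x • latticePoint v) (x : RealSpace N) :
    x ∈ cone S ↔ ∀ m ∈ S.image hS.dual ∪ A ∪ A.image Neg.neg, 0 ≤ pairing m x := by
  constructor
  · intro hx m hm
    obtain ⟨t, ht, rfl⟩ := mem_cone.1 hx
    have h0 : ∀ k ∈ A, pairing k (∑ v ∈ S, t v • latticePoint v) = 0 := fun k hk => by
      rw [pairing_sum_smul]
      exact Finset.sum_eq_zero fun v hv => by simp [hA.1 k hk v hv]
    rcases Finset.mem_union.1 hm with hm | hm
    · rcases Finset.mem_union.1 hm with hm | hm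
      · obtain ⟨u, hu, rfl⟩ := Finset.mem_image.1 hm
        rw [hS.pairing_dual hu]
        exact ht u hu
      · exact (h0 m hm).ge
    · obtain ⟨k, hk, rfl⟩ := Finset.mem_image.1 hm
      rw [pairing_neg, LinearMap.neg_apply, h0 k hk, neg_zero]
  · intro hx
    rw [hA.2 x fun k hk => le_antisymm ?_ ?_]
    · exact sum_mem_cone fun v hv => hx _ (by simp [Finset.mem_image_of_mem _ hv])
    · have := hx (-k) (Finset.mem_union_right _ (Finset.mem_image_of_mem _ hk))
      rw [pairing_neg, LinearMap.neg_apply] at this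
      linarith
    · exact hx k (by simp [hk])

theorem IsUnimod.isRationalCone [Module.Free ℤ N] [Module.Finite ℤ N] {S : Finset N}
    (hS : IsUnimod S) : IsRationalCone (cone S) := by
  obtain ⟨A, hA⟩ := hS.exists_coordinates
  exact ⟨_, hS.mem_cone_iff hA⟩

/-- The abstract simplicial complex of the sets of ray generators of the cones of a unimodular
fan. -/
structure IsFanComplex (D : Finset (Finset N)) : Prop where
  unimod : ∀ S ∈ D, IsUnimod S
  empty_mem : ∅ ∈ D
  down : ∀ S ∈ D, ∀ T ⊆ S, T ∈ D
  inter_le : ∀ S ∈ D, ∀ T ∈ D, cone S ⊓ cone T ≤ cone (S ∩ T)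

/-- The collection of cones generated by the members of `D`. -/
def coneFan (D : Finset (Finset N)) : Set (Cone N) := cone '' (D : Set (Finset N))

theorem cone_mem_coneFan {D : Finset (Finset N)} {S : Finset N} (hS : S ∈ D) :
    cone S ∈ coneFan D := ⟨S, hS, rfl⟩

theorem IsFanComplex.isUnimodularFan [Module.Free ℤ N] [Module.Finite ℤ N]
    {D : Finset (Finset N)} (hD : IsFanComplex D) : IsUnimodularFan (coneFan D) where
  finite := D.finite_toSet.image _
  rational := by
    rintro _ ⟨S, hS, rfl⟩
    exact (hD.unimod S hS).isRationalCone
  face_mem := by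
    rintro _ ⟨S, hS, rfl⟩ τ hτ
    obtain ⟨T, hT, rfl⟩ := (hD.unimod S hS).isFace_iff.1 hτ
    exact cone_mem_coneFan (hD.down S hS T hT)
  inter_face := by
    rintro _ ⟨S, hS, rfl⟩ _ ⟨T, hT, rfl⟩
    have h : cone S ⊓ cone T = cone (S ∩ T) := (hD.inter_le S hS T hT).antisymm
      (le_inf (cone_mono Finset.inter_subset_left) (cone_mono Finset.inter_subset_right))
    exact ⟨(hD.unimod S hS).isFace_iff.2 ⟨_, Finset.inter_subset_left, h⟩,
      (hD.unimod T hT).isFace_iff.2 ⟨_, Finset.inter_subset_right, h⟩⟩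
  origin_mem := ⟨∅, hD.empty_mem, cone_empty⟩
  unimodular := by
    rintro _ ⟨S, hS, rfl⟩
    obtain ⟨n, b, s, hb⟩ := (hD.unimod S hS).exists_basis
    refine ⟨n, b, s, ?_⟩
    rw [cone, ← hb, Set.image_image]

/-- Take all unimodular sets whose cones lie in `F`. There are finitely many because a cone
determines its generators, and common faces of two cones become intersections of generator sets. -/
theorem IsUnimodularFan.exists_complex [Module.Free ℤ N] {F : Set (Cone N)}
    (hF : IsUnimodularFan F) :
    ∃ D : Finset (Finset N), IsFanComplex D ∧ F = coneFan D := by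
  have hfin : {S : Finset N | IsUnimod S ∧ cone S ∈ F}.Finite := by
    refine Set.Finite.of_finite_image (f := cone) (hF.finite.subset ?_) ?_
    · rintro _ ⟨S, hS, rfl⟩
      exact hS.2
    · intro S hS T hT h
      exact hS.1.cone_injective hT.1 h
  have hmem : ∀ S, S ∈ hfin.toFinset ↔ IsUnimod S ∧ cone S ∈ F := fun S => by simp
  refine ⟨hfin.toFinset, ⟨fun S hS => ((hmem S).1 hS).1, ?_, ?_, ?_⟩, ?_⟩
  · exact (hmem _).2 ⟨fun u hu => by simp at hu, by simpa using hF.origin_mem⟩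
  · intro S hS T hT
    obtain ⟨h1, h2⟩ := (hmem S).1 hS
    exact (hmem T).2 ⟨h1.mono hT, hF.face_mem _ h2 _ (h1.isFace_iff.2 ⟨T, hT, rfl⟩)⟩
  · intro S hS T hT
    obtain ⟨hS1, hS2⟩ := (hmem S).1 hS
    obtain ⟨hT1, hT2⟩ := (hmem T).1 hT
    obtain ⟨h1, h2⟩ := hF.inter_face _ hS2 _ hT2
    obtain ⟨S', hS', h1⟩ := hS1.isFace_iff.1 h1
    obtain ⟨T', hT', h2⟩ := hT1.isFace_iff.1 h2
    have h3 : S' = T' := (hS1.mono hS').cone_injective (hT1.mono hT') (h1.symm.trans h2)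
    rw [h1]
    exact cone_mono (Finset.subset_inter hS' (h3 ▸ hT'))
  · ext σ
    constructor
    · intro hσ
      obtain ⟨n, b, s, hb⟩ := hF.unimodular σ hσ
      have hfs : (b '' s).Finite := s.toFinite.image _
      have hc : cone hfs.toFinset = σ := by
        rw [hb, cone, hfs.coe_toFinset, Set.image_image]
      refine ⟨hfs.toFinset, (hmem _).2 ⟨IsUnimod.of_basis b ?_, hc ▸ hσ⟩, hc⟩
      rw [hfs.coe_toFinset]
      exact Set.image_subset_range _ _
    · rintro ⟨S, hS, rfl⟩
      exact ((hmem S).1 hS).2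

theorem IsUnimodularFan.free_finite {F : Set (Cone N)} (hF : IsUnimodularFan F) :
    Module.Free ℤ N ∧ Module.Finite ℤ N := by
  obtain ⟨n, b, -, -⟩ := hF.unimodular _ hF.origin_mem
  exact ⟨Module.Free.of_basis b, Module.Finite.of_basis b⟩

namespace IsFanComplex

variable {D : Finset (Finset N)}

/-- The form in which the fan condition is used throughout: a point common to two cones is supported
on the shared generators. -/
theorem mem_inter_of_sum_eq (hD : IsFanComplex D) {S T : Finset N} (hS : S ∈ D) (hT : T ∈ D)
    {s : N → ℝ} (hs : ∀ v ∈ S, 0 ≤ s v) (hx : ∑ v ∈ S, s v • latticePoint v ∈ cone T)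
    {u : N} (hu : u ∈ S) (hsu : s u ≠ 0) : u ∈ T := by
  have h1 := hD.inter_le S hS T hT ⟨sum_mem_cone hs, hx⟩
  exact (Finset.mem_inter.1 ((hD.unimod S hS).mem_of_sum_mem_cone Finset.inter_subset_left h1
    hu hsu)).2

theorem mem_rays_iff [Module.Free ℤ N] (hD : IsFanComplex D) {ρ : Cone N} :
    ρ ∈ rays (coneFan D) ↔ ∃ w, {w} ∈ D ∧ ρ = cone {w} := by
  constructor
  · rintro ⟨⟨S, hS, rfl⟩, h⟩
    rw [(hD.unimod S hS).coneDim_cone] at h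
    obtain ⟨w, rfl⟩ := Finset.card_eq_one.1 h
    exact ⟨w, hS, rfl⟩
  · rintro ⟨w, hw, rfl⟩
    exact ⟨cone_mem_coneFan hw, by rw [(hD.unimod _ hw).coneDim_cone, Finset.card_singleton]⟩

end IsFanComplex

theorem IsUnimod.latticePoint_mem_singleton_iff [Module.Free ℤ N] {w : N}
    (hw : IsUnimod ({w} : Finset N)) {v : N} :
    latticePoint v ∈ cone {w} ↔ ∃ k : ℕ, v = k • w := by
  constructor
  · intro h
    obtain ⟨t, ht, h⟩ := mem_cone.1 h
    rw [Finset.sum_singleton] at h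
    have hw' := hw.dual_apply (Finset.mem_singleton_self w) (Finset.mem_singleton_self w)
    have h1 : t w = hw.dual w v := by
      rw [← pairing_latticePoint, ← h]
      simp [hw']
    have h2 : 0 ≤ hw.dual w v := by
      have := ht w (Finset.mem_singleton_self w)
      rw [h1] at this
      exact_mod_cast this
    refine ⟨(hw.dual w v).toNat, latticePoint_injective ?_⟩
    rw [← h, h1, latticePoint_nsmul]
    congr 1
    exact_mod_cast (Int.toNat_of_nonneg h2).symm
  · rintro ⟨k, rfl⟩
    rw [latticePoint_nsmul]
    exact Cone.smul_mem (latticePoint_mem_cone (Finset.mem_singleton_self w)) k.cast_nonneg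

theorem IsUnimod.isRayGenerator_iff [Module.Free ℤ N] {w : N}
    (hw : IsUnimod ({w} : Finset N)) {u : N} : IsRayGenerator (cone {w}) u ↔ u = w := by
  constructor
  · intro h
    obtain ⟨k, hk⟩ := hw.latticePoint_mem_singleton_iff.1 ((h u).2 ⟨1, (one_smul _ _).symm⟩)
    obtain ⟨l, hl⟩ := (h w).1 (latticePoint_mem_cone (Finset.mem_singleton_self w))
    have hd := hw.dual_apply (Finset.mem_singleton_self w) (Finset.mem_singleton_self w)
    have h1 := congrArg (hw.dual w) hl
    rw [hk, hd, if_pos rfl, map_nsmul, map_nsmul, hd, if_pos rfl] at h1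
    simp only [nsmul_eq_mul, mul_one] at h1
    have h2 : l * k = 1 := by exact_mod_cast h1.symm
    rw [hk, Nat.eq_one_of_mul_eq_one_left h2, one_smul]
  · rintro rfl
    exact fun v => hw.latticePoint_mem_singleton_iff

end FanComplex

/-! ### Piecewise-linear functions as integer values at the vertices. -/

section PiecewiseLinear

variable {N : Type*} [AddCommGroup N] {F : Set (Cone N)}

/-- The integral value of a piecewise-linear function at a lattice vector, and zero outside of the
support. -/
def val (f : PL F) (v : N) : ℤ :=
  -- The value is already an integer, so the floor only changes the type. The default `0` keeps
  -- `val` additive in `f`.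
  if h : latticePoint v ∈ support F then ⌊f.1 ⟨latticePoint v, h⟩⌋ else 0

theorem val_cast (f : PL F) {v : N} (h : latticePoint v ∈ support F) :
    (val f v : ℝ) = f.1 ⟨latticePoint v, h⟩ := by
  obtain ⟨σ, hσ, hv⟩ := id h
  obtain ⟨m, hm⟩ := f.2 σ hσ
  rw [val, dif_pos h, hm ⟨_, h⟩ hv]
  simp

theorem val_eq_iff (f : PL F) {v : N} (h : latticePoint v ∈ support F) {k : ℤ} :
    val f v = k ↔ f.1 ⟨latticePoint v, h⟩ = k := by
  rw [← val_cast]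
  norm_cast

theorem val_add (f g : PL F) : val (f + g) = val f + val g := by
  ext v
  by_cases h : latticePoint v ∈ support F
  · rw [val_eq_iff _ h]
    simp [val_cast _ h]
  · simp [val, h]

theorem val_neg (f : PL F) : val (-f) = -val f := by
  ext v
  by_cases h : latticePoint v ∈ support F
  · rw [val_eq_iff _ h]
    simp [val_cast _ h]
  · simp [val, h]

theorem val_sub (f g : PL F) : val (f - g) = val f - val g := by
  rw [sub_eq_add_neg, val_add, val_neg, sub_eq_add_neg]

@[simp]
theorem val_apply_zero (f : PL F) : val f 0 = 0 := by
  by_cases h : latticePoint (0 : N) ∈ support F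
  · obtain ⟨σ, hσ, hv⟩ := id h
    obtain ⟨m, hm⟩ := f.2 σ hσ
    rw [val_eq_iff _ h, hm ⟨_, h⟩ hv]
    simp
  · rw [val, dif_neg h]

theorem val_linearPL (m : N →+ ℤ) {v : N} (h : latticePoint v ∈ support F) :
    val (linearPL F m) v = m v := by
  rw [val_eq_iff _ h]
  simp [linearPL]

variable {D : Finset (Finset N)}

theorem latticePoint_mem_support (hF : F = coneFan D) {S : Finset N} (hS : S ∈ D) {v : N}
    (hv : v ∈ S) : latticePoint v ∈ support F :=
  hF ▸ ⟨cone S, cone_mem_coneFan hS, latticePoint_mem_cone hv⟩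

theorem exists_of_mem_support (hF : F = coneFan D) {x : RealSpace N} (hx : x ∈ support F) :
    ∃ S ∈ D, ∃ t : N → ℝ, (∀ v ∈ S, 0 ≤ t v) ∧ ∑ v ∈ S, t v • latticePoint v = x := by
  subst hF
  obtain ⟨_, ⟨S, hS, rfl⟩, hx⟩ := hx
  exact ⟨S, hS, mem_cone.1 hx⟩

theorem PL.apply_eq_sum (hF : F = coneFan D) (f : PL F) {S : Finset N} (hS : S ∈ D) {t : N → ℝ}
    (ht : ∀ v ∈ S, 0 ≤ t v) (x : support F)
    (hx : ∑ v ∈ S, t v • latticePoint v = (x : RealSpace N)) :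
    f.1 x = ∑ v ∈ S, t v * val f v := by
  obtain ⟨m, hm⟩ := f.2 (cone S) (hF ▸ cone_mem_coneFan hS)
  rw [hm x (hx ▸ sum_mem_cone ht), ← hx, pairing_sum_smul]
  refine Finset.sum_congr rfl fun v hv => ?_
  rw [val_cast f (latticePoint_mem_support hF hS hv), hm _ (latticePoint_mem_cone hv),
    pairing_latticePoint]

theorem PL.ext_val (hF : F = coneFan D) {f g : PL F}
    (h : ∀ S ∈ D, ∀ v ∈ S, val f v = val g v) : f = g := by
  refine Subtype.ext (funext fun x => ?_)
  obtain ⟨S, hS, t, ht, hx⟩ := exists_of_mem_support hF x.2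
  rw [PL.apply_eq_sum hF f hS ht x hx, PL.apply_eq_sum hF g hS ht x hx]
  exact Finset.sum_congr rfl fun v hv => by rw [h S hS v hv]

/-- Each cone has a linear function with the prescribed values. Two of them agree on a common point
because it is supported on common generators. -/
theorem IsFanComplex.exists_PL (hD : IsFanComplex D) (hF : F = coneFan D) (a : N → ℤ) :
    ∃ f : PL F, ∀ S ∈ D, ∀ v ∈ S, val f v = a v := by
  have hex : ∀ S : D, ∃ m : N →+ ℤ, ∀ v ∈ (S : Finset N), m v = a v := fun S =>
    (hD.unimod S S.2).exists_eq a
  choose m hm using hex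
  have hsup : ∀ x : support F, ∃ S : D, (x : RealSpace N) ∈ cone (S : Finset N) := fun x => by
    obtain ⟨S, hS, t, ht, hx⟩ := exists_of_mem_support hF x.2
    exact ⟨⟨S, hS⟩, hx ▸ sum_mem_cone ht⟩
  choose T hT using hsup
  have key : ∀ (x : support F) (S : D), (x : RealSpace N) ∈ cone (S : Finset N) →
      pairing (m (T x)) x = pairing (m S) (x : RealSpace N) := fun x S hx => by
    obtain ⟨t, ht, hxt⟩ := mem_cone.1 (hD.inter_le _ (T x).2 _ S.2 ⟨hT x, hx⟩)
    rw [← hxt, pairing_sum_smul, pairing_sum_smul]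
    refine Finset.sum_congr rfl fun v hv => ?_
    rw [hm _ v (Finset.mem_inter.1 hv).1, hm _ v (Finset.mem_inter.1 hv).2]
  refine ⟨⟨fun x => pairing (m (T x)) x, fun σ hσ => ?_⟩, fun S hS v hv => ?_⟩
  · rw [hF] at hσ
    obtain ⟨S, hS, rfl⟩ := hσ
    exact ⟨m ⟨S, hS⟩, fun x hx => key x ⟨S, hS⟩ hx⟩
  · have h := latticePoint_mem_support hF hS hv
    rw [val_eq_iff _ h]
    change pairing (m (T ⟨_, h⟩)) (latticePoint v) = _
    rw [key ⟨_, h⟩ ⟨S, hS⟩ (latticePoint_mem_cone hv), pairing_latticePoint, hm _ v hv]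

/-- Courant functions become Kronecker deltas on vertices, because a ray determines its generator.
-/
theorem IsFanComplex.isCourant_iff [Module.Free ℤ N] (hD : IsFanComplex D) (hF : F = coneFan D)
    {w : N} (hw : {w} ∈ D) (δ : PL F) :
    IsCourant (cone {w}) δ ↔ ∀ S ∈ D, ∀ v ∈ S, val δ v = if v = w then 1 else 0 := by
  constructor
  · rintro ⟨h1, h2⟩ S hS v hv
    have hvD := hD.down S hS {v} (by simpa using hv)
    have h := latticePoint_mem_support hF hS hv
    rw [val_eq_iff _ h]
    split_ifs with hvw
    · subst hvw
      rw [h1 v ((hD.unimod _ hw).isRayGenerator_iff.2 rfl) _ rfl]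
      simp
    · rw [h2 (cone {v}) (hF ▸ hD.mem_rays_iff.2 ⟨v, hvD, rfl⟩) ?_ v
        ((hD.unimod _ hvD).isRayGenerator_iff.2 rfl) _ rfl]
      · simp
      · intro hc
        exact hvw (Finset.singleton_injective
          ((hD.unimod _ hvD).cone_injective (hD.unimod _ hw) hc))
  · intro hδ
    refine ⟨fun u hu x hx => ?_, fun τ hτ hτw u hu x hx => ?_⟩
    · obtain rfl := (hD.unimod _ hw).isRayGenerator_iff.1 hu
      have h := latticePoint_mem_support hF hw (Finset.mem_singleton_self u)
      have h1 := (val_eq_iff δ h).1 (hδ _ hw u (Finset.mem_singleton_self u))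
      rw [if_pos rfl, Int.cast_one] at h1
      rw [← h1]
      exact congrArg δ.1 (Subtype.ext hx)
    · rw [hF] at hτ
      obtain ⟨v, hv, rfl⟩ := hD.mem_rays_iff.1 hτ
      obtain rfl := (hD.unimod _ hv).isRayGenerator_iff.1 hu
      have h := latticePoint_mem_support hF hv (Finset.mem_singleton_self u)
      have h1 := (val_eq_iff δ h).1 (hδ _ hv u (Finset.mem_singleton_self u))
      rw [if_neg (fun h => hτw (by rw [h])), Int.cast_zero] at h1
      rw [← h1]
      exact congrArg δ.1 (Subtype.ext hx)

theorem plClass_eq_iff {f g : PL F} :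
    plClass f = plClass g ↔ ∃ m : N →+ ℤ, linearPL F m = g - f := by
  rw [plClass, plClass, QuotientAddGroup.eq, neg_add_eq_sub]
  exact Iff.rfl

end PiecewiseLinear

/-! ### Quotient lattices and stars of complexes. -/

section Quotients

variable {N P : Type*} [AddCommGroup N] [AddCommGroup P]

theorem exists_descend {q : N →+ P} (hq : Function.Surjective q) (m : N →+ ℤ)
    (h : ∀ n, q n = 0 → m n = 0) : ∃ k : P →+ ℤ, ∀ n, k (q n) = m n :=
  ⟨q.liftOfSurjective hq ⟨m, h⟩, fun n => q.liftOfRightInverse_comp_apply _ _ ⟨m, h⟩ n⟩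

theorem map_eq_zero_of_mem_closure {S : Set N} (m : N →+ ℤ) (h : ∀ v ∈ S, m v = 0) {n : N}
    (hn : n ∈ AddSubgroup.closure S) : m n = 0 :=
  (AddSubgroup.closure_le m.ker).2 h hn

theorem IsUnimod.eq_sum_of_mem_closure {S : Finset N} (hS : IsUnimod S) {n : N}
    (hn : n ∈ AddSubgroup.closure (S : Set N)) : n = ∑ v ∈ S, hS.dual v n • v := by
  induction hn using AddSubgroup.closure_induction with
  | mem x hx =>
    rw [Finset.sum_eq_single x]
    · simp [hS.dual_apply hx hx]
    · intro v hv hvx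
      simp [hS.dual_apply hv hx, hvx.symm]
    · exact fun h => absurd hx h
  | zero => simp
  | add x y _ _ hx hy =>
    simp only [map_add, add_smul, Finset.sum_add_distrib]
    rw [← hx, ← hy]
  | neg x _ hx =>
    simp only [map_neg, neg_smul, Finset.sum_neg_distrib]
    rw [← hx]

/-- The span of `S` is saturated: if `k • n` lies in it, the dual functions give integral
coefficients for `n` itself. Hence the quotient is torsion free. -/
theorem IsUnimod.quotient_free [Module.Free ℤ N] [Module.Finite ℤ N] {S : Finset N}
    (hS : IsUnimod S) {q : N →+ P} (hq : Function.Surjective q)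
    (hker : ∀ n, q n = 0 ↔ n ∈ AddSubgroup.closure (S : Set N)) :
    Module.Free ℤ P ∧ Module.Finite ℤ P := by
  have hfin : Module.Finite ℤ P := Module.Finite.of_surjective q.toIntLinearMap hq
  have htf : Module.IsTorsionFree ℤ P := by
    refine Module.IsTorsionFree.of_smul_eq_zero fun k x hkx => ?_
    obtain ⟨n, rfl⟩ := hq x
    by_cases hk : k = 0
    · exact Or.inl hk
    · right
      rw [← map_zsmul, hker] at hkx
      have h1 := hS.eq_sum_of_mem_closure hkx
      have h2 : k • (n - ∑ v ∈ S, hS.dual v n • v) = 0 := by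
        rw [smul_sub, sub_eq_zero]
        conv_lhs => rw [h1]
        rw [Finset.smul_sum]
        exact Finset.sum_congr rfl fun v _ => by rw [map_zsmul, smul_assoc]
      have h3 := (smul_eq_zero.1 h2).resolve_left hk
      rw [sub_eq_zero] at h3
      rw [hker, h3]
      exact AddSubgroup.sum_mem _ fun v hv =>
        AddSubgroup.zsmul_mem _ (AddSubgroup.subset_closure hv) _
  exact ⟨Module.free_of_finite_type_torsion_free', hfin⟩

/-- Right exactness of the tensor product with `ℝ` identifies the real kernel with the line through
`w`. -/
theorem realMap_eq_zero {q : N →+ P} (hq : Function.Surjective q) {w : N}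
    (hker : ∀ n, q n = 0 ↔ n ∈ AddSubgroup.closure {w}) {x : RealSpace N}
    (hx : realMap q x = 0) : ∃ t : ℝ, x = t • latticePoint w := by
  have hex : Function.Exact (LinearMap.toSpanSingleton ℤ N w) q.toIntLinearMap := fun n => by
    rw [AddMonoidHom.coe_toIntLinearMap, hker, AddSubgroup.mem_closure_singleton]
    exact Iff.rfl
  have h := lTensor_exact ℝ hex hq
  obtain ⟨z, rfl⟩ := (h x).1 hx
  refine ⟨TensorProduct.rid ℤ ℝ z, ?_⟩
  have hz : z = (TensorProduct.rid ℤ ℝ z) ⊗ₜ[ℤ] (1 : ℤ) := by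
    rw [← TensorProduct.rid_symm_apply, LinearEquiv.symm_apply_apply]
  conv_lhs => rw [hz]
  simp [latticePoint, TensorProduct.smul_tmul']

theorem cone_image_sdiff (q : N →+ P) (T S : Finset N) (hS : ∀ v ∈ S, q v = 0) :
    cone ((T \ S).image q) = cone (T.image q) := by
  refine le_antisymm (cone_mono (Finset.image_subset_image Finset.sdiff_subset))
    (cone_le fun u hu => ?_)
  obtain ⟨v, hv, rfl⟩ := Finset.mem_image.1 hu
  by_cases hvS : v ∈ S
  · simp [hS v hvS]
  · exact latticePoint_mem_cone (Finset.mem_image_of_mem _ (Finset.mem_sdiff.2 ⟨hv, hvS⟩))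

/-- The vertices of the link of `S` in the complex `D`. -/
def link (D : Finset (Finset N)) (S : Finset N) : Set N := {v | v ∉ S ∧ insert v S ∈ D}

/-- The image under `q` of the link of `S` in the complex `D`. -/
def quotComplex (D : Finset (Finset N)) (S : Finset N) (q : N →+ P) : Finset (Finset P) :=
  (D.filter (fun T => S ⊆ T)).image (fun T => (T \ S).image q)

theorem mem_quotComplex {D : Finset (Finset N)} {S : Finset N} {q : N →+ P} {A : Finset P} :
    A ∈ quotComplex D S q ↔ ∃ T ∈ D, S ⊆ T ∧ (T \ S).image q = A := by
  simp [quotComplex, and_assoc]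

theorem mem_link_of_mem {D : Finset (Finset N)} (hD : IsFanComplex D) {S T : Finset N}
    (hT : T ∈ D) (hST : S ⊆ T) {v : N} (hv : v ∈ T) (hvS : v ∉ S) : v ∈ link D S :=
  ⟨hvS, hD.down T hT _ (Finset.insert_subset hv hST)⟩

/-- `G` is the star of the fan of the complex `D` at the cone of `S`, where `q` is the quotient map
to the lattice of `G`. -/
structure IsStarModel (D : Finset (Finset N)) (S : Finset N) (q : N →+ P) (G : Set (Cone P)) :
    Prop where
  complex : IsFanComplex D
  mem : S ∈ D
  surj : Function.Surjective q
  ker : ∀ n, q n = 0 ↔ n ∈ AddSubgroup.closure (S : Set N)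
  fan : G = coneFan (quotComplex D S q)
  quot : IsFanComplex (quotComplex D S q)
  inj : Set.InjOn q (link D S)

/-- If `v = v' + k • w` with `k ≥ 0`, then `v` lies in the cone of `{v', w}`, so it is one of these
two vectors and is not `w`. -/
theorem injOn_link_singleton {D : Finset (Finset N)} (hD : IsFanComplex D) {w : N} {q : N →+ P}
    (hker : ∀ n, q n = 0 ↔ n ∈ AddSubgroup.closure {w}) : Set.InjOn q (link D {w}) := by
  have key : ∀ v ∈ link D {w}, ∀ v' ∈ link D {w}, ∀ k : ℤ, 0 ≤ k → v = v' + k • w → v = v' := by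
    intro v hv v' hv' k hk h
    have hvD : {v} ∈ D := hD.down _ hv.2 _ (by simp)
    have h1 : v ∈ (insert v' {w} : Finset N) := by
      refine hD.mem_inter_of_sum_eq hvD hv'.2 (s := fun _ => 1) (fun _ _ => zero_le_one) ?_
        (Finset.mem_singleton_self v) one_ne_zero
      rw [Finset.sum_singleton, one_smul, h, latticePoint_add, latticePoint_zsmul]
      exact add_mem (latticePoint_mem_cone (by simp))
        (Cone.smul_mem (latticePoint_mem_cone (by simp)) (by exact_mod_cast hk))
    rcases Finset.mem_insert.1 h1 with h1 | h1
    · exact h1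
    · exact absurd h1 hv.1
  intro v hv v' hv' h
  have h1 : q (v - v') = 0 := by rw [map_sub, h, sub_self]
  rw [hker, AddSubgroup.mem_closure_singleton] at h1
  obtain ⟨k, hk⟩ := h1
  rcases le_total 0 k with h0 | h0
  · exact key v hv v' hv' k h0 (by rw [hk]; abel)
  · exact (key v' hv' v hv (-k) (by omega) (by rw [neg_smul, hk]; abel)).symm

theorem isFanComplex_quotComplex_singleton {D : Finset (Finset N)} (hD : IsFanComplex D) {w : N}
    (hw : {w} ∈ D) {q : N →+ P} (hq : Function.Surjective q)
    (hker : ∀ n, q n = 0 ↔ n ∈ AddSubgroup.closure {w}) :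
    IsFanComplex (quotComplex D {w} q) where
  unimod := by
    intro A hA
    obtain ⟨T, hT, hwT, rfl⟩ := mem_quotComplex.1 hA
    intro u hu
    obtain ⟨v, hv, rfl⟩ := Finset.mem_image.1 hu
    have hwT' : w ∈ T := by simpa using hwT
    obtain ⟨hvT, hvw⟩ := Finset.mem_sdiff.1 hv
    have hU := hD.unimod T hT
    have hvw' : v ≠ w := by simpa using hvw
    obtain ⟨k, hk⟩ := exists_descend hq (hU.dual v) (fun n hn => by
      refine map_eq_zero_of_mem_closure _ ?_ ((hker n).1 hn)
      rintro _ rfl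
      rw [hU.dual_apply hvT hwT', if_neg hvw'.symm])
    refine ⟨k, by rw [hk, hU.dual_apply hvT hvT, if_pos rfl], fun x hx hxv => ?_⟩
    obtain ⟨v', hv', rfl⟩ := Finset.mem_image.1 hx
    rw [hk, hU.dual_apply hvT (Finset.mem_sdiff.1 hv').1, if_neg]
    rintro rfl
    exact hxv rfl
  empty_mem := mem_quotComplex.2 ⟨{w}, hw, subset_rfl, by simp⟩
  down := by
    intro A hA B hB
    obtain ⟨T, hT, hwT, rfl⟩ := mem_quotComplex.1 hA
    obtain ⟨T0, hT0, rfl⟩ := Finset.subset_image_iff.1 hB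
    have hT0w : w ∉ T0 := fun h => by simpa using hT0 h
    refine mem_quotComplex.2 ⟨insert w T0, hD.down T hT _ (Finset.insert_subset (by simpa using hwT)
      fun x hx => (Finset.mem_sdiff.1 (hT0 hx)).1), by simp, ?_⟩
    rw [Finset.insert_sdiff_of_mem _ (Finset.mem_singleton_self w),
      Finset.sdiff_singleton_eq_erase, Finset.erase_eq_of_notMem hT0w]
  inter_le := by
    -- A point of both cones is supported on common generators, so its image is a combination of
    -- their images.
    have aux : ∀ S ∈ D, ∀ T ∈ D, ∀ x ∈ cone (S \ {w}), x ∈ cone T →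
        realMap q x ∈ cone ((S \ {w}).image q ∩ (T \ {w}).image q) := by
      intro S hS T hT x hx hxT
      obtain ⟨s, hs, rfl⟩ := mem_cone.1 hx
      rw [map_sum]
      refine Submodule.sum_mem _ fun v hv => ?_
      by_cases h0 : s v = 0
      · simp [h0]
      · rw [map_smul, realMap_latticePoint]
        refine Cone.smul_mem (latticePoint_mem_cone ?_) (hs v hv)
        have hvT : v ∈ T := hD.mem_inter_of_sum_eq (hD.down S hS _ Finset.sdiff_subset) hT hs hxT
          hv h0
        exact Finset.mem_inter.2 ⟨Finset.mem_image_of_mem _ hv, Finset.mem_image_of_mem _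
          (Finset.mem_sdiff.2 ⟨hvT, (Finset.mem_sdiff.1 hv).2⟩)⟩
    intro A hA B hB y hy
    obtain ⟨S, hS, hwS, rfl⟩ := mem_quotComplex.1 hA
    obtain ⟨T, hT, hwT, rfl⟩ := mem_quotComplex.1 hB
    rw [← map_cone, ← map_cone] at hy
    obtain ⟨x1, hx1, h1⟩ := PointedCone.mem_map.1 hy.1
    obtain ⟨x2, hx2, h2⟩ := PointedCone.mem_map.1 hy.2
    have hwS' : w ∈ S := by simpa using hwS
    have hwT' : w ∈ T := by simpa using hwT
    obtain ⟨t, ht⟩ := realMap_eq_zero hq hker (x := x1 - x2) (by rw [map_sub, h1, h2, sub_self])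
    -- The two lifts differ by `t` times `w`, and `w` belongs to both `S` and `T`. According to the
    -- sign of `t`, one of the lifts therefore lies in both cones.
    rcases le_total 0 t with h0 | h0
    · rw [← h1]
      refine aux S hS T hT x1 hx1 ?_
      rw [sub_eq_iff_eq_add.1 ht]
      exact add_mem (Cone.smul_mem (latticePoint_mem_cone hwT') h0)
        (cone_mono Finset.sdiff_subset hx2)
    · rw [← h2, Finset.inter_comm]
      refine aux T hT S hS x2 hx2 ?_
      have : x2 = (-t) • latticePoint w + x1 := by
        rw [neg_smul, ← ht]; abel
      rw [this]
      exact add_mem (Cone.smul_mem (latticePoint_mem_cone hwS') (by linarith))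
        (cone_mono Finset.sdiff_subset hx1)

theorem mem_neighborhood_coneFan [Module.Free ℤ N] {D : Finset (Finset N)} (hD : IsFanComplex D)
    {w : N} (hw : {w} ∈ D) {τ : Cone N} :
    τ ∈ neighborhood (coneFan D) (cone {w}) ↔ ∃ T' ∈ D, w ∈ T' ∧ ∃ T ⊆ T', τ = cone T := by
  constructor
  · rintro ⟨-, _, ⟨T', hT', rfl⟩, h1, h2⟩
    obtain ⟨A, hA, h1⟩ := (hD.unimod T' hT').isFace_iff.1 h1
    have := (hD.unimod _ hw).cone_injective ((hD.unimod T' hT').mono hA) h1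
    subst this
    exact ⟨T', hT', by simpa using hA, (hD.unimod T' hT').isFace_iff.1 h2⟩
  · rintro ⟨T', hT', hwT', T, hT, rfl⟩
    exact ⟨cone_mem_coneFan (hD.down T' hT' T hT), cone T', cone_mem_coneFan hT',
      (hD.unimod T' hT').isFace_iff.2 ⟨{w}, by simpa using hwT', rfl⟩,
      (hD.unimod T' hT').isFace_iff.2 ⟨T, hT, rfl⟩⟩

theorem map_neighborhood_coneFan [Module.Free ℤ N] {D : Finset (Finset N)} (hD : IsFanComplex D)
    {w : N} (hw : {w} ∈ D) (q : N →+ P) (hqw : q w = 0) :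
    PointedCone.map (realMap q) '' neighborhood (coneFan D) (cone {w}) =
      coneFan (quotComplex D {w} q) := by
  have hw0 : ∀ v ∈ ({w} : Finset N), q v = 0 := fun v hv => by
    rw [Finset.mem_singleton.1 hv, hqw]
  ext σ
  constructor
  · rintro ⟨τ, hτ, rfl⟩
    obtain ⟨T', hT', hwT', T, hT, rfl⟩ := (mem_neighborhood_coneFan hD hw).1 hτ
    refine ⟨(insert w T \ {w}).image q, mem_quotComplex.2 ⟨insert w T,
      hD.down T' hT' _ (Finset.insert_subset hwT' hT), by simp, rfl⟩, ?_⟩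
    rw [Finset.insert_sdiff_of_mem _ (Finset.mem_singleton_self w), cone_image_sdiff _ _ _ hw0,
      map_cone]
  · rintro ⟨A, hA, rfl⟩
    obtain ⟨T, hT, hwT, rfl⟩ := mem_quotComplex.1 hA
    refine ⟨cone T, (mem_neighborhood_coneFan hD hw).2 ⟨T, hT, by simpa using hwT, T, subset_rfl,
      rfl⟩, ?_⟩
    rw [cone_image_sdiff _ _ _ hw0, map_cone]

theorem IsUnimod.closure_latticeSet [Module.Free ℤ N] {w : N} (hw : IsUnimod ({w} : Finset N)) :
    AddSubgroup.closure (latticeSet (cone {w})) = AddSubgroup.closure {w} := by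
  refine le_antisymm ((AddSubgroup.closure_le _).2 fun v hv => ?_)
    (AddSubgroup.closure_mono ?_)
  · obtain ⟨k, rfl⟩ := hw.latticePoint_mem_singleton_iff.1 hv
    exact AddSubgroup.nsmul_mem _ (AddSubgroup.subset_closure (Set.mem_singleton w)) k
  · rintro _ rfl
    exact latticePoint_mem_cone (Finset.mem_singleton_self _)

theorem IsFanComplex.isStarModel_id {D : Finset (Finset N)} (hD : IsFanComplex D) :
    IsStarModel D ∅ (AddMonoidHom.id N) (coneFan D) := by
  have h : quotComplex D ∅ (AddMonoidHom.id N) = D := by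
    ext A
    simp [mem_quotComplex]
  exact ⟨hD, hD.empty_mem, fun x => ⟨x, rfl⟩, fun n => by simp, by rw [h], by rwa [h],
    fun _ _ _ _ h => h⟩

namespace IsStarModel

variable {D : Finset (Finset N)} {S : Finset N} {q : N →+ P} {G : Set (Cone P)}

theorem map_eq_zero (h : IsStarModel D S q G) {v : N} (hv : v ∈ S) : q v = 0 :=
  (h.ker v).2 (AddSubgroup.subset_closure hv)

theorem free_finite [Module.Free ℤ N] [Module.Finite ℤ N] (h : IsStarModel D S q G) :
    Module.Free ℤ P ∧ Module.Finite ℤ P :=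
  (h.complex.unimod S h.mem).quotient_free h.surj h.ker

theorem singleton_mem {u : N} (hu : u ∈ link D S) :
    {q u} ∈ quotComplex D S q :=
  mem_quotComplex.2 ⟨insert u S, hu.2, Finset.subset_insert _ _, by
    rw [Finset.insert_sdiff_of_notMem _ hu.1]; simp⟩

theorem exists_of_mem (h : IsStarModel D S q G) {T : Finset P} (hT : T ∈ quotComplex D S q)
    {w : P} (hw : w ∈ T) : ∃ u ∈ link D S, q u = w := by
  obtain ⟨T', hT', hST, rfl⟩ := mem_quotComplex.1 hT
  obtain ⟨v, hv, rfl⟩ := Finset.mem_image.1 hw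
  obtain ⟨hv, hvS⟩ := Finset.mem_sdiff.1 hv
  exact ⟨v, mem_link_of_mem h.complex hT' hST hv hvS, rfl⟩

theorem mem_ray_iff [Module.Free ℤ P] (h : IsStarModel D S q G) {ρ : Cone P} :
    ρ ∈ rays G ↔ ∃ u ∈ link D S, ρ = cone {q u} := by
  rw [h.fan, h.quot.mem_rays_iff]
  constructor
  · rintro ⟨w, hw, rfl⟩
    obtain ⟨u, hu, rfl⟩ := h.exists_of_mem hw (Finset.mem_singleton_self w)
    exact ⟨u, hu, rfl⟩
  · rintro ⟨u, hu, rfl⟩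
    exact ⟨q u, singleton_mem hu, rfl⟩

theorem mem_link_insert (h : IsStarModel D S q G) {u v : N} (hu : u ∈ link D S)
    (hv : v ∈ link D (insert u S)) : v ∈ link D S ∧ q v ∈ link (quotComplex D S q) {q u} := by
  have hvu : v ≠ u := fun h => hv.1 (h ▸ Finset.mem_insert_self _ _)
  have hvS : v ∉ S := fun h => hv.1 (Finset.mem_insert_of_mem h)
  have hvl : v ∈ link D S := mem_link_of_mem h.complex hv.2
    ((Finset.subset_insert _ _).trans (Finset.subset_insert _ _)) (Finset.mem_insert_self _ _) hvS
  refine ⟨hvl, fun hq => hvu (h.inj hvl hu (Finset.mem_singleton.1 hq)), mem_quotComplex.2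
    ⟨_, hv.2, (Finset.subset_insert _ _).trans (Finset.subset_insert _ _), ?_⟩⟩
  rw [Finset.insert_sdiff_of_notMem _ hvS, Finset.insert_sdiff_of_notMem _ hu.1]
  simp

/-- A star of a star is a star of `D` at a larger set. This lets every iterated star be described by
`D` and a subset of the original lattice. -/
theorem comp {Q : Type*} [AddCommGroup Q] (h : IsStarModel D S q G) {u : N} (hu : u ∈ link D S)
    {r : P →+ Q} (hrs : Function.Surjective r)
    (hrker : ∀ n, r n = 0 ↔ n ∈ AddSubgroup.closure {q u}) :
    IsStarModel D (insert u S) (r.comp q)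
      (coneFan (quotComplex (quotComplex D S q) {q u} r)) := by
  have hqu := singleton_mem (q := q) hu
  -- Injectivity of `q` on the link makes removing `q u` after projection the same as removing `u`
  -- before it.
  have hquot : quotComplex (quotComplex D S q) {q u} r = quotComplex D (insert u S) (r.comp q) := by
    have hset : ∀ T ∈ D, insert u S ⊆ T →
        (((T \ S).image q) \ {q u}).image r = (T \ insert u S).image (r.comp q) := by
      intro T hT hST
      have h1 : ((T \ S).image q) \ {q u} = (T \ insert u S).image q := by
        ext y
        simp only [Finset.mem_sdiff, Finset.mem_image, Finset.mem_singleton, Finset.mem_insert,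
          not_or]
        constructor
        · rintro ⟨⟨v, ⟨hv, hvS⟩, rfl⟩, hne⟩
          exact ⟨v, ⟨hv, fun h => hne (h ▸ rfl), hvS⟩, rfl⟩
        · rintro ⟨v, ⟨hv, hvu, hvS⟩, rfl⟩
          refine ⟨⟨v, ⟨hv, hvS⟩, rfl⟩, fun heq => hvu ?_⟩
          exact h.inj (mem_link_of_mem h.complex hT
            ((Finset.subset_insert _ _).trans hST) hv hvS) hu heq
      rw [h1, Finset.image_image]
      rfl
    ext A
    rw [mem_quotComplex, mem_quotComplex]
    constructor
    · rintro ⟨B, hB, huB, rfl⟩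
      obtain ⟨T, hT, hST, rfl⟩ := mem_quotComplex.1 hB
      have huT : insert u S ⊆ T := by
        obtain ⟨v, hv, hvu⟩ := Finset.mem_image.1 (Finset.singleton_subset_iff.1 huB)
        obtain ⟨hv, hvS⟩ := Finset.mem_sdiff.1 hv
        have := h.inj (mem_link_of_mem h.complex hT hST hv hvS) hu hvu
        exact Finset.insert_subset (this ▸ hv) hST
      exact ⟨T, hT, huT, (hset T hT huT).symm⟩
    · rintro ⟨T, hT, huT, rfl⟩
      refine ⟨(T \ S).image q, mem_quotComplex.2 ⟨T, hT, (Finset.subset_insert _ _).trans huT, rfl⟩,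
        ?_, hset T hT huT⟩
      rw [Finset.singleton_subset_iff]
      exact Finset.mem_image_of_mem _ (Finset.mem_sdiff.2 ⟨huT (Finset.mem_insert_self _ _), hu.1⟩)
  refine ⟨h.complex, hu.2, hrs.comp h.surj, fun n => ?_, ?_, ?_, ?_⟩
  · rw [AddMonoidHom.comp_apply, hrker, AddSubgroup.mem_closure_singleton, Finset.coe_insert,
      Set.insert_eq, AddSubgroup.closure_union, AddSubgroup.mem_sup]
    constructor
    · rintro ⟨k, hk⟩
      refine ⟨k • u, AddSubgroup.zsmul_mem _ (AddSubgroup.subset_closure (Set.mem_singleton u)) k, n - k • u, ?_,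
        by abel⟩
      rw [← h.ker, map_sub, map_zsmul, hk, sub_self]
    · rintro ⟨y, hy, z, hz, rfl⟩
      obtain ⟨k, rfl⟩ := AddSubgroup.mem_closure_singleton.1 hy
      exact ⟨k, by rw [map_add, (h.ker z).2 hz, map_zsmul, add_zero]⟩
  · rw [hquot]
  · rw [← hquot]
    exact isFanComplex_quotComplex_singleton h.quot hqu hrs hrker
  · intro v hv v' hv' heq
    have h1 := h.mem_link_insert hu hv
    have h2 := h.mem_link_insert hu hv'
    exact h.inj h1.1 h2.1 (injOn_link_singleton h.quot hrker h1.2 h2.2 heq)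

theorem step [Module.Free ℤ P] (h : IsStarModel D S q G) {u : N} (hu : u ∈ link D S) :
    IsStarModel D (insert u S)
      ((QuotientAddGroup.mk' (AddSubgroup.closure (latticeSet (cone {q u})))).comp q)
      (starFan G (cone {q u})) := by
  have hqu := singleton_mem (q := q) hu
  have hrker : ∀ n, QuotientAddGroup.mk' (AddSubgroup.closure (latticeSet (cone {q u}))) n = 0 ↔
      n ∈ AddSubgroup.closure {q u} := fun n => by
    rw [QuotientAddGroup.mk'_apply, QuotientAddGroup.eq_zero_iff,
      (h.quot.unimod _ hqu).closure_latticeSet]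
  have h1 := h.comp hu (QuotientAddGroup.mk'_surjective _) hrker
  rw [← map_neighborhood_coneFan h.quot hqu _
    ((hrker _).2 (AddSubgroup.subset_closure (Set.mem_singleton _))), ← h.fan] at h1
  exact h1

end IsStarModel

end Quotients

/-! ### Translation between Ehrhart polynomials of fans and functions of vertex values. -/

section Transfer

variable {N P : Type*} [AddCommGroup N] [AddCommGroup P]

/-- The functions `a` and `b` agree at the vertices of the star of `S` in `D`. -/
def EqOnStar (D : Finset (Finset N)) (S : Finset N) (a b : N → ℤ) : Prop :=
  ∀ T ∈ D, S ⊆ T → ∀ v ∈ T, a v = b v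

theorem eqOnStar_of_link {D : Finset (Finset N)} (hD : IsFanComplex D) {S : Finset N} {a b : N → ℤ}
    (h1 : ∀ v ∈ S, a v = b v) (h2 : ∀ v ∈ link D S, a v = b v) : EqOnStar D S a b := by
  intro T hT hST v hv
  by_cases hvS : v ∈ S
  · exact h1 v hvS
  · exact h2 v (mem_link_of_mem hD hT hST hv hvS)

/-- The predicate that `X`, a function of the values of piecewise-linear functions at the vertices
of the complex `D`, is the Ehrhart polynomial of the star of the fan of `D` at the cone of `S`. -/
inductive IsEhrhartFunction (D : Finset (Finset N)) : Finset N → ((N → ℤ) → ℤ) → Prop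
  | intro (S : Finset N) (X : (N → ℤ) → ℤ)
      (congr : ∀ a b, EqOnStar D S a b → X a = X b)
      (add_linear : ∀ (a : N → ℤ) (m : N →+ ℤ), X (a + ⇑m) = X a)
      (map_zero : X 0 = 1)
      (Y : N → (N → ℤ) → ℤ)
      (star : ∀ u ∈ link D S, IsEhrhartFunction D (insert u S) (Y u))
      (recursion : ∀ u ∈ link D S, ∀ a, X a = X (a - Pi.single u 1) + Y u a) :
      IsEhrhartFunction D S X

namespace IsEhrhartFunction

variable {D : Finset (Finset N)} {S : Finset N} {X : (N → ℤ) → ℤ}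

theorem congr (h : IsEhrhartFunction D S X) {a b : N → ℤ} (hab : EqOnStar D S a b) : X a = X b := by
  cases h with
  | intro _ _ h1 => exact h1 a b hab

theorem add_linear (h : IsEhrhartFunction D S X) (a : N → ℤ) (m : N →+ ℤ) : X (a + ⇑m) = X a := by
  cases h with
  | intro _ _ _ h1 => exact h1 a m

end IsEhrhartFunction

/-- The piecewise-linear function `f` on the star of `S` is induced by the values `a`. -/
def IsRep (D : Finset (Finset N)) (S : Finset N) (q : N →+ P) {G : Set (Cone P)} (a : N → ℤ)
    (f : PL G) : Prop :=
  ∃ m : N →+ ℤ, (∀ v ∈ S, m v = a v) ∧ ∀ v ∈ link D S, val f (q v) = a v - m v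

/-- Equality of functions on a neighborhood is checked on generators, which reduces the geometric
condition to one on vertices of the link. -/
theorem IsFanComplex.isStarRestriction_iff [Module.Free ℤ P] {E : Finset (Finset P)}
    (hE : IsFanComplex E) {w : P} (hw : {w} ∈ E) {G : Set (Cone P)} (hG : G = coneFan E)
    {r : P →+ StarLattice (cone {w})}
    (hr : r = QuotientAddGroup.mk' (AddSubgroup.closure (latticeSet (cone {w}))))
    (hrw : r w = 0)
    (hstar : starFan G (cone {w}) = coneFan (quotComplex E {w} r))
    (f : PL G) (g : PL (starFan G (cone {w}))) :
    IsStarRestriction (cone {w}) f g ↔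
      ∃ m : P →+ ℤ, m w = val f w ∧ ∀ v ∈ link E {w}, val g (r v) = val f v - m v := by
  have hsr : starMap (cone {w}) = realMap r := by rw [hr, starMap]
  have hsw := latticePoint_mem_support hG hw (Finset.mem_singleton_self w)
  have hnb : ∀ T ∈ E, w ∈ T → cone T ∈ neighborhood G (cone {w}) := fun T hT hwT => by
    rw [hG]
    exact (mem_neighborhood_coneFan hE hw).2 ⟨T, hT, hwT, T, subset_rfl, rfl⟩
  have hq : ∀ T ∈ E, w ∈ T → (T \ {w}).image r ∈ quotComplex E {w} r := fun T hT hwT =>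
    mem_quotComplex.2 ⟨T, hT, by simpa using hwT, by convert rfl⟩
  constructor
  · rintro ⟨m, h1, h2⟩
    refine ⟨m, ?_, fun v hv => ?_⟩
    · have := h1 ⟨_, hsw⟩ (latticePoint_mem_cone (Finset.mem_singleton_self w))
      rw [pairing_latticePoint, ← val_eq_iff] at this
      exact this.symm
    · have hvE := hv.2
      have hs1 := latticePoint_mem_support hG hvE (Finset.mem_insert_self _ _)
      have hs2 : latticePoint (r v) ∈ support (starFan G (cone {w})) :=
        latticePoint_mem_support hstar (hq _ hvE (by simp))
          (Finset.mem_image_of_mem _ (Finset.mem_sdiff.2 ⟨Finset.mem_insert_self _ _, hv.1⟩))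
      have := h2 ⟨_, hs1⟩ ⟨_, hs2⟩ ⟨_, hnb _ hvE (by simp),
        latticePoint_mem_cone (Finset.mem_insert_self _ _)⟩ (by rw [hsr, realMap_latticePoint])
      rw [pairing_latticePoint, ← val_cast, ← val_cast] at this
      exact_mod_cast this
  · rintro ⟨m, h1, h2⟩
    refine ⟨m, fun x hx => ?_, fun x y hx hy => ?_⟩
    · obtain ⟨t, ht, hxt⟩ := mem_cone.1 hx
      rw [PL.apply_eq_sum hG f hw ht x hxt, ← hxt, pairing_sum_smul, Finset.sum_singleton,
        Finset.sum_singleton, h1]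
    · obtain ⟨σ, hσ, hxσ⟩ := hx
      rw [hG] at hσ
      obtain ⟨T, hT, hwT, T', hT', rfl⟩ := (mem_neighborhood_coneFan hE hw).1 hσ
      obtain ⟨t, ht, hxt⟩ := mem_cone.1 (cone_mono hT' hxσ)
      have hinj : Set.InjOn r ((T \ {w} : Finset P) : Set P) := by
        refine (injOn_link_singleton hE (w := w) (q := r) fun n => ?_).mono ?_
        · rw [hr, QuotientAddGroup.mk'_apply, QuotientAddGroup.eq_zero_iff,
            (hE.unimod _ hw).closure_latticeSet]
        · intro v hv
          obtain ⟨hv, hvw⟩ := Finset.mem_sdiff.1 (Finset.mem_coe.1 hv)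
          exact mem_link_of_mem hE hT (by simpa using hwT) hv hvw
      have hinv : ∀ v ∈ T \ {w}, Function.invFunOn r (T \ {w} : Finset P) (r v) = v := fun v hv =>
        hinj.leftInvOn_invFunOn hv
      -- Coefficients on `T \ {w}` are carried to the quotient, where distinct generators stay
      -- distinct. The term at `w` maps to zero.
      let s : StarLattice (cone {w}) → ℝ := fun z => t (Function.invFunOn r (T \ {w} : Finset P) z)
      have hy' : ∑ z ∈ (T \ {w}).image r, s z • latticePoint z =
          (y : RealSpace (StarLattice (cone {w}))) := by
        rw [Finset.sum_image (fun v hv v' hv' h => hinj hv hv' h), hy, hsr, ← hxt, map_sum,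
          ← Finset.sum_sdiff (Finset.singleton_subset_iff.2 hwT), Finset.sum_singleton, map_smul,
          realMap_latticePoint, hrw, latticePoint_zero, smul_zero, add_zero]
        refine Finset.sum_congr rfl fun v hv => ?_
        rw [map_smul, realMap_latticePoint]
        simp only [s, hinv v hv]
      rw [PL.apply_eq_sum hG f hT ht x hxt, ← hxt, pairing_sum_smul, PL.apply_eq_sum hstar g
        (hq T hT hwT) (t := s) ?_ y hy', Finset.sum_image (fun v hv v' hv' h => hinj hv hv' h),
        ← Finset.sum_sub_distrib, ← Finset.sum_sdiff (Finset.singleton_subset_iff.2 hwT),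
        Finset.sum_singleton, h1, sub_self, add_zero]
      · refine Finset.sum_congr rfl fun v hv => ?_
        obtain ⟨hvT, hvw⟩ := Finset.mem_sdiff.1 hv
        rw [h2 v (mem_link_of_mem hE hT (by simpa using hwT) hvT hvw)]
        simp only [s, hinv v hv]
        push_cast
        ring
      · intro z hz
        obtain ⟨v, hv, rfl⟩ := Finset.mem_image.1 hz
        simp only [s, hinv v hv]
        exact ht v (Finset.mem_sdiff.1 hv).1

namespace IsStarModel

variable {D : Finset (Finset N)} {S : Finset N} {q : N →+ P} {G : Set (Cone P)}

theorem exists_isRep (h : IsStarModel D S q G) (a : N → ℤ) : ∃ f : PL G, IsRep D S q a f := by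
  obtain ⟨m, hm⟩ := (h.complex.unimod S h.mem).exists_eq a
  obtain ⟨f, hf⟩ := h.quot.exists_PL h.fan (fun x =>
    a (Function.invFunOn q (link D S) x) - m (Function.invFunOn q (link D S) x))
  refine ⟨f, m, hm, fun v hv => ?_⟩
  rw [hf _ (singleton_mem hv) _ (Finset.mem_singleton_self _), h.inj.leftInvOn_invFunOn hv]

/-- The two linear corrections agree with `a` on `S`, so their difference vanishes on the kernel of
`q` and descends to the quotient. -/
theorem plClass_eq (h : IsStarModel D S q G) {a : N → ℤ} {f g : PL G} (hf : IsRep D S q a f)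
    (hg : IsRep D S q a g) : plClass f = plClass g := by
  obtain ⟨m, h1, h2⟩ := hf
  obtain ⟨k, h3, h4⟩ := hg
  obtain ⟨c, hc⟩ := exists_descend h.surj (m - k) (fun n hn => by
    refine map_eq_zero_of_mem_closure _ (fun v hv => ?_) ((h.ker n).1 hn)
    simp [h1 v hv, h3 v hv])
  refine plClass_eq_iff.2 ⟨c, PL.ext_val h.fan fun T hT w hw => ?_⟩
  obtain ⟨u, hu, rfl⟩ := h.exists_of_mem hT hw
  rw [val_linearPL c (latticePoint_mem_support h.fan hT hw), hc, val_sub, Pi.sub_apply, h2 u hu,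
    h4 u hu, AddMonoidHom.sub_apply]
  ring

/-- The converse ambiguity: values inducing the same function on the star differ there by a linear
function on `N`. -/
theorem eqOnStar_of_isRep (h : IsStarModel D S q G) {a b : N → ℤ} {f : PL G}
    (ha : IsRep D S q a f) (hb : IsRep D S q b f) :
    ∃ k : N →+ ℤ, EqOnStar D S b (a + ⇑k) := by
  obtain ⟨m, h1, h2⟩ := ha
  obtain ⟨k, h3, h4⟩ := hb
  refine ⟨k - m, eqOnStar_of_link h.complex (fun v hv => ?_) fun v hv => ?_⟩
  · simp [h1 v hv, h3 v hv]
  · have := h2 v hv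
    rw [h4 v hv] at this
    simp only [Pi.add_apply, AddMonoidHom.sub_apply]
    omega

theorem isRep_val (h : IsStarModel D S q G) (f : PL G) : IsRep D S q (val f ∘ q) f :=
  ⟨0, fun v hv => by simp [h.map_eq_zero hv], fun v _ => by simp⟩

theorem mk_apply_self (u : N) :
    QuotientAddGroup.mk' (AddSubgroup.closure (latticeSet (cone {q u}))) (q u) = 0 := by
  rw [QuotientAddGroup.mk'_apply, QuotientAddGroup.eq_zero_iff]
  exact AddSubgroup.subset_closure (latticePoint_mem_cone (Finset.mem_singleton_self _))

theorem starFan_eq [Module.Free ℤ P] (h : IsStarModel D S q G) {u : N} (hu : u ∈ link D S) :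
    starFan G (cone {q u}) = coneFan (quotComplex (quotComplex D S q) {q u}
      (QuotientAddGroup.mk' (AddSubgroup.closure (latticeSet (cone {q u}))))) := by
  rw [← map_neighborhood_coneFan h.quot (singleton_mem hu) _ (mk_apply_self u), ← h.fan]
  rfl

theorem exists_isStarRestriction [Module.Free ℤ P] (h : IsStarModel D S q G) {u : N}
    (hu : u ∈ link D S) (f : PL G) :
    ∃ g : PL (starFan G (cone {q u})), IsStarRestriction (cone {q u}) f g := by
  have hqu := singleton_mem (q := q) hu
  obtain ⟨m, hm⟩ := (h.quot.unimod _ hqu).exists_eq (val f)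
  have hE := isFanComplex_quotComplex_singleton h.quot hqu (QuotientAddGroup.mk'_surjective
    (AddSubgroup.closure (latticeSet (cone {q u})))) (fun n => by
      rw [QuotientAddGroup.mk'_apply, QuotientAddGroup.eq_zero_iff,
        (h.quot.unimod _ hqu).closure_latticeSet])
  have hinj := injOn_link_singleton h.quot (w := q u)
    (q := QuotientAddGroup.mk' (AddSubgroup.closure (latticeSet (cone {q u})))) (fun n => by
      rw [QuotientAddGroup.mk'_apply, QuotientAddGroup.eq_zero_iff,
        (h.quot.unimod _ hqu).closure_latticeSet])
  obtain ⟨g, hg⟩ := hE.exists_PL (h.starFan_eq hu) (fun x =>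
    val f (Function.invFunOn (QuotientAddGroup.mk' _) (link (quotComplex D S q) {q u}) x) -
      m (Function.invFunOn (QuotientAddGroup.mk' _) (link (quotComplex D S q) {q u}) x))
  refine ⟨g, (h.quot.isStarRestriction_iff hqu h.fan rfl (mk_apply_self u) (h.starFan_eq hu)
    f g).2 ⟨m, hm _ (Finset.mem_singleton_self _), fun v hv => ?_⟩⟩
  rw [hg _ (singleton_mem hv) _ (Finset.mem_singleton_self _), hinj.leftInvOn_invFunOn hv]

/-- The same values `a` represent `f` and its restriction to the star at `u`. Only the linear
correction changes, which is why `IsEhrhartFunction` applies `Y u` to the unchanged `a`. -/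
theorem isRep_of_isStarRestriction [Module.Free ℤ P] (h : IsStarModel D S q G) {u : N}
    (hu : u ∈ link D S) {a : N → ℤ} {f : PL G} (hf : IsRep D S q a f)
    {g : PL (starFan G (cone {q u}))} (hg : IsStarRestriction (cone {q u}) f g) :
    IsRep D (insert u S)
      ((QuotientAddGroup.mk' (AddSubgroup.closure (latticeSet (cone {q u})))).comp q) a g := by
  obtain ⟨m, h1, h2⟩ := hf
  obtain ⟨k, h3, h4⟩ := (h.quot.isStarRestriction_iff (singleton_mem hu) h.fan rfl
    (mk_apply_self u) (h.starFan_eq hu) f g).1 hg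
  refine ⟨m + k.comp q, fun v hv => ?_, fun v hv => ?_⟩
  · rcases Finset.mem_insert.1 hv with rfl | hv
    · simp [h3, h2 v hu]
    · simp [h.map_eq_zero hv, h1 v hv]
  · obtain ⟨h5, h6⟩ := h.mem_link_insert hu hv
    rw [AddMonoidHom.comp_apply, h4 _ h6, h2 v h5]
    simp only [AddMonoidHom.add_apply, AddMonoidHom.comp_apply]
    ring

theorem eqOnStar_courant [Module.Free ℤ P] (h : IsStarModel D S q G) {u : N} (hu : u ∈ link D S)
    {δ : PL G} (hδ : IsCourant (cone {q u}) δ) : EqOnStar D S (val δ ∘ q) (Pi.single u 1) := by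
  have hδ' := (h.quot.isCourant_iff h.fan (singleton_mem hu) δ).1 hδ
  refine eqOnStar_of_link h.complex (fun v hv => ?_) fun v hv => ?_
  · have hvu : v ≠ u := fun h => hu.1 (h ▸ hv)
    simp [h.map_eq_zero hv, hvu]
  · rw [Function.comp_apply, hδ' _ (singleton_mem hv) _ (Finset.mem_singleton_self _)]
    by_cases hvu : v = u
    · subst hvu; simp
    · rw [if_neg (fun heq => hvu (h.inj hv hu heq)), Pi.single_eq_of_ne hvu]

end IsStarModel

theorem IsRep.congr {D : Finset (Finset N)} {S : Finset N} {q : N →+ P} {G : Set (Cone P)}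
    (hS : S ∈ D) {a b : N → ℤ} {f : PL G} (hf : IsRep D S q a f) (hab : EqOnStar D S a b) :
    IsRep D S q b f := by
  obtain ⟨m, h1, h2⟩ := hf
  refine ⟨m, fun v hv => by rw [h1 v hv, hab S hS subset_rfl v hv], fun v hv => ?_⟩
  rw [h2 v hv, hab _ hv.2 (Finset.subset_insert _ _) v (Finset.mem_insert_self _ _)]

theorem IsRep.add_linear {D : Finset (Finset N)} {S : Finset N} {q : N →+ P} {G : Set (Cone P)}
    {a : N → ℤ} {f : PL G} (hf : IsRep D S q a f) (k : N →+ ℤ) : IsRep D S q (a + ⇑k) f := by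
  obtain ⟨m, h1, h2⟩ := hf
  refine ⟨m + k, fun v hv => by simp [h1 v hv], fun v hv => ?_⟩
  rw [h2 v hv]
  simp

theorem IsRep.sub {D : Finset (Finset N)} {S : Finset N} {q : N →+ P} {G : Set (Cone P)}
    {a b : N → ℤ} {f g : PL G} (hf : IsRep D S q a f) (hg : IsRep D S q b g) :
    IsRep D S q (a - b) (f - g) := by
  obtain ⟨m, h1, h2⟩ := hf
  obtain ⟨k, h3, h4⟩ := hg
  refine ⟨m - k, fun v hv => by simp [h1 v hv, h3 v hv], fun v hv => ?_⟩
  rw [val_sub, Pi.sub_apply, h2 v hv, h4 v hv]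
  simp only [Pi.sub_apply, AddMonoidHom.sub_apply]
  ring

theorem IsEhrhartPolynomial.exists_isEhrhartFunction {P : Type*} [AddCommGroup P]
    {G : Set (Cone P)} {χ : ReducedPL G → ℤ} (hχ : IsEhrhartPolynomial G χ) :
    ∀ {N : Type*} [AddCommGroup N] [Module.Free ℤ N] [Module.Finite ℤ N] {D : Finset (Finset N)}
      {S : Finset N} {q : N →+ P}, IsStarModel D S q G →
      ∃ X, IsEhrhartFunction D S X ∧ ∀ a f, IsRep D S q a f → X a = χ (plClass f) := by
  induction hχ with
  | @intro P _ G χ hG χstar hstar hzero hrec ih =>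
    intro N _ _ _ D S q h
    obtain ⟨hfree, -⟩ := h.free_finite
    choose r hr using h.exists_isRep
    have hX : ∀ a f, IsRep D S q a f → χ (plClass (r a)) = χ (plClass f) := fun a f hf => by
      rw [h.plClass_eq (hr a) hf]
    have hray : ∀ u ∈ link D S, cone {q u} ∈ rays G := fun u hu => h.mem_ray_iff.2 ⟨u, hu, rfl⟩
    have hY : ∀ u, ∃ Y, ∀ hu : u ∈ link D S, IsEhrhartFunction D (insert u S) Y ∧
        ∀ a g, IsRep D (insert u S)
          ((QuotientAddGroup.mk' (AddSubgroup.closure (latticeSet (cone {q u})))).comp q) a g →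
          Y a = χstar _ (hray u hu) (plClass g) := fun u => by
      by_cases hu : u ∈ link D S
      · obtain ⟨Y, hY⟩ := ih _ (hray u hu) (h.step hu)
        exact ⟨Y, fun _ => hY⟩
      · exact ⟨0, fun h => absurd h hu⟩
    choose Y hY using hY
    refine ⟨fun a => χ (plClass (r a)), ⟨S, _, fun a b hab => ?_, fun a m => ?_, ?_, Y,
      fun u hu => (hY u hu).1, fun u hu a => ?_⟩, hX⟩
    · exact hX a _ ((hr b).congr h.mem (fun T hT hST v hv => (hab T hT hST v hv).symm))
    · exact (hX a _ (hr a)).symm ▸ hX _ _ ((hr a).add_linear m)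
    · rw [hX 0 0 ⟨0, by simp, fun v _ => by
        have : val (0 : PL G) = 0 := by simpa using val_sub (0 : PL G) 0
        simp [this]⟩]
      exact hzero
    · obtain ⟨δ, hδ⟩ := h.quot.exists_PL h.fan (fun x => if x = q u then 1 else 0)
      have hδ' := (h.quot.isCourant_iff h.fan (IsStarModel.singleton_mem hu) δ).2 hδ
      obtain ⟨g, hg⟩ := h.exists_isStarRestriction hu (r a)
      have hrep : IsRep D S q (a - Pi.single u 1) (r a - δ) :=
        (hr a).sub ((h.isRep_val δ).congr h.mem (h.eqOnStar_courant hu hδ'))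
      change χ (plClass (r a)) = χ (plClass (r (a - Pi.single u 1))) + _
      rw [hX _ _ hrep, (hY u hu).2 a g (h.isRep_of_isStarRestriction hu (hr a) hg)]
      exact hrec _ (hray u hu) (r a) δ g hδ' hg

/-- A linear function on the quotient pulls back to one on `N`, under which `X` is invariant. So `X`
descends to classes. -/
theorem IsEhrhartFunction.exists_eq {D : Finset (Finset N)} {S : Finset N} {X : (N → ℤ) → ℤ}
    (hX : IsEhrhartFunction D S X) {q : N →+ P} {G : Set (Cone P)} (h : IsStarModel D S q G) :
    ∃ χ : ReducedPL G → ℤ, ∀ f, χ (plClass f) = X (val f ∘ q) := by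
  refine ⟨fun c => X (val (Quotient.out c) ∘ q), fun f => ?_⟩
  obtain ⟨m, hm⟩ := plClass_eq_iff.1 (show plClass f = plClass (Quotient.out (plClass f)) from
    (Quotient.out_eq (plClass f)).symm)
  rw [← hX.add_linear (val f ∘ q) (m.comp q)]
  refine hX.congr (eqOnStar_of_link h.complex (fun v hv => by simp [h.map_eq_zero hv])
    fun v hv => ?_)
  have h1 := val_linearPL m (latticePoint_mem_support h.fan (IsStarModel.singleton_mem hv)
    (Finset.mem_singleton_self (q v)))
  rw [hm, val_sub, Pi.sub_apply] at h1
  simp only [Function.comp_apply, Pi.add_apply, AddMonoidHom.coe_comp]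
  omega

theorem IsEhrhartFunction.isEhrhartPolynomial {N : Type*} [AddCommGroup N] [Module.Free ℤ N]
    [Module.Finite ℤ N] {D : Finset (Finset N)} {S : Finset N} {X : (N → ℤ) → ℤ}
    (hX : IsEhrhartFunction D S X) :
    ∀ {P : Type*} [AddCommGroup P] {q : N →+ P} {G : Set (Cone P)}, IsStarModel D S q G →
      ∀ χ : ReducedPL G → ℤ, (∀ f, χ (plClass f) = X (val f ∘ q)) → IsEhrhartPolynomial G χ := by
  induction hX with
  | intro S X hcongr hadd hzero Y hstar hrec ih =>
    intro P _ q G h χ hχ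
    obtain ⟨hfree, hfin⟩ := h.free_finite
    have hex : ∀ ρ ∈ rays G, ∃ χρ : ReducedPL (starFan G ρ) → ℤ,
        IsEhrhartPolynomial (starFan G ρ) χρ ∧ ∀ (f δ : PL G) (g : PL (starFan G ρ)),
        IsCourant ρ δ → IsStarRestriction ρ f g →
          χ (plClass f) = χ (plClass (f - δ)) + χρ (plClass g) := by
      intro ρ hρ
      obtain ⟨u, hu, rfl⟩ := h.mem_ray_iff.1 hρ
      obtain ⟨χρ, hχρ⟩ := (hstar u hu).exists_eq (h.step hu)
      refine ⟨χρ, ih u hu (h.step hu) χρ hχρ, fun f δ g hδ hg => ?_⟩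
      -- Values pulled back from `f` and from `g` both represent `g`, hence differ on the star by a
      -- linear function and have the same image under `Y u`.
      obtain ⟨k, hk⟩ := (h.step hu).eqOnStar_of_isRep
        (h.isRep_of_isStarRestriction hu (h.isRep_val f) hg) ((h.step hu).isRep_val g)
      have h1 : EqOnStar D S (val (f - δ) ∘ q) (val f ∘ q - Pi.single u 1) := by
        intro T hT hST v hv
        have := h.eqOnStar_courant hu hδ T hT hST v hv
        rw [Pi.sub_apply, ← this, val_sub]
        rfl
      rw [hχ, hχ, hχρ, hcongr _ _ h1, (hstar u hu).congr hk, (hstar u hu).add_linear]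
      exact hrec u hu _
    choose χstar h1 h2 using hex
    refine ⟨G, χ, ?_, χstar, h1, ?_, h2⟩
    · rw [h.fan]
      exact h.quot.isUnimodularFan
    · have h0 : val (0 : PL G) = 0 := by simpa using val_sub (0 : PL G) 0
      have := hχ 0
      rw [h0] at this
      exact this.trans hzero

end Transfer

/-! ### Euler characteristics of unions of cells of hyperplane arrangements. -/

section Arrangement

variable {V ι : Type*} [AddCommGroup V] [Module ℝ V] (l : ι → V →ₗ[ℝ] ℝ)

/-- The signs at `x` of the linear forms with index in `A`. -/
def signVec (A : Finset ι) (x : V) : ι → SignType :=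
  fun i => if i ∈ A then SignType.sign (l i x) else 0

/-- The span of the cell with sign vector `s` in the arrangement of the linear forms with index in
`A`. -/
def zeroSpace (A : Finset ι) (s : ι → SignType) : Submodule ℝ V where
  carrier := {x | ∀ i ∈ A, s i = 0 → l i x = 0}
  add_mem' := fun hx hy i hi hs => by rw [map_add, hx i hi hs, hy i hi hs, add_zero]
  zero_mem' := fun i _ _ => map_zero _
  smul_mem' := fun c x hx i hi hs => by rw [map_smul, hx i hi hs, smul_zero]

variable {l}

theorem mem_zeroSpace {A : Finset ι} {s : ι → SignType} {x : V} :
    x ∈ zeroSpace l A s ↔ ∀ i ∈ A, s i = 0 → l i x = 0 := Iff.rfl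

theorem signVec_eq_iff {A : Finset ι} {x y : V} :
    signVec l A x = signVec l A y ↔
      ∀ i ∈ A, SignType.sign (l i x) = SignType.sign (l i y) := by
  constructor
  · intro h i hi
    have := congrFun h i
    simpa only [signVec, if_pos hi] using this
  · intro h
    funext i
    by_cases hi : i ∈ A
    · simp only [signVec, if_pos hi, h i hi]
    · simp only [signVec, if_neg hi]

theorem finite_range_signVec (A : Finset ι) : (Set.range (signVec l A)).Finite := by
  refine (Set.finite_range (fun (g : A → SignType) (i : ι) =>
    if h : i ∈ A then g ⟨i, h⟩ else 0)).subset ?_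
  rintro _ ⟨x, rfl⟩
  refine ⟨fun i => SignType.sign (l i x), ?_⟩
  funext i
  simp [signVec]

theorem signVec_insert {A : Finset ι} {a : ι} (ha : a ∉ A) (x : V) :
    signVec l (insert a A) x = Function.update (signVec l A x) a (SignType.sign (l a x)) := by
  funext i
  by_cases hi : i = a
  · subst hi
    simp [signVec]
  · simp [signVec, hi]

theorem signVec_apply_of_notMem {A : Finset ι} {a : ι} (ha : a ∉ A) (x : V) :
    signVec l A x a = 0 := by simp [signVec, ha]

theorem signVec_convex {A : Finset ι} {x y : V} (h : signVec l A x = signVec l A y) {t u : ℝ}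
    (ht : 0 < t) (hu : 0 < u) : signVec l A (t • x + u • y) = signVec l A x := by
  rw [signVec_eq_iff] at h ⊢
  intro i hi
  have := h i hi
  rw [map_add, map_smul, map_smul, smul_eq_mul, smul_eq_mul]
  rcases lt_trichotomy (l i x) 0 with hx | hx | hx
  · rw [sign_neg hx, eq_comm, sign_eq_neg_one_iff] at this
    rw [sign_neg hx, sign_eq_neg_one_iff]
    nlinarith [mul_neg_of_pos_of_neg ht hx, mul_neg_of_pos_of_neg hu this]
  · rw [hx, sign_zero, eq_comm, sign_eq_zero_iff] at this
    rw [hx, this]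
    simp
  · rw [sign_pos hx, eq_comm, sign_eq_one_iff] at this
    rw [sign_pos hx, sign_eq_one_iff]
    positivity

/-- Nonzero signs persist under small perturbations, and zero signs persist along `w`. So a cell is
open in its span. -/
theorem signVec_add_smul {A : Finset ι} {x w : V} (hw : w ∈ zeroSpace l A (signVec l A x)) :
    ∃ δ > (0 : ℝ), signVec l A (x + δ • w) = signVec l A x ∧
      signVec l A (x + (-δ) • w) = signVec l A x := by
  have hev : ∀ᶠ ε : ℝ in nhds 0, signVec l A (x + ε • w) = signVec l A x := by
    simp only [signVec_eq_iff]
    rw [Filter.eventually_all_finset]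
    intro i hi
    have hc : Continuous fun ε : ℝ => l i (x + ε • w) := by
      simp only [map_add, map_smul, smul_eq_mul]
      fun_prop
    rcases lt_trichotomy (l i x) 0 with hx | hx | hx
    · have := (hc.tendsto 0).eventually_lt_const (u := 0) (by simpa using hx)
      filter_upwards [this] with ε hε
      rw [sign_neg hε, sign_neg hx]
    · have hw0 : l i w = 0 := hw i hi (by simp [signVec, hi, hx])
      filter_upwards with ε
      simp [hw0]
    · have := (hc.tendsto 0).eventually_const_lt (u := 0) (by simpa using hx)
      filter_upwards [this] with ε hε
      rw [sign_pos hε, sign_pos hx]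
  obtain ⟨δ, hδ, h⟩ := Metric.eventually_nhds_iff.1 hev
  refine ⟨δ / 2, by positivity, h ?_, h ?_⟩
  · rw [Real.dist_eq, sub_zero, abs_of_pos (by positivity)]; linarith
  · rw [Real.dist_eq, sub_zero, abs_neg, abs_of_pos (by positivity)]; linarith

theorem zeroSpace_insert_update {A : Finset ι} {a : ι} (ha : a ∉ A) (s : ι → SignType)
    (ε : SignType) : zeroSpace l (insert a A) (Function.update s a ε) =
      if ε = 0 then zeroSpace l A s ⊓ LinearMap.ker (l a) else zeroSpace l A s := by
  have hne : ∀ i ∈ A, i ≠ a := fun i hi h => ha (h ▸ hi)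
  ext x
  split_ifs with h
  · rw [Submodule.mem_inf, mem_zeroSpace, mem_zeroSpace, LinearMap.mem_ker]
    constructor
    · intro hx
      exact ⟨fun i hi hs => hx i (Finset.mem_insert_of_mem hi) (by simpa [hne i hi] using hs),
        hx a (Finset.mem_insert_self _ _) (by simp [h])⟩
    · rintro ⟨h1, h2⟩ i hi hs
      rcases Finset.mem_insert.1 hi with rfl | hi
      · exact h2
      · exact h1 i hi (by simpa [hne i hi] using hs)
  · rw [mem_zeroSpace, mem_zeroSpace]
    constructor
    · intro hx i hi hs
      exact hx i (Finset.mem_insert_of_mem hi) (by simpa [hne i hi] using hs)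
    · intro h1 i hi hs
      rcases Finset.mem_insert.1 hi with rfl | hi
      · exact absurd (by simpa using hs) h
      · exact h1 i hi (by simpa [hne i hi] using hs)

theorem finrank_inf_ker [FiniteDimensional ℝ V] {W : Submodule ℝ V} {f : V →ₗ[ℝ] ℝ} {w : V}
    (hw : w ∈ W) (hf : f w ≠ 0) :
    Module.finrank ℝ (W ⊓ LinearMap.ker f : Submodule ℝ V) + 1 = Module.finrank ℝ W := by
  have h0 : f.domRestrict W ≠ 0 := fun h => hf (LinearMap.congr_fun h ⟨w, hw⟩)
  have h1 : (LinearMap.ker (f.domRestrict W)).map W.subtype = W ⊓ LinearMap.ker f := by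
    ext x
    simp [and_comm]
  rw [← Module.Dual.finrank_ker_add_one_of_ne_zero (f := f.domRestrict W) h0,
    ← Submodule.finrank_map_subtype_eq W, h1]

/-- Refining an arrangement by one hyperplane preserves the alternating sum over the pieces of a
cell. -/
theorem sum_refine_cell [FiniteDimensional ℝ V] {A : Finset ι} {a : ι} (ha : a ∉ A) (x : V) :
    ∑ s ∈ (finite_range_signVec (l := l) (insert a A)).toFinset with
        Function.update s a 0 = signVec l A x,
      (-1 : ℤ) ^ Module.finrank ℝ (zeroSpace l (insert a A) s) =
    (-1) ^ Module.finrank ℝ (zeroSpace l A (signVec l A x)) := by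
  set s0 := signVec l A x with hs0
  set W := zeroSpace l A s0 with hW
  -- The pieces of the old cell are indexed by the signs that the new form takes on it.
  have hfib : ((finite_range_signVec (l := l) (insert a A)).toFinset.filter
      (fun s => Function.update s a 0 = s0)) =
      (Finset.univ.filter (fun ε => ∃ y, signVec l A y = s0 ∧ SignType.sign (l a y) = ε)).image
        (fun ε => Function.update s0 a ε) := by
    ext s
    simp only [Finset.mem_filter, Set.Finite.mem_toFinset, Set.mem_range, Finset.mem_image,
      Finset.mem_univ, true_and]
    constructor
    · rintro ⟨⟨y, rfl⟩, h⟩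
      rw [signVec_insert ha, Function.update_idem, ← signVec_apply_of_notMem (l := l) ha y,
        Function.update_eq_self] at h
      exact ⟨_, ⟨y, h, rfl⟩, by rw [signVec_insert ha, h]⟩
    · rintro ⟨ε, ⟨y, hy, rfl⟩, rfl⟩
      refine ⟨⟨y, by rw [signVec_insert ha, hy]⟩, ?_⟩
      rw [Function.update_idem, ← signVec_apply_of_notMem (l := l) ha x, Function.update_eq_self]
  rw [hfib, Finset.sum_image (fun ε _ ε' _ h => by simpa using congrFun h a)]
  refine (Finset.sum_congr rfl fun ε _ => (by rw [zeroSpace_insert_update ha] :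
    (-1 : ℤ) ^ Module.finrank ℝ (zeroSpace l (insert a A) (Function.update s0 a ε)) =
      (-1) ^ Module.finrank ℝ
        (if ε = 0 then W ⊓ LinearMap.ker (l a) else W : Submodule ℝ V))).trans ?_
  have hconst : (∀ y, signVec l A y = s0 → SignType.sign (l a y) = SignType.sign (l a x)) →
      (SignType.sign (l a x) = 0 → W ≤ LinearMap.ker (l a)) →
      ∑ ε with ∃ y, signVec l A y = s0 ∧ SignType.sign (l a y) = ε, (-1 : ℤ) ^
        Module.finrank ℝ (if ε = 0 then W ⊓ LinearMap.ker (l a) else W : Submodule ℝ V) =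
      (-1) ^ Module.finrank ℝ W := by
    intro h1 h2
    have : (Finset.univ.filter (fun ε => ∃ y, signVec l A y = s0 ∧ SignType.sign (l a y) = ε)) =
        {SignType.sign (l a x)} := by
      ext ε
      simp only [Finset.mem_filter, Finset.mem_univ, true_and, Finset.mem_singleton]
      exact ⟨fun ⟨y, hy, h⟩ => h ▸ h1 y hy, fun h => ⟨x, rfl, h.symm⟩⟩
    rw [this, Finset.sum_singleton]
    by_cases h : SignType.sign (l a x) = 0
    · rw [if_pos h, inf_eq_left.2 (h2 h)]
    · rw [if_neg h]
  -- Three cases: the new hyperplane contains the span of the cell, cuts the cell, or misses it. The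
  -- cell is subdivided only in the second.
  by_cases hker : W ≤ LinearMap.ker (l a)
  · refine hconst (fun y hy => ?_) fun _ => hker
    have hmem : y - x ∈ W := fun i hi hsi => by
      have h1 := signVec_eq_iff.1 (hs0 ▸ hy : signVec l A y = signVec l A x) i hi
      rw [hs0, signVec, if_pos hi] at hsi
      rw [hsi, sign_eq_zero_iff] at h1
      rw [map_sub, h1, sign_eq_zero_iff.1 hsi, sub_zero]
    have h2 : l a (y - x) = 0 := hker hmem
    rw [map_sub, sub_eq_zero] at h2
    rw [h2]
  · obtain ⟨w, hw, hlw⟩ := Set.not_subset.1 hker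
    have hlw : l a w ≠ 0 := hlw
    by_cases hz : ∃ y, signVec l A y = s0 ∧ l a y = 0
    · obtain ⟨y, hy, hy0⟩ := hz
      have key : ∀ w' ∈ W, 0 < l a w' → (∃ z, signVec l A z = s0 ∧ SignType.sign (l a z) = 1) ∧
          ∃ z, signVec l A z = s0 ∧ SignType.sign (l a z) = -1 := by
        intro w' hw' hpos
        obtain ⟨δ, hδ, h1, h2⟩ := signVec_add_smul (l := l) (A := A) (x := y) (w := w')
          (by rw [hy]; exact hw')
        refine ⟨⟨_, h1.trans hy, ?_⟩, ⟨_, h2.trans hy, ?_⟩⟩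
        · rw [sign_eq_one_iff, map_add, hy0, zero_add, map_smul, smul_eq_mul]
          positivity
        · rw [sign_eq_neg_one_iff, map_add, hy0, zero_add, map_smul, smul_eq_mul, neg_mul,
            neg_lt_zero]
          positivity
      have hall : (Finset.univ.filter (fun ε => ∃ y, signVec l A y = s0 ∧
          SignType.sign (l a y) = ε)) = Finset.univ := by
        have h3 : (∃ z, signVec l A z = s0 ∧ SignType.sign (l a z) = 1) ∧
            ∃ z, signVec l A z = s0 ∧ SignType.sign (l a z) = -1 := by
          rcases lt_or_gt_of_ne hlw with h | h
          · exact key (-w) (W.neg_mem hw) (by rw [map_neg]; linarith)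
          · exact key w hw h
        refine Finset.filter_true_of_mem fun ε _ => ?_
        rcases ε with _ | _ | _
        · exact ⟨y, hy, by rw [hy0, sign_zero]; rfl⟩
        · exact h3.2
        · exact h3.1
      -- The pieces have dimensions `d`, `d - 1` and `d`, and `2 * (-1) ^ d + (-1) ^ (d - 1) = (-1)
      -- ^ d`.
      rw [hall]
      have huniv : (Finset.univ : Finset SignType) = {0, 1, -1} := by decide
      rw [huniv, Finset.sum_insert (by decide), Finset.sum_insert (by decide),
        Finset.sum_singleton, if_pos rfl, if_neg (by decide), if_neg (by decide),
        ← finrank_inf_ker hw hlw]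
      ring
    · push Not at hz
      refine hconst (fun y hy => ?_) fun h => absurd (sign_eq_zero_iff.1 h) (hz x rfl)
      -- Cells are convex, so points of opposite sign would put the positive combination with
      -- weights `-l a z` and `l a y` in the cell and on the hyperplane.
      have key : ∀ y z, signVec l A y = s0 → signVec l A z = s0 → 0 < l a y → ¬ l a z < 0 := by
        intro y z hy hz' h1 h2
        refine hz ((-l a z) • y + (l a y) • z) ?_ ?_
        · rw [signVec_convex (hy.trans hz'.symm) (by linarith) h1, hy]
        · rw [map_add, map_smul, map_smul, smul_eq_mul, smul_eq_mul]
          ring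
      rcases lt_or_gt_of_ne (hz y hy) with h1 | h1 <;>
        rcases lt_or_gt_of_ne (hz x rfl) with h2 | h2
      · rw [sign_neg h1, sign_neg h2]
      · exact absurd h1 (key x y rfl hy h2)
      · exact absurd h2 (key y x hy rfl h1)
      · rw [sign_pos h1, sign_pos h2]

variable (l) in
/-- The combinatorial Euler characteristic of a union `X` of cells of an arrangement. -/
def eulerSum (A : Finset ι) (X : Set V) : ℤ :=
  ∑ s ∈ (finite_range_signVec (l := l) A).toFinset,
    if ∃ x ∈ X, signVec l A x = s then (-1) ^ Module.finrank ℝ (zeroSpace l A s) else 0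

variable (l) in
/-- `X` is a union of cells of the arrangement. -/
def IsSaturated (A : Finset ι) (X : Set V) : Prop :=
  ∀ x y, signVec l A x = signVec l A y → x ∈ X → y ∈ X

theorem IsSaturated.mono {A B : Finset ι} (hAB : A ⊆ B) {X : Set V} (h : IsSaturated l A X) :
    IsSaturated l B X := fun x y hxy =>
  h x y (signVec_eq_iff.2 fun i hi => signVec_eq_iff.1 hxy i (hAB hi))

theorem isSaturated_cell (A : Finset ι) (x₀ : V) :
    IsSaturated l A {x | signVec l A x = signVec l A x₀} :=
  fun _ _ hxy hx => hxy.symm.trans hx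

/-- Group the cells of the finer arrangement by the coarse cell containing them. Saturation means
that `X` takes all or none of each group, and `sum_refine_cell` evaluates the group. -/
theorem eulerSum_insert [FiniteDimensional ℝ V] {A : Finset ι} {a : ι} (ha : a ∉ A) {X : Set V}
    (hX : IsSaturated l A X) : eulerSum l (insert a A) X = eulerSum l A X := by
  have hup : ∀ x, Function.update (signVec l (insert a A) x) a 0 = signVec l A x := fun x => by
    rw [signVec_insert ha, Function.update_idem, ← signVec_apply_of_notMem (l := l) ha x,
      Function.update_eq_self]
  rw [eulerSum, eulerSum, ← Finset.sum_fiberwise_of_maps_to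
    (t := (finite_range_signVec (l := l) A).toFinset) (g := fun s => Function.update s a 0)]
  · refine Finset.sum_congr rfl fun s hs => ?_
    obtain ⟨x, rfl⟩ := (Set.Finite.mem_toFinset _).1 hs
    rw [← sum_refine_cell ha x]
    have hiff : ∀ s ∈ (finite_range_signVec (l := l) (insert a A)).toFinset.filter
        (fun s => Function.update s a 0 = signVec l A x),
        ((∃ y ∈ X, signVec l (insert a A) y = s) ↔ ∃ y ∈ X, signVec l A y = signVec l A x) := by
      intro s hs
      obtain ⟨hs, hsx⟩ := Finset.mem_filter.1 hs
      obtain ⟨z, rfl⟩ := (Set.Finite.mem_toFinset _).1 hs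
      rw [hup] at hsx
      constructor
      · rintro ⟨y, hy, h⟩
        exact ⟨y, hy, by rw [← hup, h, hup, hsx]⟩
      · rintro ⟨y, hy, h⟩
        exact ⟨z, hX y z (h.trans hsx.symm) hy, rfl⟩
    rw [Finset.sum_congr rfl (fun s hs => if_congr (hiff s hs) rfl rfl)]
    split_ifs
    · rfl
    · exact Finset.sum_const_zero
  · intro s hs
    obtain ⟨x, rfl⟩ := (Set.Finite.mem_toFinset _).1 hs
    rw [hup]
    simp

theorem eulerSum_mono [FiniteDimensional ℝ V] {A B : Finset ι} (hAB : A ⊆ B) {X : Set V}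
    (hX : IsSaturated l A X) : eulerSum l B X = eulerSum l A X := by
  have key : ∀ C : Finset ι, eulerSum l (C ∪ A) X = eulerSum l A X := by
    intro C
    induction C using Finset.induction_on with
    | empty => rw [Finset.empty_union]
    | insert a C _ ih =>
      rw [Finset.insert_union]
      by_cases ha : a ∈ C ∪ A
      · rw [Finset.insert_eq_of_mem ha, ih]
      · rw [eulerSum_insert ha (hX.mono Finset.subset_union_right), ih]
  rw [← key B, Finset.union_eq_left.2 hAB]

theorem eulerSum_cell (A : Finset ι) (x₀ : V) :
    eulerSum l A {x | signVec l A x = signVec l A x₀} =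
      (-1) ^ Module.finrank ℝ (zeroSpace l A (signVec l A x₀)) := by
  rw [eulerSum, Finset.sum_eq_single (signVec l A x₀)]
  · rw [if_pos ⟨x₀, rfl, rfl⟩]
  · rintro s - hs
    rw [if_neg]
    rintro ⟨x, hx, rfl⟩
    exact hs hx
  · intro h
    exact absurd ((finite_range_signVec (l := l) A).mem_toFinset.2 ⟨x₀, rfl⟩) h

theorem eulerSum_partition {τ : Type*} (A : Finset ι) {X : Set V} (I : Finset τ) (C : τ → Set V)
    (hC : ∀ T ∈ I, IsSaturated l A (C T)) (hX : ∀ x, x ∈ X ↔ ∃ T ∈ I, x ∈ C T)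
    (hdisj : ∀ T ∈ I, ∀ T' ∈ I, ∀ x, x ∈ C T → x ∈ C T' → T = T') :
    eulerSum l A X = ∑ T ∈ I, eulerSum l A (C T) := by
  simp only [eulerSum]
  rw [Finset.sum_comm]
  refine Finset.sum_congr rfl fun s _ => ?_
  split_ifs with h
  · obtain ⟨x, hx, rfl⟩ := h
    obtain ⟨T, hT, hxT⟩ := (hX x).1 hx
    rw [Finset.sum_eq_single T]
    · rw [if_pos ⟨x, hxT, rfl⟩]
    · intro T' hT' hne
      rw [if_neg]
      rintro ⟨y, hy, hyx⟩
      exact hne (hdisj T' hT' T hT x (hC T' hT' y x hyx hy) hxT)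
    · exact fun h => absurd hT h
  · refine (Finset.sum_eq_zero fun T hT => ?_).symm
    rw [if_neg]
    rintro ⟨x, hx, rfl⟩
    exact h ⟨x, (hX x).2 ⟨T, hT, hx⟩, rfl⟩

/-- Additivity of the Euler characteristic for a partition of a cell into cells of other
arrangements. -/
theorem neg_one_pow_finrank_eq_sum [FiniteDimensional ℝ V] {τ : Type*} (A₀ : Finset ι) (x₀ : V)
    (I : Finset τ) (A : τ → Finset ι) (y : τ → V)
    (hX : ∀ x, signVec l A₀ x = signVec l A₀ x₀ ↔
      ∃ T ∈ I, signVec l (A T) x = signVec l (A T) (y T))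
    (hdisj : ∀ T ∈ I, ∀ T' ∈ I, ∀ x, signVec l (A T) x = signVec l (A T) (y T) →
      signVec l (A T') x = signVec l (A T') (y T') → T = T') :
    (-1 : ℤ) ^ Module.finrank ℝ (zeroSpace l A₀ (signVec l A₀ x₀)) =
      ∑ T ∈ I, (-1) ^ Module.finrank ℝ (zeroSpace l (A T) (signVec l (A T) (y T))) := by
  -- In this common refinement all the given cells are unions of cells, so additivity is a
  -- rearrangement of one finite sum.
  set B := A₀ ∪ I.biUnion A with hB
  have hA : ∀ T ∈ I, A T ⊆ B := fun T hT =>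
    (Finset.subset_biUnion_of_mem A hT).trans Finset.subset_union_right
  rw [← eulerSum_cell, ← eulerSum_mono (B := B)
    (X := {x | signVec l A₀ x = signVec l A₀ x₀}) Finset.subset_union_left (isSaturated_cell _ _),
    eulerSum_partition (X := {x | signVec l A₀ x = signVec l A₀ x₀}) B I (fun T => {x | signVec l (A T) x = signVec l (A T) (y T)})
      (fun T hT => (isSaturated_cell _ _).mono (hA T hT)) hX hdisj]
  exact Finset.sum_congr rfl fun T hT => by
    rw [eulerSum_mono (hA T hT) (isSaturated_cell _ _), eulerSum_cell]

end Arrangement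

/-! ### Signed counts of cones in complete fans. -/

section Complete

variable {N : Type*} [AddCommGroup N] {D : Finset (Finset N)}

/-- The relative interior of the cone of `T` modulo the span of its face `S`. -/
def starCell (S T : Finset N) : Set (RealSpace N) :=
  {x | ∃ t : N → ℝ, (∀ v ∈ T, v ∉ S → 0 < t v) ∧ ∑ v ∈ T, t v • latticePoint v = x}

/-- Move `x` far in the direction of an interior point `y` of the cone of `S`. One cone contains `n
• y + x` for infinitely many `n`, so it contains `y`, and its generators include `S`. -/
theorem IsFanComplex.exists_mem_starCell [Module.Free ℤ N] [Module.Finite ℤ N]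
    (hD : IsFanComplex D) (hcomp : ∀ x, ∃ S ∈ D, x ∈ cone S) {S : Finset N} (hS : S ∈ D)
    (x : RealSpace N) : ∃ T ∈ D, S ⊆ T ∧ x ∈ starCell S T := by
  let y : RealSpace N := ∑ v ∈ S, (1 : ℝ) • latticePoint v
  choose T hTD hT using fun n : ℕ => hcomp ((n : ℝ) • y + x)
  obtain ⟨⟨T₀, hT₀⟩, hinf⟩ := Finite.exists_infinite_fiber (fun n => (⟨T n, hTD n⟩ : D))
  have hinf' : Set.Infinite {n | T n = T₀} := by
    have h := Set.infinite_coe_iff.1 hinf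
    refine h.mono fun n hn => ?_
    exact congrArg Subtype.val (hn : (⟨T n, hTD n⟩ : D) = ⟨T₀, hT₀⟩)
  have hU := hD.unimod T₀ hT₀
  obtain ⟨A, hA⟩ := hU.exists_coordinates
  -- An inequality of `cone T₀` that failed at `y` would fail at `n • y + x` for all large `n`.
  have hy : y ∈ cone T₀ := by
    rw [hU.mem_cone_iff hA]
    intro m hm
    by_contra hneg
    push Not at hneg
    obtain ⟨n, hn⟩ := exists_nat_gt (pairing m x / (-pairing m y))
    obtain ⟨n', hn', hlt⟩ := hinf'.exists_gt n
    have h1 := (hU.mem_cone_iff hA _).1 (hn' ▸ hT n') m hm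
    rw [map_add, map_smul, smul_eq_mul] at h1
    have h2 : (n : ℝ) < n' := by exact_mod_cast hlt
    rw [div_lt_iff₀ (by linarith)] at hn
    nlinarith
  have hST : S ⊆ T₀ := fun v hv =>
    hD.mem_inter_of_sum_eq hS hT₀ (s := fun _ => 1) (fun _ _ => zero_le_one) hy hv one_ne_zero
  obtain ⟨n, hn⟩ := hinf'.nonempty
  obtain ⟨t, ht, htx⟩ := mem_cone.1 (hn ▸ hT n)
  -- Generators outside `S` with coefficient zero are dropped to obtain strict positivity.
  -- Subtracting `n • y` affects only the coefficients on `S`, whose signs are free.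
  refine ⟨S ∪ T₀.filter (fun v => t v ≠ 0), hD.down T₀ hT₀ _
    (Finset.union_subset hST (Finset.filter_subset _ _)), Finset.subset_union_left,
    fun v => if v ∈ S then t v - n else t v, fun v hv hvS => ?_, ?_⟩
  · simp only [if_neg hvS]
    obtain ⟨hv, hne⟩ := Finset.mem_filter.1 ((Finset.mem_union.1 hv).resolve_left hvS)
    exact lt_of_le_of_ne (ht v hv) (Ne.symm hne)
  · have h1 : x = ∑ v ∈ T₀, (if v ∈ S then t v - n else t v) • latticePoint v := by
      have h2 : x = ∑ v ∈ T₀, t v • latticePoint v - (n : ℝ) • y := by rw [htx]; abel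
      have h3 : (n : ℝ) • y = ∑ v ∈ T₀, (if v ∈ S then (n : ℝ) else 0) • latticePoint v := by
        simp only [y, one_smul, ite_smul, zero_smul, Finset.smul_sum]
        rw [← Finset.sum_filter, Finset.filter_mem_eq_inter, Finset.inter_eq_right.2 hST]
      rw [h2, h3, ← Finset.sum_sub_distrib]
      refine Finset.sum_congr rfl fun v _ => ?_
      rw [← sub_smul]
      split_ifs <;> simp
    rw [h1]
    refine Finset.sum_subset (Finset.union_subset hST (Finset.filter_subset _ _))
      fun v hv hv' => ?_
    rw [Finset.mem_union, not_or, Finset.mem_filter, not_and, not_not] at hv'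
    simp only [if_neg hv'.1, hv'.2 hv, zero_smul]

/-- A large multiple of the sum of `S` makes all coefficients positive in both expressions, and then
the shifted point lies in both cones. So star cells at `S` are disjoint. -/
theorem IsFanComplex.starCell_subset (hD : IsFanComplex D) {S T T' : Finset N} (hT : T ∈ D)
    (hT' : T' ∈ D) (hST : S ⊆ T) (hST' : S ⊆ T') {x : RealSpace N} (hx : x ∈ starCell S T)
    (hx' : x ∈ starCell S T') : T ⊆ T' := by
  obtain ⟨t, ht, rfl⟩ := hx
  obtain ⟨t', ht', hx'⟩ := hx'
  obtain ⟨c, hc⟩ : ∃ c : ℝ, ∀ v ∈ S, 0 < t v + c ∧ 0 < t' v + c := by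
    refine ⟨∑ v ∈ S, (|t v| + |t' v|) + 1, fun v hv => ?_⟩
    have h1 := Finset.single_le_sum (f := fun v => |t v| + |t' v|)
      (fun v _ => by positivity) hv
    have h2 := neg_abs_le (t v)
    have h3 := neg_abs_le (t' v)
    have h4 := abs_nonneg (t v)
    have h5 := abs_nonneg (t' v)
    constructor <;> linarith
  have hshift : ∀ (R : Finset N) (s : N → ℝ), S ⊆ R →
      ∑ v ∈ R, (s v + if v ∈ S then c else 0) • latticePoint v =
        ∑ v ∈ R, s v • latticePoint v + c • ∑ v ∈ S, latticePoint v := by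
    intro R s hR
    simp only [add_smul, Finset.sum_add_distrib, ite_smul, zero_smul, Finset.smul_sum]
    rw [← Finset.sum_filter, Finset.filter_mem_eq_inter, Finset.inter_eq_right.2 hR]
  have hpos : ∀ v ∈ T, 0 < t v + if v ∈ S then c else 0 := fun v hv => by
    split_ifs with h
    · exact (hc v h).1
    · simpa using ht v hv h
  have hpos' : ∀ v ∈ T', 0 < t' v + if v ∈ S then c else 0 := fun v hv => by
    split_ifs with h
    · exact (hc v h).2
    · simpa using ht' v hv h
  intro u hu
  refine hD.mem_inter_of_sum_eq hT hT' (fun v hv => (hpos v hv).le) ?_ hu (hpos u hu).ne'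
  rw [hshift T t hST, ← hx', ← hshift T' t' hST']
  exact sum_mem_cone fun v hv => (hpos' v hv).le

/-- The pairings of `N_ℝ` with `M` as a family of linear forms. -/
abbrev forms (N : Type*) [AddCommGroup N] : (N →+ ℤ) → RealSpace N →ₗ[ℝ] ℝ := pairing

/-- The dual functions off `S`, equations for the span of `T`, and `B` form an arrangement having
this set as a single cell, of dimension `#T`. -/
theorem IsUnimod.exists_arrangement [Module.Free ℤ N] [Module.Finite ℤ N] {S T : Finset N}
    (hT : IsUnimod T) (B : Finset (N →+ ℤ)) {y : RealSpace N}
    (hy : y ∈ starCell S T) (hB : ∀ k ∈ B, 0 < pairing k y) :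
    ∃ A : Finset (N →+ ℤ), (∀ x, signVec (forms N) A x = signVec (forms N) A y ↔
      x ∈ starCell S T ∧ ∀ k ∈ B, 0 < pairing k x) ∧
      Module.finrank ℝ (zeroSpace (forms N) A (signVec (forms N) A y)) = T.card := by
  obtain ⟨C, hC1, hC2⟩ := hT.exists_coordinates
  have hC0 : ∀ k ∈ C, ∀ t : N → ℝ, pairing k (∑ v ∈ T, t v • latticePoint v) = 0 :=
    fun k hk t => by
      rw [pairing_sum_smul]
      exact Finset.sum_eq_zero fun v hv => by rw [hC1 k hk v hv, Int.cast_zero, mul_zero]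
  obtain ⟨t₀, ht₀, rfl⟩ := hy
  set y := ∑ v ∈ T, t₀ v • latticePoint v with hy
  have hdual : ∀ v ∈ T, v ∉ S → 0 < pairing (hT.dual v) y := fun v hv hvS => by
    rw [hy, hT.pairing_dual hv]
    exact ht₀ v hv hvS
  refine ⟨(T \ S).image hT.dual ∪ C ∪ B, fun x => ?_, ?_⟩
  · rw [signVec_eq_iff]
    constructor
    · intro h
      have h1 : ∀ k ∈ C, pairing k x = 0 := fun k hk => by
        have := h k (by simp [hk])
        rwa [hC0 k hk, sign_zero, sign_eq_zero_iff] at this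
      refine ⟨⟨fun v => pairing (hT.dual v) x, fun v hv hvS => ?_, (hC2 x h1).symm⟩,
        fun k hk => ?_⟩
      · have := h (hT.dual v) (Finset.mem_union_left _ (Finset.mem_union_left _
          (Finset.mem_image_of_mem _ (Finset.mem_sdiff.2 ⟨hv, hvS⟩))))
        rwa [sign_pos (hdual v hv hvS), sign_eq_one_iff] at this
      · have := h k (by simp [hk])
        rwa [sign_pos (hB k hk), sign_eq_one_iff] at this
    · rintro ⟨⟨t, ht, rfl⟩, hBx⟩ k hk
      rcases Finset.mem_union.1 hk with hk | hk
      · rcases Finset.mem_union.1 hk with hk | hk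
        · obtain ⟨v, hv, rfl⟩ := Finset.mem_image.1 hk
          obtain ⟨hv, hvS⟩ := Finset.mem_sdiff.1 hv
          rw [sign_pos (hdual v hv hvS), sign_eq_one_iff]
          change 0 < pairing _ _
          rw [hT.pairing_dual hv]
          exact ht v hv hvS
        · change SignType.sign (pairing k _) = SignType.sign (pairing k _)
          rw [hC0 k hk, hC0 k hk]
      · rw [sign_pos (hB k hk), sign_pos (hBx k hk)]
  · rw [← hT.finrank_span]
    set A := (T \ S).image hT.dual ∪ C ∪ B with hA
    have hW : zeroSpace (forms N) A (signVec (forms N) A y) =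
        Submodule.span ℝ (latticePoint '' (T : Set N)) := by
      apply le_antisymm
      · intro x hx
        rw [hC2 x fun k hk => hx k (by simp [hA, hk]) ?_]
        · exact Submodule.sum_mem _ fun v hv => Submodule.smul_mem _ _
            (Submodule.subset_span ⟨v, hv, rfl⟩)
        · rw [signVec, if_pos (by simp [hA, hk]), sign_eq_zero_iff]
          exact hC0 k hk t₀
      · rw [Submodule.span_le]
        rintro _ ⟨v, hv, rfl⟩ k hk hk0
        rw [signVec, if_pos hk, sign_eq_zero_iff] at hk0
        rcases Finset.mem_union.1 hk with hk | hk
        · rcases Finset.mem_union.1 hk with hk | hk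
          · obtain ⟨u, hu, rfl⟩ := Finset.mem_image.1 hk
            obtain ⟨hu, huS⟩ := Finset.mem_sdiff.1 hu
            exact absurd hk0 (hdual u hu huS).ne'
          · change pairing k _ = 0
            rw [pairing_latticePoint, hC1 k hk v hv, Int.cast_zero]
        · exact absurd hk0 (hB k hk).ne'
    rw [hW]

theorem finrank_realSpace [Module.Free ℤ N] :
    Module.finrank ℝ (RealSpace N) = Module.finrank ℤ N :=
  Module.finrank_baseChange

/-- The open region cut out by `B` is one full-dimensional cell. The star cells at `S` partition it,
so its Euler characteristic is computed in two ways. -/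
theorem IsFanComplex.sum_starCell [Module.Free ℤ N] [Module.Finite ℤ N] (hD : IsFanComplex D)
    (hcomp : ∀ x, ∃ S ∈ D, x ∈ cone S) {S : Finset N} (hS : S ∈ D) (B : Finset (N →+ ℤ))
    (hB : ∃ x : RealSpace N, ∀ k ∈ B, 0 < pairing k x) :
    ∑ T ∈ D with S ⊆ T ∧ ∃ y ∈ starCell S T, ∀ k ∈ B, 0 < pairing k y, (-1 : ℤ) ^ T.card =
      (-1) ^ Module.finrank ℤ N := by
  obtain ⟨x₀, hx₀⟩ := hB
  have hsB : ∀ x, signVec (forms N) B x = signVec (forms N) B x₀ ↔ ∀ k ∈ B, 0 < pairing k x := by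
    intro x
    rw [signVec_eq_iff]
    refine forall₂_congr fun k hk => ?_
    rw [sign_pos (hx₀ k hk), sign_eq_one_iff]
  have htop : zeroSpace (forms N) B (signVec (forms N) B x₀) = ⊤ := by
    refine eq_top_iff.2 fun x _ k hk hk0 => ?_
    rw [signVec, if_pos hk, sign_eq_zero_iff] at hk0
    exact absurd hk0 (hx₀ k hk).ne'
  have hex : ∀ T, ∃ (y : RealSpace N) (A : Finset (N →+ ℤ)), T ∈ D.filter (fun T => S ⊆ T ∧
      ∃ y ∈ starCell S T, ∀ k ∈ B, 0 < pairing k y) →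
      (∀ x, signVec (forms N) A x = signVec (forms N) A y ↔
        x ∈ starCell S T ∧ ∀ k ∈ B, 0 < pairing k x) ∧
      Module.finrank ℝ (zeroSpace (forms N) A (signVec (forms N) A y)) = T.card := by
    intro T
    by_cases hT : T ∈ D.filter (fun T => S ⊆ T ∧ ∃ y ∈ starCell S T, ∀ k ∈ B, 0 < pairing k y)
    · obtain ⟨hTD, hST, y, hy, hyB⟩ := Finset.mem_filter.1 hT
      obtain ⟨A, hA⟩ := (hD.unimod T hTD).exists_arrangement B hy hyB
      exact ⟨y, A, fun _ => hA⟩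
    · exact ⟨0, ∅, fun h => absurd h hT⟩
  choose y A hA using hex
  have h := neg_one_pow_finrank_eq_sum (l := forms N) B x₀ (D.filter (fun T => S ⊆ T ∧
      ∃ y ∈ starCell S T, ∀ k ∈ B, 0 < pairing k y)) A y ?_ ?_
  · rw [htop, finrank_top, finrank_realSpace] at h
    rw [h]
    exact Finset.sum_congr rfl fun T hT => by rw [(hA T hT).2]
  · intro x
    rw [hsB]
    constructor
    · intro hx
      obtain ⟨T, hT, hST, hxT⟩ := hD.exists_mem_starCell hcomp hS x
      have hT' : T ∈ D.filter (fun T => S ⊆ T ∧ ∃ y ∈ starCell S T, ∀ k ∈ B, 0 < pairing k y) :=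
        Finset.mem_filter.2 ⟨hT, hST, x, hxT, hx⟩
      exact ⟨T, hT', ((hA T hT').1 x).2 ⟨hxT, hx⟩⟩
    · rintro ⟨T, hT, hx⟩
      exact (((hA T hT).1 x).1 hx).2
  · intro T hT T' hT' x hx hx'
    have h1 := ((hA T hT).1 x).1 hx
    have h2 := ((hA T' hT').1 x).1 hx'
    obtain ⟨hTD, hST, -⟩ := Finset.mem_filter.1 hT
    obtain ⟨hTD', hST', -⟩ := Finset.mem_filter.1 hT'
    exact (hD.starCell_subset hTD hTD' hST hST' h1.1 h2.1).antisymm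
      (hD.starCell_subset hTD' hTD hST' hST h2.1 h1.1)

theorem starCell_nonempty_pos {S T : Finset N} {m : N →+ ℤ} (hm : ∀ v ∈ S, m v = 0) :
    (∃ y ∈ starCell S T, 0 < pairing m y) ↔ ∃ v ∈ T, 0 < m v := by
  constructor
  · rintro ⟨_, ⟨t, ht, rfl⟩, hy⟩
    rw [pairing_sum_smul] at hy
    obtain ⟨v, hv, hpos⟩ := Finset.exists_lt_of_sum_lt (s := T) (f := fun _ => (0 : ℝ))
      (g := fun v => t v * (m v : ℝ)) (by simpa using hy)
    refine ⟨v, hv, ?_⟩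
    have hvS : v ∉ S := fun h => by simp [hm v h] at hpos
    have := (pos_iff_pos_of_mul_pos hpos).1 (ht v hv hvS)
    exact_mod_cast this
  · rintro ⟨u, hu, hpos⟩
    have hpos' : (1 : ℝ) ≤ m u := by exact_mod_cast hpos
    -- With all coefficients `1` and an extra `c` at `u`, the term `c * m u ≥ c` outweighs the
    -- negative contributions.
    set c : ℝ := ∑ v ∈ T, |(m v : ℝ)| with hc
    have hc0 : 0 ≤ c := Finset.sum_nonneg fun v _ => abs_nonneg _
    refine ⟨_, ⟨fun v => 1 + if v = u then c else 0, fun v _ _ => by positivity, rfl⟩, ?_⟩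
    rw [pairing_sum_smul]
    simp only [add_mul, one_mul, ite_mul, zero_mul, Finset.sum_add_distrib, Finset.sum_ite_eq',
      if_pos hu]
    have h1 : -c + |(m u : ℝ)| + m u ≤ ∑ v ∈ T, (m v : ℝ) := by
      rw [hc, ← Finset.add_sum_erase _ _ hu, ← Finset.add_sum_erase _ (fun v => (m v : ℝ)) hu]
      have : -∑ v ∈ T.erase u, |(m v : ℝ)| ≤ ∑ v ∈ T.erase u, (m v : ℝ) := by
        rw [← Finset.sum_neg_distrib]
        exact Finset.sum_le_sum fun v _ => neg_abs_le _
      linarith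
    have h2 : |(m u : ℝ)| = m u := abs_of_pos (by linarith)
    rw [h2] at h1
    nlinarith

/-- Subtract from the count of all `T ⊇ S` the count of those whose star cell meets `m > 0`. Both
equal `(-1) ^ n`, with `n` the rank of `N`, when that halfspace is nonempty, that is for `m ≠ 0`. -/
theorem IsFanComplex.sum_nonpos [Module.Free ℤ N] [Module.Finite ℤ N] (hD : IsFanComplex D)
    (hcomp : ∀ x, ∃ S ∈ D, x ∈ cone S) {S : Finset N} (hS : S ∈ D) (m : N →+ ℤ)
    (hm : ∀ v ∈ S, m v = 0) :
    ∑ T ∈ D with S ⊆ T ∧ ∀ v ∈ T, m v ≤ 0, (-1 : ℤ) ^ T.card =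
      if m = 0 then (-1) ^ Module.finrank ℤ N else 0 := by
  have hall := hD.sum_starCell hcomp hS ∅ ⟨0, by simp⟩
  have hall' : ∑ T ∈ D with S ⊆ T, (-1 : ℤ) ^ T.card = (-1) ^ Module.finrank ℤ N := by
    rw [← hall]
    refine Finset.sum_congr (Finset.filter_congr fun T _ => ?_) fun _ _ => rfl
    refine ⟨fun h => ⟨h, ∑ v ∈ T, (1 : ℝ) • latticePoint v,
      ⟨fun _ => 1, fun _ _ _ => one_pos, rfl⟩, by simp⟩, fun h => h.1⟩
  split_ifs with h0
  · subst h0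
    simpa using hall'
  · have hex : ∃ x : RealSpace N, ∀ k ∈ ({m} : Finset (N →+ ℤ)), 0 < pairing k x := by
      obtain ⟨n, hn⟩ := DFunLike.ne_iff.1 h0
      rw [AddMonoidHom.zero_apply] at hn
      rcases lt_or_gt_of_ne hn with hn | hn
      · exact ⟨latticePoint (-n), by simpa using hn⟩
      · exact ⟨latticePoint n, by simpa using hn⟩
    have hpos := hD.sum_starCell hcomp hS {m} hex
    simp only [Finset.mem_singleton, forall_eq, starCell_nonempty_pos hm] at hpos
    have hsplit := Finset.sum_filter_add_sum_filter_not (D.filter (fun T => S ⊆ T))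
      (fun T => ∀ v ∈ T, m v ≤ 0) (fun T => (-1 : ℤ) ^ T.card)
    rw [Finset.filter_filter, Finset.filter_filter, hall'] at hsplit
    push Not at hsplit
    linarith

theorem IsFanComplex.card_le_finrank [Module.Free ℤ N] [Module.Finite ℤ N] (hD : IsFanComplex D)
    {S : Finset N} (hS : S ∈ D) : S.card ≤ Module.finrank ℤ N := by
  rw [← finrank_realSpace, ← (hD.unimod S hS).finrank_span]
  exact Submodule.finrank_le _

/-- For `S` of maximal size the only star cell at `S` is the span of `S`, and star cells cover the
space. -/
theorem IsFanComplex.exists_card_eq [Module.Free ℤ N] [Module.Finite ℤ N] (hD : IsFanComplex D)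
    (hcomp : ∀ x, ∃ S ∈ D, x ∈ cone S) : ∃ S ∈ D, S.card = Module.finrank ℤ N := by
  obtain ⟨S, hS, hmax⟩ := D.exists_max_image Finset.card ⟨∅, hD.empty_mem⟩
  refine ⟨S, hS, ?_⟩
  rw [← finrank_realSpace, ← (hD.unimod S hS).finrank_span]
  have htop : Submodule.span ℝ (latticePoint '' (S : Set N)) = ⊤ := by
    refine eq_top_iff.2 fun x _ => ?_
    obtain ⟨T, hT, hST, t, -, rfl⟩ := hD.exists_mem_starCell hcomp hS x
    rw [← Finset.eq_of_subset_of_card_le hST (hmax T hT)]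
    exact Submodule.sum_mem _ fun v hv => Submodule.smul_mem _ _
      (Submodule.subset_span ⟨v, hv, rfl⟩)
  rw [htop, finrank_top]

end Complete

/-! ### Generation by linear and Courant functions, and uniqueness. -/

section Uniqueness

variable {N : Type*} [AddCommGroup N] {D : Finset (Finset N)}

/-- A property of values at vertices that is invariant under linear functions and Courant functions
and depends only on the star of `S` holds everywhere if it holds at zero. -/
theorem IsFanComplex.star_induction (hD : IsFanComplex D) {S : Finset N} (hS : S ∈ D)
    {p : (N → ℤ) → Prop} (congr : ∀ a b, EqOnStar D S a b → p a → p b)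
    (add_linear : ∀ (a : N → ℤ) (m : N →+ ℤ), p a → p (a + ⇑m)) (zero : p 0)
    (step : ∀ u ∈ link D S, ∀ a, p (a - Pi.single u 1) ↔ p a) (a : N → ℤ) : p a := by
  have hint : ∀ u ∈ link D S, ∀ (k : ℤ) a, p a → p (a + k • Pi.single u 1) := by
    intro u hu k a ha
    induction k using Int.induction_on with
    | zero => simpa using ha
    | succ k ih =>
      rw [← step u hu]
      convert ih using 1
      rw [add_smul, one_smul]
      abel
    | pred k ih =>
      rw [← step u hu] at ih
      convert ih using 1
      rw [sub_smul, one_smul]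
      abel
  have hfin : ∀ (L : Finset N), (∀ u ∈ L, u ∈ link D S) → ∀ c : N → ℤ,
      p (∑ u ∈ L, c u • Pi.single u 1) := by
    intro L
    induction L using Finset.induction_on with
    | empty => intro _ c; simpa using zero
    | insert u L huL ih =>
      intro hL c
      rw [Finset.sum_insert huL, add_comm]
      exact hint u (hL u (Finset.mem_insert_self _ _)) _ _
        (ih (fun v hv => hL v (Finset.mem_insert_of_mem hv)) c)
  obtain ⟨m, hm⟩ := (hD.unimod S hS).exists_eq a
  let L := (D.biUnion id).filter (· ∈ link D S)
  have hL : ∀ v, v ∈ L ↔ v ∈ link D S := fun v => by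
    simp only [L, Finset.mem_filter, Finset.mem_biUnion, id, and_iff_right_iff_imp]
    exact fun hv => ⟨_, hv.2, Finset.mem_insert_self _ _⟩
  -- Subtracting a linear `m` that agrees with `a` on `S` leaves, on the star, an integral
  -- combination of Courant functions at link vertices.
  refine congr _ _ ?_ (add_linear _ m (hfin L (fun u hu => (hL u).1 hu) (fun v => a v - m v)))
  have hsum : ∀ v, (∑ u ∈ L, (a u - m u) • (Pi.single u 1 : N → ℤ)) v =
      if v ∈ L then a v - m v else 0 := fun v => by
    rw [Finset.sum_apply]
    simp [Pi.single_apply]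
  refine eqOnStar_of_link hD (fun v hv => ?_) fun v hv => ?_
  · rw [Pi.add_apply, hsum, if_neg (fun h => ((hL v).1 h).1 hv), hm v hv, zero_add]
  · rw [Pi.add_apply, hsum, if_pos ((hL v).2 hv), sub_add_cancel]

/-- By induction the functions on the smaller stars agree, so both recursions have the same
increments, and equality spreads from zero. -/
theorem IsEhrhartFunction.unique (hD : IsFanComplex D) {S : Finset N} {X : (N → ℤ) → ℤ}
    (hX : IsEhrhartFunction D S X) (hS : S ∈ D) {X' : (N → ℤ) → ℤ}
    (hX' : IsEhrhartFunction D S X') : X = X' := by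
  induction hX generalizing X' with
  | intro S X hcongr hadd hzero Y hstar hrec ih =>
    obtain ⟨_, _, hcongr', hadd', hzero', Y', hstar', hrec'⟩ := hX'
    funext a
    refine hD.star_induction hS (p := fun a => X a = X' a) (fun a b hab h => ?_)
      (fun a m h => ?_) (hzero.trans hzero'.symm) (fun u hu a => ?_) a
    · rw [← hcongr a b hab, ← hcongr' a b hab, h]
    · rw [hadd, hadd', h]
    · rw [hrec u hu a, hrec' u hu a, ih u hu hu.2 (hstar' u hu)]
      exact add_left_inj _ |>.symm

end Uniqueness

/-! ### The signed count on the fiber: recursion, value at zero and finiteness. -/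

section FiberCount

variable {N : Type*} [AddCommGroup N] {D : Finset (Finset N)}

/-- The sum of `(-1) ^ #T` over the members `T ⊇ S` of `D` on which `m ≤ a`, if `m = a` on `S`. -/
def fiberCount (D : Finset (Finset N)) (S : Finset N) (a : N → ℤ) (m : N →+ ℤ) : ℤ :=
  ∑ T ∈ D with S ⊆ T ∧ (∀ v ∈ S, m v = a v) ∧ ∀ v ∈ T, m v ≤ a v, (-1) ^ T.card

theorem fiberCount_congr {S : Finset N} (hS : S ∈ D) {a b : N → ℤ} (hab : EqOnStar D S a b)
    (m : N →+ ℤ) : fiberCount D S a m = fiberCount D S b m := by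
  refine Finset.sum_congr (Finset.filter_congr fun T hT => and_congr_right fun hST =>
    and_congr ?_ ?_) fun _ _ => rfl
  · exact forall₂_congr fun v hv => by rw [hab S hS subset_rfl v hv]
  · exact forall₂_congr fun v hv => by rw [hab T hT hST v hv]

theorem fiberCount_add_linear (S : Finset N) (a : N → ℤ) (k m : N →+ ℤ) :
    fiberCount D S (a + ⇑k) m = fiberCount D S a (m - k) := by
  refine Finset.sum_congr (Finset.filter_congr fun T hT => ?_) fun _ _ => rfl
  simp only [Pi.add_apply, AddMonoidHom.sub_apply, sub_le_iff_le_add, sub_eq_iff_eq_add]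

/-- By integrality, lowering `a u` by one excludes exactly those `T` that contain `u` with `m u = a
u`. These are the sets counted at `insert u S`. -/
theorem fiberCount_recursion {S : Finset N} {u : N} (hu : u ∉ S) (a : N → ℤ) (m : N →+ ℤ) :
    fiberCount D S a m =
      fiberCount D S (a - Pi.single u 1) m + fiberCount D (insert u S) a m := by
  have hne : ∀ v, v ≠ u → (a - Pi.single u 1 : N → ℤ) v = a v := fun v hv => by simp [hv]
  have heq : (a - Pi.single u 1 : N → ℤ) u = a u - 1 := by simp
  have hSv : ∀ v ∈ S, (a - Pi.single u 1 : N → ℤ) v = a v := fun v hv => hne v (fun h => hu (h ▸ hv))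
  simp only [fiberCount]
  rw [← Finset.sum_filter_add_sum_filter_not _ (fun T => ¬ (u ∈ T ∧ m u = a u)),
    Finset.filter_filter, Finset.filter_filter]
  congr 1 <;> refine Finset.sum_congr (Finset.filter_congr fun T hT => ?_) fun _ _ => rfl
  · constructor
    · rintro ⟨⟨h1, h2, h3⟩, h4⟩
      refine ⟨h1, fun v hv => by rw [hSv v hv, h2 v hv], fun v hv => ?_⟩
      by_cases hvu : v = u
      · subst hvu
        have := h3 v hv
        have h5 : m v ≠ a v := fun h => h4 ⟨hv, h⟩
        rw [heq]
        omega
      · rw [hne v hvu]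
        exact h3 v hv
    · rintro ⟨h1, h2, h3⟩
      refine ⟨⟨h1, fun v hv => by rw [← hSv v hv, h2 v hv], fun v hv => ?_⟩, ?_⟩
      · have := h3 v hv
        by_cases hvu : v = u
        · subst hvu
          rw [heq] at this
          omega
        · rwa [hne v hvu] at this
      · rintro ⟨h4, h5⟩
        have := h3 u h4
        rw [heq] at this
        omega
  · rw [not_not]
    constructor
    · rintro ⟨⟨h1, h2, h3⟩, h4, h5⟩
      refine ⟨Finset.insert_subset h4 h1, fun v hv => ?_, h3⟩
      rcases Finset.mem_insert.1 hv with rfl | hv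
      · exact h5
      · exact h2 v hv
    · rintro ⟨h1, h2, h3⟩
      exact ⟨⟨(Finset.subset_insert _ _).trans h1, fun v hv => h2 v (Finset.mem_insert_of_mem hv),
        h3⟩, h1 (Finset.mem_insert_self _ _), h2 u (Finset.mem_insert_self _ _)⟩

theorem IsFanComplex.fiberCount_zero [Module.Free ℤ N] [Module.Finite ℤ N] (hD : IsFanComplex D)
    (hcomp : ∀ x, ∃ S ∈ D, x ∈ cone S) {S : Finset N} (hS : S ∈ D) (m : N →+ ℤ) :
    fiberCount D S 0 m = if m = 0 then (-1) ^ Module.finrank ℤ N else 0 := by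
  by_cases hm : ∀ v ∈ S, m v = 0
  · rw [← hD.sum_nonpos hcomp hS m hm]
    refine Finset.sum_congr (Finset.filter_congr fun T hT => ?_) fun _ _ => rfl
    simp only [Pi.zero_apply, and_iff_right hm]
  · rw [if_neg (fun h => hm (by simp [h])), fiberCount, Finset.filter_false_of_mem,
      Finset.sum_empty]
    rintro T - ⟨-, h, -⟩
    exact hm h

/-- Induction on the codimension of `S`. At zero only `m = 0` counts, linear functions translate the
support, and a Courant function changes it by a finite set coming from a larger `S`. -/
theorem IsFanComplex.finite_fiberCount [Module.Free ℤ N] [Module.Finite ℤ N]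
    (hD : IsFanComplex D) (hcomp : ∀ x, ∃ S ∈ D, x ∈ cone S) {S : Finset N} (hS : S ∈ D)
    (a : N → ℤ) : {m | fiberCount D S a m ≠ 0}.Finite := by
  induction hn : Module.finrank ℤ N - S.card using Nat.strong_induction_on generalizing S a with
  | _ n ih =>
  refine hD.star_induction hS (p := fun a => {m | fiberCount D S a m ≠ 0}.Finite)
    (fun a b hab h => ?_) (fun a k h => ?_) ?_ (fun u hu a => ?_) a
  · simpa only [fiberCount_congr hS hab] using h
  · refine (h.image (· + k)).subset fun m hm => ⟨m - k, ?_, sub_add_cancel m k⟩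
    rwa [Set.mem_ofPred_eq, fiberCount_add_linear] at hm
  · refine (Set.finite_singleton (0 : N →+ ℤ)).subset fun m hm => ?_
    rw [Set.mem_ofPred_eq, hD.fiberCount_zero hcomp hS] at hm
    by_contra h
    exact hm (if_neg h)
  · have hcard := hD.card_le_finrank hu.2
    rw [Finset.card_insert_of_notMem hu.1] at hcard
    have hf := ih _ (by rw [Finset.card_insert_of_notMem hu.1]; omega) hu.2 a rfl
    constructor <;> intro h <;> refine (h.union hf).subset fun m hm => ?_ <;> by_contra hcon <;>
      rw [Set.mem_union, not_or, Set.mem_ofPred_eq, Set.mem_ofPred_eq, not_not, not_not] at hcon <;>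
      refine hm ?_ <;> have hr := fiberCount_recursion hu.1 a m (D := D)
    · rw [hr, hcon.1, hcon.2, add_zero]
    · rw [hcon.1, hcon.2, add_zero] at hr
      exact hr.symm

end FiberCount

/-! ### Ehrhart functions of bundles of complexes. -/

section Bundle

variable {N' N N'' : Type*} [AddCommGroup N'] [AddCommGroup N] [AddCommGroup N'']

/-- The complex `D` is the join of the images of `D'` and `D''` under the inclusion `i` of the
fiber lattice and a section `l` of the projection `p` over the vertices of `D''`. -/
structure IsComplexBundle (i : N' →+ N) (p : N →+ N'') (l : N'' → N) (D' : Finset (Finset N'))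
    (D'' : Finset (Finset N'')) (D : Finset (Finset N)) : Prop where
  injective : Function.Injective i
  exact : Function.Exact i p
  surjective : Function.Surjective p
  fiber : IsFanComplex D'
  base : IsFanComplex D''
  total : IsFanComplex D
  section_apply : ∀ S ∈ D'', ∀ v ∈ S, p (l v) = v
  mem_iff : ∀ T, T ∈ D ↔ ∃ S' ∈ D', ∃ S'' ∈ D'', T = S'.image i ∪ S''.image l

namespace IsComplexBundle

variable {i : N' →+ N} {p : N →+ N''} {l : N'' → N} {D' : Finset (Finset N')}
  {D'' : Finset (Finset N'')} {D : Finset (Finset N)}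

theorem join_mem (h : IsComplexBundle i p l D' D'' D) {S' : Finset N'} (hS' : S' ∈ D')
    {S'' : Finset N''} (hS'' : S'' ∈ D'') : S'.image i ∪ S''.image l ∈ D :=
  (h.mem_iff _).2 ⟨S', hS', S'', hS'', rfl⟩

theorem proj_incl (h : IsComplexBundle i p l D' D'' D) (x : N') : p (i x) = 0 :=
  (h.exact _).2 ⟨x, rfl⟩

theorem section_ne_incl (h : IsComplexBundle i p l D' D'' D) {S : Finset N''} (hS : S ∈ D'')
    {v : N''} (hv : v ∈ S) (x : N') : l v ≠ i x := fun heq => by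
  have := h.section_apply S hS v hv
  rw [heq, h.proj_incl] at this
  exact (h.base.unimod S hS).ne_zero hv this.symm

theorem section_eq_iff (h : IsComplexBundle i p l D' D'' D) {S T : Finset N''} (hS : S ∈ D'')
    {v : N''} (hv : v ∈ S) (hT : T ∈ D'') {w : N''} (hw : w ∈ T) : l v = l w ↔ v = w := by
  refine ⟨fun heq => ?_, fun h => h ▸ rfl⟩
  rw [← h.section_apply S hS v hv, heq, h.section_apply T hT w hw]

theorem join_subset (h : IsComplexBundle i p l D' D'' D) {S' T' : Finset N'} {S'' T'' : Finset N''}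
    (hS'' : S'' ∈ D'') (hT'' : T'' ∈ D'')
    (hsub : S'.image i ∪ S''.image l ⊆ T'.image i ∪ T''.image l) : S' ⊆ T' ∧ S'' ⊆ T'' := by
  constructor
  · intro x hx
    rcases Finset.mem_union.1 (hsub (Finset.mem_union_left _ (Finset.mem_image_of_mem i hx)))
      with hx | hx
    · obtain ⟨y, hy, hyx⟩ := Finset.mem_image.1 hx
      exact h.injective hyx ▸ hy
    · obtain ⟨v, hv, hvx⟩ := Finset.mem_image.1 hx
      exact absurd hvx (h.section_ne_incl hT'' hv x)
  · intro v hv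
    rcases Finset.mem_union.1 (hsub (Finset.mem_union_right _ (Finset.mem_image_of_mem l hv)))
      with hx | hx
    · obtain ⟨y, hy, hyx⟩ := Finset.mem_image.1 hx
      exact absurd hyx.symm (h.section_ne_incl hS'' hv y)
    · obtain ⟨w, hw, hwv⟩ := Finset.mem_image.1 hx
      exact ((h.section_eq_iff hT'' hw hS'' hv).1 hwv) ▸ hw

/-- Every recursion on the total complex is at a fiber vertex or at a base vertex, which are treated
separately. -/
theorem link_cases (h : IsComplexBundle i p l D' D'' D) {S' : Finset N'}
    {S'' : Finset N''} (hS'' : S'' ∈ D'') {u : N} (hu : u ∈ link D (S'.image i ∪ S''.image l)) :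
    (∃ u' ∈ link D' S', i u' = u) ∨ ∃ u'' ∈ link D'' S'', l u'' = u := by
  obtain ⟨hu1, hu2⟩ := hu
  obtain ⟨T', hT', T'', hT'', hT⟩ := (h.mem_iff _).1 hu2
  obtain ⟨h1, h2⟩ := h.join_subset hS'' hT'' (hT ▸ Finset.subset_insert _ _)
  rw [Finset.mem_union, not_or] at hu1
  rcases Finset.mem_union.1 (hT ▸ Finset.mem_insert_self _ _ : u ∈ T'.image i ∪ T''.image l)
    with hx | hx
  · obtain ⟨u', hu', rfl⟩ := Finset.mem_image.1 hx
    exact Or.inl ⟨u', mem_link_of_mem h.fiber hT' h1 hu' fun hc =>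
      hu1.1 (Finset.mem_image_of_mem _ hc), rfl⟩
  · obtain ⟨u'', hu'', rfl⟩ := Finset.mem_image.1 hx
    exact Or.inr ⟨u'', mem_link_of_mem h.base hT'' h2 hu'' fun hc =>
      hu1.2 (Finset.mem_image_of_mem _ hc), rfl⟩

theorem section_mem_link (h : IsComplexBundle i p l D' D'' D) {S' : Finset N'} (hS' : S' ∈ D')
    {S'' : Finset N''} (hS'' : S'' ∈ D'') {u : N''} (hu : u ∈ link D'' S'') :
    l u ∈ link D (S'.image i ∪ S''.image l) := by
  refine ⟨fun hc => ?_, ?_⟩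
  · rcases Finset.mem_union.1 hc with hc | hc
    · obtain ⟨x, -, hx⟩ := Finset.mem_image.1 hc
      exact h.section_ne_incl hu.2 (Finset.mem_insert_self _ _) x hx.symm
    · obtain ⟨v, hv, hvu⟩ := Finset.mem_image.1 hc
      exact hu.1 (((h.section_eq_iff hS'' hv hu.2 (Finset.mem_insert_self _ _)).1 hvu) ▸ hv)
  · rw [← Finset.union_insert, ← Finset.image_insert]
    exact h.join_mem hS' hu.2

theorem eqOnStar_fiber (h : IsComplexBundle i p l D' D'' D) {S' : Finset N'}
    {S'' : Finset N''} (hS'' : S'' ∈ D'') {a b : N → ℤ}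
    (hab : EqOnStar D (S'.image i ∪ S''.image l) a b) : EqOnStar D' S' (a ∘ i) (b ∘ i) :=
  fun _ hT' hST _ hv => hab _ (h.join_mem hT' hS'')
    (Finset.union_subset_union_left (Finset.image_subset_image hST)) _
    (Finset.mem_union_left _ (Finset.mem_image_of_mem _ hv))

theorem eqOnStar_base (h : IsComplexBundle i p l D' D'' D) {S' : Finset N'} (hS' : S' ∈ D')
    {S'' : Finset N''} {a b : N → ℤ}
    (hab : EqOnStar D (S'.image i ∪ S''.image l) a b) : EqOnStar D'' S'' (a ∘ l) (b ∘ l) :=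
  fun _ hT'' hST _ hv => hab _ (h.join_mem hS' hT'')
    (Finset.union_subset_union_right (Finset.image_subset_image hST)) _
    (Finset.mem_union_right _ (Finset.mem_image_of_mem _ hv))

/-- The Ehrhart function of a bundle in terms of that of the base. -/
def bundleFunction (r : N →+ N') (l : N'' → N) (i : N' →+ N) (D' : Finset (Finset N'))
    (S' : Finset N') (X : (N'' → ℤ) → ℤ) (a : N → ℤ) : ℤ :=
  (-1) ^ Module.finrank ℤ N' *
    ∑ᶠ m : N' →+ ℤ, fiberCount D' S' (a ∘ i) m * X ((a - ⇑(m.comp r)) ∘ l)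

/-- A double induction: the outer one follows the recursion of the base function, the inner one the
codimension of `S'` in the fiber. All joins `S' ∪ S''` are needed, since the stars of a bundle are
again of this type. -/
theorem isEhrhartFunction_bundleFunction [Module.Free ℤ N'] [Module.Finite ℤ N']
    (h : IsComplexBundle i p l D' D'' D) (hcomp : ∀ x, ∃ S ∈ D', x ∈ cone S)
    {r : N →+ N'} (hr : ∀ x, r (i x) = x) {S'' : Finset N''} {X : (N'' → ℤ) → ℤ}
    (hX : IsEhrhartFunction D'' S'' X) (hS'' : S'' ∈ D'') {S' : Finset N'} (hS' : S' ∈ D') :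
    IsEhrhartFunction D (S'.image i ∪ S''.image l) (bundleFunction r l i D' S' X) := by
  induction hX generalizing S' with
  | intro S'' X hcongr hadd hzero Y hstar hrec ih =>
  induction hn : Module.finrank ℤ N' - S'.card using Nat.strong_induction_on generalizing S' with
  | _ n ihn =>
  -- Finite support justifies adding the infinite sums termwise.
  have hsupp : ∀ (S : Finset N') (hS : S ∈ D') (a : N' → ℤ) (g : (N' →+ ℤ) → ℤ),
      (Function.support fun m => fiberCount D' S a m * g m).Finite := fun S hS a g =>
    (h.fiber.finite_fiberCount hcomp hS a).subset fun m hm => left_ne_zero_of_mul hm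
  have hY : ∀ u ∈ link D (S'.image i ∪ S''.image l), ∃ Z : (N → ℤ) → ℤ,
      IsEhrhartFunction D (insert u (S'.image i ∪ S''.image l)) Z ∧
      ∀ a, bundleFunction r l i D' S' X a =
        bundleFunction r l i D' S' X (a - Pi.single u 1) + Z a := by
    intro u hu
    rcases h.link_cases hS'' hu with ⟨u', hu', rfl⟩ | ⟨u'', hu'', rfl⟩
    · refine ⟨bundleFunction r l i D' (insert u' S') X, ?_, fun a => ?_⟩
      · have hcard := h.fiber.card_le_finrank hu'.2
        rw [Finset.card_insert_of_notMem hu'.1] at hcard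
        have := ihn _ (by rw [Finset.card_insert_of_notMem hu'.1]; omega) hu'.2 rfl
        rwa [Finset.image_insert, Finset.insert_union] at this
      · simp only [bundleFunction]
        rw [← mul_add, ← finsum_add_distrib (hsupp _ hS' _ _) (hsupp _ hu'.2 _ _)]
        congr 1
        refine finsum_congr fun m => ?_
        have h1 : (a - Pi.single (i u') 1) ∘ i = a ∘ i - Pi.single u' 1 := by
          funext x
          simp [Pi.single_apply, h.injective.eq_iff]
        -- Section vectors are never in the image of `i`, so the base factor does not see a change
        -- at a fiber vertex.
        have h2 : X ((a - Pi.single (i u') 1 - ⇑(m.comp r)) ∘ l) = X ((a - ⇑(m.comp r)) ∘ l) := by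
          refine hcongr _ _ fun T hT _ v hv => ?_
          simp [h.section_ne_incl hT hv u']
        rw [h1, h2, fiberCount_recursion hu'.1 (a ∘ i) m, add_mul]
    · refine ⟨bundleFunction r l i D' S' (Y u''), ?_, fun a => ?_⟩
      · have := ih u'' hu'' hu''.2 hS'
        rwa [Finset.image_insert, Finset.union_insert] at this
      · simp only [bundleFunction]
        rw [← mul_add, ← finsum_add_distrib (hsupp _ hS' _ _) (hsupp _ hS' _ _)]
        congr 1
        refine finsum_congr fun m => ?_
        have hmem := Finset.mem_insert_self u'' S''
        have h1 : (a - Pi.single (l u'') 1) ∘ i = a ∘ i := by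
          funext x
          simp [(h.section_ne_incl hu''.2 hmem x).symm]
        have h2 : X ((a - Pi.single (l u'') 1 - ⇑(m.comp r)) ∘ l) =
            X ((a - ⇑(m.comp r)) ∘ l - Pi.single u'' 1) := by
          refine hcongr _ _ fun T hT _ v hv => ?_
          simp only [Function.comp_apply, Pi.sub_apply, Pi.single_apply,
            h.section_eq_iff hT hv hu''.2 hmem]
          ring
        rw [h1, h2, ← mul_add, ← hrec u'' hu'']
  choose! Z hZ1 hZ2 using hY
  refine ⟨_, _, fun a b hab => ?_, fun a k => ?_, ?_, Z, hZ1, hZ2⟩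
  · simp only [bundleFunction]
    congr 1
    refine finsum_congr fun m => ?_
    rw [fiberCount_congr hS' (h.eqOnStar_fiber hS'' hab)]
    congr 1
    refine hcongr _ _ fun T hT hST v hv => ?_
    have := h.eqOnStar_base hS' hab T hT hST v hv
    simp only [Function.comp_apply, Pi.sub_apply] at this ⊢
    rw [this]
  · simp only [bundleFunction]
    congr 1
    -- The part of `k` coming from the fiber through `r` is absorbed by reindexing `m`. The rest
    -- vanishes on `N'`, so it is a linear function `c` on `N''`, under which `X` is invariant.
    obtain ⟨c, hc⟩ := exists_descend h.surjective (k - (k.comp i).comp r) (fun n hn => by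
      obtain ⟨x, rfl⟩ := (h.exact n).1 hn
      simp [hr])
    rw [← finsum_comp_equiv (Equiv.addRight (k.comp i))]
    refine finsum_congr fun m => ?_
    have h1 : (a + ⇑k) ∘ i = a ∘ i + ⇑(k.comp i) := rfl
    rw [h1, fiberCount_add_linear, Equiv.coe_addRight, add_sub_cancel_right]
    congr 1
    refine Eq.trans ?_ (hadd _ c)
    refine hcongr _ _ fun T hT _ v hv => ?_
    have h2 := hc (l v)
    rw [h.section_apply T hT v hv] at h2
    simp only [Function.comp_apply, Pi.sub_apply, Pi.add_apply, h2, AddMonoidHom.add_apply,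
      AddMonoidHom.sub_apply, AddMonoidHom.comp_apply]
    ring
  · simp only [bundleFunction]
    -- Completeness of the fiber leaves only `m = 0`, and its sign cancels the prefactor.
    rw [finsum_eq_single _ 0]
    · have h1 : (0 : N → ℤ) ∘ i = 0 := rfl
      have h2 : ((0 : N → ℤ) - ⇑((0 : N' →+ ℤ).comp r)) ∘ l = 0 := by
        funext v
        simp
      rw [h1, h2, hzero, h.fiber.fiberCount_zero hcomp hS', if_pos rfl, mul_one, ← mul_pow]
      simp
    · intro m hm
      have h1 : (0 : N → ℤ) ∘ i = 0 := rfl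
      rw [h1, h.fiber.fiberCount_zero hcomp hS', if_neg hm, zero_mul]

/-- Values at the vertices of the base, extended by zero along the fiber. -/
def pullback (p : N →+ N'') (b : N'' → ℤ) (n : N) : ℤ := if p n = 0 then 0 else b (p n)

theorem pullback_section (h : IsComplexBundle i p l D' D'' D) {S : Finset N''} (hS : S ∈ D'')
    {v : N''} (hv : v ∈ S) (b : N'' → ℤ) : pullback p b (l v) = b v := by
  rw [pullback, h.section_apply S hS v hv, if_neg ((h.base.unimod S hS).ne_zero hv)]

theorem pullback_incl (h : IsComplexBundle i p l D' D'' D) (b : N'' → ℤ) (x : N') :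
    pullback p b (i x) = 0 := by
  rw [pullback, if_pos (h.proj_incl x)]

/-- Values on the star of the lifted `S''` are determined by those on the fiber, here zero, and
those on the base star. Courant and linear functions of the base pull back to ones of the total
complex, so the base inherits the recursion. -/
theorem isEhrhartFunction_pullback (h : IsComplexBundle i p l D' D'' D) {T : Finset N}
    {X : (N → ℤ) → ℤ} (hX : IsEhrhartFunction D T X) {S'' : Finset N''} (hS'' : S'' ∈ D'')
    (hT : T = S''.image l) : IsEhrhartFunction D'' S'' (fun b => X (pullback p b)) := by
  have hjoin : ∀ S : Finset N'', S.image l = (∅ : Finset N').image i ∪ S.image l := fun S => by simp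
  induction hX generalizing S'' with
  | intro T X hcongr hadd hzero Y hstar hrec ih =>
  have hstar_cases : ∀ (a b : N → ℤ), (∀ x, a (i x) = b (i x)) →
      (∀ R ∈ D'', S'' ⊆ R → ∀ v ∈ R, a (l v) = b (l v)) → EqOnStar D T a b := by
    intro a b h1 h2 R hR hTR n hn
    obtain ⟨R', hR', R'', hR'', rfl⟩ := (h.mem_iff R).1 hR
    rw [hT, hjoin] at hTR
    rcases Finset.mem_union.1 hn with hn | hn
    · obtain ⟨x, -, rfl⟩ := Finset.mem_image.1 hn
      exact h1 x
    · obtain ⟨v, hv, rfl⟩ := Finset.mem_image.1 hn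
      exact h2 R'' hR'' (h.join_subset hS'' hR'' hTR).2 v hv
  have hlink : ∀ u ∈ link D'' S'', l u ∈ link D T := fun u hu => by
    rw [hT, hjoin]
    exact h.section_mem_link h.fiber.empty_mem hS'' hu
  refine ⟨_, _, fun a b hab => hcongr _ _ (hstar_cases _ _ (fun x => ?_) fun R hR hSR v hv => ?_),
    fun a m => ?_, ?_, fun u b => Y (l u) (pullback p b), fun u hu => ?_, fun u hu a => ?_⟩
  · rw [h.pullback_incl, h.pullback_incl]
  · rw [h.pullback_section hR hv, h.pullback_section hR hv, hab R hR hSR v hv]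
  · refine Eq.trans ?_ (hadd _ (m.comp p))
    congr 1
    funext n
    -- The extension by zero is compatible with linear functions because `m 0 = 0`.
    by_cases hn : p n = 0 <;> simp [pullback, hn]
  · have : pullback p (0 : N'' → ℤ) = 0 := by
      funext n
      simp [pullback]
    rw [this, hzero]
  · exact ih (l u) (hlink u hu) hu.2 (by rw [hT, Finset.image_insert])
  · rw [hrec (l u) (hlink u hu)]
    congr 1
    refine hcongr _ _ (hstar_cases _ _ (fun x => ?_) fun R hR hSR v hv => ?_)
    · have hne := h.section_ne_incl hu.2 (Finset.mem_insert_self _ _) x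
      rw [Pi.sub_apply, h.pullback_incl, h.pullback_incl, Pi.single_eq_of_ne hne.symm, sub_zero]
    · rw [Pi.sub_apply, h.pullback_section hR hv, h.pullback_section hR hv]
      simp only [Pi.sub_apply, Pi.single_apply,
        h.section_eq_iff hR hv hu.2 (Finset.mem_insert_self _ _)]

end IsComplexBundle

end Bundle

/-! ### The counts and dimension in the statement, and splittings. -/

section Translation

variable {N : Type*} [AddCommGroup N]

/-- On a simplicial cone the inequality `m ≤ g` holds once it holds at the generators. -/
theorem IsFanComplex.signedCount_eq [Module.Free ℤ N] {D : Finset (Finset N)}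
    (hD : IsFanComplex D) (g : PL (coneFan D)) (m : N →+ ℤ) :
    signedCount g m = fiberCount D ∅ (val g) m := by
  have hsub : sublevelFan g m =
      cone '' ((D.filter (fun T => ∀ v ∈ T, m v ≤ val g v) : Finset (Finset N)) :
        Set (Finset N)) := by
    ext σ
    constructor
    · rintro ⟨⟨T, hT, rfl⟩, h⟩
      refine ⟨T, Finset.mem_coe.2 (Finset.mem_filter.2 ⟨hT, fun v hv => ?_⟩), rfl⟩
      have hs := latticePoint_mem_support rfl hT hv
      have := h ⟨_, hs⟩ (latticePoint_mem_cone hv)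
      rw [pairing_latticePoint, ← val_cast] at this
      exact_mod_cast this
    · rintro ⟨T, hT, rfl⟩
      obtain ⟨hT, h⟩ := Finset.mem_filter.1 (Finset.mem_coe.1 hT)
      refine ⟨cone_mem_coneFan hT, fun x hx => ?_⟩
      obtain ⟨t, ht, hxt⟩ := mem_cone.1 hx
      rw [PL.apply_eq_sum rfl g hT ht x hxt, ← hxt, pairing_sum_smul]
      exact Finset.sum_le_sum fun v hv =>
        mul_le_mul_of_nonneg_left (by exact_mod_cast h v hv) (ht v hv)
  rw [signedCount, hsub, finsum_mem_image, finsum_mem_coe_finset, fiberCount]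
  · refine Finset.sum_congr (Finset.filter_congr fun T _ => by simp) fun T hT => ?_
    rw [(hD.unimod T (Finset.mem_filter.1 hT).1).coneDim_cone]
  · intro S hS T hT h
    exact (hD.unimod S (Finset.mem_filter.1 hS).1).cone_injective
      (hD.unimod T (Finset.mem_filter.1 hT).1) h

theorem IsFanComplex.fanDim_eq [Module.Free ℤ N] [Module.Finite ℤ N] {D : Finset (Finset N)}
    (hD : IsFanComplex D) (hcomp : ∀ x, ∃ S ∈ D, x ∈ cone S) :
    fanDim (coneFan D) = Module.finrank ℤ N := by
  refine IsGreatest.csSup_eq ⟨?_, ?_⟩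
  · obtain ⟨S, hS, hcard⟩ := hD.exists_card_eq hcomp
    exact ⟨cone S, cone_mem_coneFan hS, by rw [(hD.unimod S hS).coneDim_cone, hcard]⟩
  · rintro _ ⟨_, ⟨S, hS, rfl⟩, rfl⟩
    rw [(hD.unimod S hS).coneDim_cone]
    exact hD.card_le_finrank hS

theorem IsComplete.exists_mem_cone {D : Finset (Finset N)} (h : IsComplete (coneFan D))
    (x : RealSpace N) : ∃ S ∈ D, x ∈ cone S := by
  obtain ⟨_, ⟨S, hS, rfl⟩, hx⟩ := (h.symm ▸ Set.mem_univ x : x ∈ support (coneFan D))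
  exact ⟨S, hS, hx⟩

theorem exists_retraction {N' N'' : Type*} [AddCommGroup N'] [AddCommGroup N'']
    [Module.Free ℤ N''] {i : N' →+ N} {p : N →+ N''} (hi : Function.Injective i)
    (hex : Function.Exact i p) (hp : Function.Surjective p) :
    ∃ r : N →+ N', r.comp i = AddMonoidHom.id N' := by
  obtain ⟨s, hs⟩ := Module.projective_lifting_property p.toIntLinearMap LinearMap.id hp
  have hs' : ∀ x, p (s x) = x := fun x => LinearMap.congr_fun hs x
  have hr : ∀ n, ∃ x, i x = n - s (p n) := fun n =>
    (hex _).1 (by rw [map_sub, hs', sub_self])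
  choose r hr using hr
  refine ⟨AddMonoidHom.mk' r fun a b => hi ?_, ?_⟩
  · rw [map_add, hr, hr, hr, map_add, map_add]
    abel
  · ext x
    apply hi
    change i (r (i x)) = i x
    rw [hr, (hex _).2 ⟨x, rfl⟩, map_zero, sub_zero]

end Translation

/-! ### From fiber bundles of fans to bundles of complexes. -/

namespace IsFiberBundle

variable {N' N N'' : Type*} [AddCommGroup N'] [AddCommGroup N] [AddCommGroup N'']
  {i : N' →+ N} {p : N →+ N''} {D' : Finset (Finset N')} {D'' : Finset (Finset N'')}
  {D : Finset (Finset N)} {L : Set (Cone N)}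

/-- The lattice condition on the lifted subfan makes the lift of a ray generator integral. -/
theorem exists_section (h : IsFiberBundle i p (coneFan D') (coneFan D'') (coneFan D) L) :
    ∃ l : N'' → N, ∀ S ∈ D'', ∀ v ∈ S, latticePoint (l v) ∈ support L ∧ p (l v) = v := by
  have hex : ∀ v : N'', ∃ n : N, ∀ S ∈ D'', v ∈ S → latticePoint n ∈ support L ∧ p n = v := by
    intro v
    by_cases hv : ∃ S ∈ D'', v ∈ S
    · obtain ⟨S, hS, hv⟩ := hv
      obtain ⟨σ, hσ, hmap⟩ := h.lift_bijOn.surjOn (cone_mem_coneFan hS)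
      have hmem : v ∈ latticeSet (PointedCone.map (realMap p) σ) := by
        rw [hmap]
        exact latticePoint_mem_cone hv
      rw [← h.lift_lattice σ hσ] at hmem
      obtain ⟨n, hn, hnv⟩ := hmem
      exact ⟨n, fun _ _ _ => ⟨⟨σ, hσ, hn⟩, hnv⟩⟩
    · exact ⟨0, fun S hS hvS => absurd ⟨S, hS, hvS⟩ hv⟩
  choose l hl using hex
  exact ⟨l, fun S hS v hv => hl v S hS hv⟩

variable {l : N'' → N}

/-- Since `p` is injective on the lifted support, a lifted cone is generated by the lifts of the
generators of its image. -/
theorem eq_cone_of_map_eq (h : IsFiberBundle i p (coneFan D') (coneFan D'') (coneFan D) L)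
    (hl : ∀ S ∈ D'', ∀ v ∈ S, latticePoint (l v) ∈ support L ∧ p (l v) = v)
    {S : Finset N''} (hS : S ∈ D'') {σ : Cone N} (hσ : σ ∈ L)
    (hmap : PointedCone.map (realMap p) σ = cone S) : σ = cone (S.image l) := by
  have hmem : ∀ v ∈ S, latticePoint (l v) ∈ σ := by
    intro v hv
    have h1 : v ∈ latticeSet (PointedCone.map (realMap p) σ) := by
      rw [hmap]
      exact latticePoint_mem_cone hv
    rw [← h.lift_lattice σ hσ] at h1
    obtain ⟨n, hn, hnv⟩ := h1
    have h2 : latticePoint (l v) = latticePoint n :=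
      h.lift_injOn (hl S hS v hv).1 ⟨σ, hσ, hn⟩ (by
        rw [realMap_latticePoint, realMap_latticePoint, (hl S hS v hv).2, hnv])
    rw [h2]
    exact hn
  refine le_antisymm (fun y hy => ?_) (cone_le fun n hn => ?_)
  · have h1 : realMap p y ∈ cone S := hmap ▸ PointedCone.mem_map.2 ⟨y, hy, rfl⟩
    obtain ⟨t, ht, hty⟩ := mem_cone.1 h1
    have h2 : y = ∑ v ∈ S, t v • latticePoint (l v) := by
      refine h.lift_injOn ⟨σ, hσ, hy⟩ ⟨σ, hσ, Submodule.sum_mem _ fun v hv =>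
        Cone.smul_mem (hmem v hv) (ht v hv)⟩ ?_
      rw [← hty, map_sum]
      exact Finset.sum_congr rfl fun v hv => by
        rw [map_smul, realMap_latticePoint, (hl S hS v hv).2]
    rw [h2]
    exact Submodule.sum_mem _ fun v hv =>
      Cone.smul_mem (latticePoint_mem_cone (Finset.mem_image_of_mem _ hv)) (ht v hv)
  · obtain ⟨v, hv, rfl⟩ := Finset.mem_image.1 hn
    exact hmem v hv

/-- Dual functions of base vertices are pulled back along `p`. Those of fiber vertices are pulled
back along a retraction and corrected by a function on `N''` so as to vanish on the section. -/
theorem isUnimod_join [Module.Free ℤ N'']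
    (h : IsFiberBundle i p (coneFan D') (coneFan D'') (coneFan D) L)
    (hl : ∀ S ∈ D'', ∀ v ∈ S, latticePoint (l v) ∈ support L ∧ p (l v) = v)
    {S' : Finset N'} (hS' : IsUnimod S') {S'' : Finset N''} (hS'' : IsUnimod S'')
    (hmem : S'' ∈ D'') : IsUnimod (S'.image i ∪ S''.image l) := by
  obtain ⟨r, hr⟩ := exists_retraction h.inclusion_injective h.exact h.projection_surjective
  have hr' : ∀ x, r (i x) = x := fun x => DFunLike.congr_fun hr x
  have hpi : ∀ x, p (i x) = 0 := fun x => (h.exact _).2 ⟨x, rfl⟩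
  intro u hu
  rcases Finset.mem_union.1 hu with hu | hu
  · obtain ⟨x, hx, rfl⟩ := Finset.mem_image.1 hu
    obtain ⟨c, hc⟩ := hS''.exists_eq (fun v => hS'.dual x (r (l v)))
    refine ⟨(hS'.dual x).comp r - c.comp p, ?_, fun n hn hne => ?_⟩
    · simp [hr', hpi, hS'.dual_apply hx hx]
    · rcases Finset.mem_union.1 hn with hn | hn
      · obtain ⟨y, hy, rfl⟩ := Finset.mem_image.1 hn
        have hyx : y ≠ x := fun h => hne (h ▸ rfl)
        simp [hr', hpi, hS'.dual_apply hx hy, hyx]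
      · obtain ⟨v, hv, rfl⟩ := Finset.mem_image.1 hn
        simp [(hl S'' hmem v hv).2, hc v hv]
  · obtain ⟨v, hv, rfl⟩ := Finset.mem_image.1 hu
    refine ⟨(hS''.dual v).comp p, ?_, fun n hn hne => ?_⟩
    · simp [(hl S'' hmem v hv).2, hS''.dual_apply hv hv]
    · rcases Finset.mem_union.1 hn with hn | hn
      · obtain ⟨y, hy, rfl⟩ := Finset.mem_image.1 hn
        simp [hpi]
      · obtain ⟨w, hw, rfl⟩ := Finset.mem_image.1 hn
        have hwv : w ≠ v := fun h => hne (h ▸ rfl)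
        simp [(hl S'' hmem w hw).2, hS''.dual_apply hv hw, hwv]

theorem isComplexBundle [Module.Free ℤ N] [Module.Free ℤ N'']
    (h : IsFiberBundle i p (coneFan D') (coneFan D'') (coneFan D) L)
    (hD' : IsFanComplex D') (hD'' : IsFanComplex D'') (hD : IsFanComplex D)
    (hl : ∀ S ∈ D'', ∀ v ∈ S, latticePoint (l v) ∈ support L ∧ p (l v) = v) :
    IsComplexBundle i p l D' D'' D := by
  refine ⟨h.inclusion_injective, h.exact, h.projection_surjective, hD', hD'', hD,
    fun S hS v hv => (hl S hS v hv).2, fun T => ⟨fun hT => ?_, ?_⟩⟩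
  · obtain ⟨⟨_, σ⟩, ⟨⟨S', hS', rfl⟩, hσ⟩, hsum⟩ := h.sum_bijOn.surjOn (cone_mem_coneFan hT)
    obtain ⟨S'', hS'', hmap⟩ := h.lift_bijOn.mapsTo hσ
    obtain rfl := h.eq_cone_of_map_eq hl hS'' hσ hmap.symm
    refine ⟨S', hS', S'', hS'', (hD.unimod T hT).cone_injective
      (h.isUnimod_join hl (hD'.unimod S' hS') (hD''.unimod S'' hS'') hS'') ?_⟩
    rw [cone_union, ← map_cone]
    exact hsum.symm
  · rintro ⟨S', hS', S'', hS'', rfl⟩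
    obtain ⟨σ, hσ, hmap⟩ := h.lift_bijOn.surjOn (cone_mem_coneFan hS'')
    obtain rfl := h.eq_cone_of_map_eq hl hS'' hσ hmap
    obtain ⟨T, hT, hcone⟩ := h.sum_bijOn.mapsTo
      (show (cone S', cone (S''.image l)) ∈ coneFan D' ×ˢ L from ⟨cone_mem_coneFan hS', hσ⟩)
    have : T = S'.image i ∪ S''.image l := by
      refine (hD.unimod T hT).cone_injective
        (h.isUnimod_join hl (hD'.unimod S' hS') (hD''.unimod S'' hS'') hS'') ?_
      rw [hcone, cone_union, ← map_cone]
    exact this ▸ hT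

theorem val_fiberPart (h : IsFiberBundle i p (coneFan D') (coneFan D'') (coneFan D) L)
    (f : PL (coneFan D)) {S : Finset N'} (hS : S ∈ D') {x : N'} (hx : x ∈ S) :
    val (h.fiberPart f) x = val f (i x) := by
  have hs := latticePoint_mem_support rfl hS hx
  have hs' : latticePoint (i x) ∈ support (coneFan D) := by
    rw [← realMap_latticePoint]
    exact h.fiber_mem_support hs
  rw [val_eq_iff _ hs, val_cast _ hs']
  exact congrArg f.1 (Subtype.ext (realMap_latticePoint i x))

theorem section_mem_support (h : IsFiberBundle i p (coneFan D') (coneFan D'') (coneFan D) L)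
    (hl : ∀ S ∈ D'', ∀ v ∈ S, latticePoint (l v) ∈ support L ∧ p (l v) = v)
    {S : Finset N''} (hS : S ∈ D'') {v : N''} (hv : v ∈ S) :
    latticePoint (l v) ∈ support (coneFan D) := by
  obtain ⟨σ, hσ, hmem⟩ := (hl S hS v hv).1
  exact ⟨σ, h.lift_subset hσ, hmem⟩

theorem val_basePart (h : IsFiberBundle i p (coneFan D') (coneFan D'') (coneFan D) L)
    (hl : ∀ S ∈ D'', ∀ v ∈ S, latticePoint (l v) ∈ support L ∧ p (l v) = v)
    (f : PL (coneFan D)) {S : Finset N''} (hS : S ∈ D'') {v : N''} (hv : v ∈ S) :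
    val (h.basePart f) v = val f (l v) := by
  have hs := latticePoint_mem_support rfl hS hv
  have hs' := h.section_mem_support hl hS hv
  rw [val_eq_iff _ hs, val_cast _ hs']
  exact h.basePart_apply f ⟨_, hs'⟩ (hl S hS v hv).1 _ (by
    rw [realMap_latticePoint, (hl S hS v hv).2])

end IsFiberBundle

end EhrhartFan
end

/-! ### Proof of the proposition. -/

theorem mainTheorem6 {N' N N'' : Type*} [AddCommGroup N'] [AddCommGroup N] [AddCommGroup N'']
    [Module.Free ℤ N'] [Module.Free ℤ N] [Module.Free ℤ N'']
    [Module.Finite ℤ N'] [Module.Finite ℤ N] [Module.Finite ℤ N'']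
    (i : N' →+ N) (p : N →+ N'')
    (F' : Set (EhrhartFan.Cone N')) (F'' : Set (EhrhartFan.Cone N''))
    (F L : Set (EhrhartFan.Cone N))
    (h : EhrhartFan.IsFiberBundle i p F' F'' F L)
    (hcomplete : EhrhartFan.IsComplete F') :
    (EhrhartFan.IsEhrhart F ↔ EhrhartFan.IsEhrhart F'') ∧
    ∀ (χ : EhrhartFan.ReducedPL F → ℤ) (χ'' : EhrhartFan.ReducedPL F'' → ℤ),
      EhrhartFan.IsEhrhartPolynomial F χ → EhrhartFan.IsEhrhartPolynomial F'' χ'' →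
      ∀ r : N →+ N', r.comp i = AddMonoidHom.id N' →
      ∀ f : EhrhartFan.PL F,
        {m' : N' →+ ℤ | EhrhartFan.signedCount (h.fiberPart f) m' ≠ 0}.Finite ∧
        χ (EhrhartFan.plClass f) =
          (-1) ^ EhrhartFan.fanDim F' *
            ∑ᶠ m' : N' →+ ℤ, EhrhartFan.signedCount (h.fiberPart f) m' *
              χ'' (EhrhartFan.plClass
                (h.basePart (f - EhrhartFan.linearPL F (m'.comp r)))) := by
  obtain ⟨D', hD', rfl⟩ := h.fiber_unimodular.exists_complex
  obtain ⟨D'', hD'', rfl⟩ := h.base_unimodular.exists_complex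
  obtain ⟨D, hD, rfl⟩ := h.total_unimodular.exists_complex
  obtain ⟨l, hl⟩ := h.exists_section
  have hb := h.isComplexBundle hD' hD'' hD hl
  have hcomp := hcomplete.exists_mem_cone
  have hfun : ∀ {X : (N'' → ℤ) → ℤ}, EhrhartFan.IsEhrhartFunction D'' ∅ X → ∀ r : N →+ N',
      r.comp i = AddMonoidHom.id N' → EhrhartFan.IsEhrhartFunction D ∅
        (EhrhartFan.IsComplexBundle.bundleFunction r l i D' ∅ X) := fun hX r hr => by
    simpa using hb.isEhrhartFunction_bundleFunction hcomp (fun x => DFunLike.congr_fun hr x) hX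
      hD''.empty_mem hD'.empty_mem
  refine ⟨⟨?_, ?_⟩, ?_⟩
  · rintro ⟨χ, hχ⟩
    -- The whole fan is its own star at the empty set, with the identity as quotient map.
    obtain ⟨X, hX, -⟩ := hχ.exists_isEhrhartFunction hD.isStarModel_id
    have hX'' := hb.isEhrhartFunction_pullback hX hD''.empty_mem (by simp)
    obtain ⟨χ'', hχ''⟩ := hX''.exists_eq hD''.isStarModel_id
    exact ⟨χ'', hX''.isEhrhartPolynomial hD''.isStarModel_id χ'' hχ''⟩
  · rintro ⟨χ'', hχ''⟩
    obtain ⟨X'', hX'', -⟩ := hχ''.exists_isEhrhartFunction hD''.isStarModel_id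
    obtain ⟨r, hr⟩ := EhrhartFan.exists_retraction h.inclusion_injective h.exact
      h.projection_surjective
    have hX := hfun hX'' r hr
    obtain ⟨χ, hχ⟩ := hX.exists_eq hD.isStarModel_id
    exact ⟨χ, hX.isEhrhartPolynomial hD.isStarModel_id χ hχ⟩
  · intro χ χ'' hχ hχ'' r hr f
    obtain ⟨X, hX, hXf⟩ := hχ.exists_isEhrhartFunction hD.isStarModel_id
    obtain ⟨X'', hX'', hXf''⟩ := hχ''.exists_isEhrhartFunction hD''.isStarModel_id
    have hcount : ∀ m, EhrhartFan.signedCount (h.fiberPart f) m =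
        EhrhartFan.fiberCount D' ∅ (EhrhartFan.val f ∘ i) m := fun m => by
      rw [hD'.signedCount_eq]
      exact EhrhartFan.fiberCount_congr hD'.empty_mem
        (fun T hT _ v hv => h.val_fiberPart f hT hv) m
    simp only [hcount]
    refine ⟨hD'.finite_fiberCount hcomp hD'.empty_mem _, ?_⟩
    -- The function of the given `χ` and the bundle function built from `χ''` satisfy the same
    -- recursion, so they coincide.
    rw [← hXf _ f (hD.isStarModel_id.isRep_val f),
      hX.unique hD hD.empty_mem (hfun hX'' r hr), hD'.fanDim_eq hcomp]
    refine congrArg _ (finsum_congr fun m => congrArg _ ?_)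
    rw [← hXf'' _ _ (hD''.isStarModel_id.isRep_val _)]
    refine hX''.congr fun T hT _ v hv => ?_
    have h1 := h.val_basePart hl (f - EhrhartFan.linearPL _ (m.comp r)) hT hv
    rw [EhrhartFan.val_sub, Pi.sub_apply,
      EhrhartFan.val_linearPL _ (h.section_mem_support hl hT hv)] at h1
    exact h1.symm
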